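/- **Setting.** A $d$-dimensional cellular automaton $A=(d,S,N,f)$ consists of a state set $S=\{0,1,\dots,m\}$, a neighborhood $N=(x_1,\dots,x_v)$ of $v\ge 1$ pairwise distinct vectors of $\mathbb Z^d$, and a local function $f:S^v\to S$. It acts on configurations $c:\mathbb Z^d\to S$ by $A(c)(i)=f(c(i+x_1),\dots,c(i+x_v))$. It is *number-conserving* if, for every configuration $c$ that is zero outside a finite set, $A(c)$ is also zero outside a finite set and $\sum_{i\in\mathbb Z^d}c(i)=\sum_{i\in\mathbb Z^d}A(c)(i)$. Its *transition table* has one row for each $p\in S^v$, listing the $v$ states of $p$ and the new state $f(p)$; the *size* $s=(v+1)(m+1)^v$ of the table is the number of states written in it. A *random access machine* has finitely many integer registers and an integer memory indexed by $\mathbb Z$. Its programs are built from the assignments $x:=n$, $x:=y+z$, $x:=y-z$, $x:=\mathrm{mem}[y]$, $\mathrm{mem}[x]:=y$ by composition, "if $x>0$ then … else …" and "while $x>0$ do …". Every assignment that does not access the memory, and every test, takes time $1$. The input $d,v,m$, the coordinates of $x_1,\dots,x_v$, and the table, row by row, is stored in the first memory cells; all other cells and all registers are $0$. **Theorem.** There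 is one program which, given any cellular automaton of any dimension, halts and decides whether it is number-conserving, and for each dimension $d$ there is a constant $C_d$ such that for every $d$-dimensional cellular automaton with a transition table of size $s$ 1. the running time is at most $C_d\,s$ if each memory access takes time $1$; 2. the running time is at most $C_d\,s\lfloor\log_2 s\rfloor$ if each access to the memory cell with address $a$ takes time $1$ plus the number of binary digits of $|a|$. The program thereby also decides whether $A$ conserves the number on periodic configurations (for every $c$ with a period $\pi_i>0$ in each coordinate direction $i$, the sums of $c(k)$ and of $A(c)(k)$ over $0\le k_i<\pi_i$ agree), and, for $d=1$, whether $\mu_n(c)/\mu_n(A(c))\to 1$ as $n\to\infty$ for every configuration $c$, where $\mu_n$ is the sum of the states in $\{-n,\dots,n\}$ and $0/0$ counts as $1$. -/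

import Mathlib

/-! ### Cellular automata and number conservation -/

/-- A `d`-dimensional cellular automaton `(d, S, N, f)`: states `S = {0, …, maxState}`, a neighborhood
`N` of `arity` pairwise distinct vectors of `ℤ^d`, and a local function `f : S^arity → S`. -/
structure CellularAutomaton (d : ℕ) where
  /-- the largest state -/
  maxState : ℕ
  /-- the number of neighbors -/
  arity : ℕ
  /-- the relative positions of the neighbors -/
  neighbor : Fin arity ↪ (Fin d → ℤ)
  /-- the local function -/
  rule : (Fin arity → Fin (maxState + 1)) → Fin (maxState + 1)

namespace CellularAutomaton

variable {d : ℕ}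

/-- Configurations: maps from `ℤ^d` to the set of states. -/
abbrev Config (A : CellularAutomaton d) : Type := (Fin d → ℤ) → Fin (A.maxState + 1)

/-- The global function: `A(c)(i) = f(c(i + x₁), …, c(i + x_v))`. -/
def step (A : CellularAutomaton d) (c : A.Config) : A.Config :=
  fun i => A.rule fun k => c (i + A.neighbor k)

/-- Number conservation on finite configurations: if `c` is zero outside a finite set, then so is
`A(c)`, and both have the same sum of states. -/
def FiniteNumberConserving (A : CellularAutomaton d) : Prop :=
  ∀ c : A.Config, {i | c i ≠ 0}.Finite →
    {i | A.step c i ≠ 0}.Finite ∧ ∑ᶠ i, (c i : ℕ) = ∑ᶠ i, (A.step c i : ℕ)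

/-- Number conservation on periodic configurations: if `c` has the positive period `π i` in each
direction `i`, then `c` and `A(c)` have the same sum of states over the period
`{k | 0 ≤ k i < π i}`. -/
def PeriodicNumberConserving (A : CellularAutomaton d) : Prop :=
  ∀ (π : Fin d → ℕ), (∀ i, 0 < π i) → ∀ c : A.Config,
    (∀ k i, c (k + Pi.single i (π i : ℤ)) = c k) →
      ∑ k ∈ Fintype.piFinset (fun i => Finset.Ico (0 : ℤ) (π i)), (c k : ℕ) =
        ∑ k ∈ Fintype.piFinset (fun i => Finset.Ico (0 : ℤ) (π i)), (A.step c k : ℕ)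

/-- The sum of the states of `c` in the window `{-n, …, n}^d`. -/
noncomputable def windowSum (A : CellularAutomaton d) (n : ℕ) (c : A.Config) : ℕ :=
  ∑ k ∈ Fintype.piFinset (fun _ : Fin d => Finset.Icc (-(n : ℤ)) n), (c k : ℕ)

open Classical in
/-- Number conservation through windows: the ratio of the window sums of `c` and `A(c)` tends to `1`
for every configuration `c`. The ratio `0 / 0` counts as `1`. -/
noncomputable def WindowNumberConserving (A : CellularAutomaton d) : Prop :=
  ∀ c : A.Config, Filter.Tendsto
    (fun n : ℕ => if A.windowSum n c = 0 ∧ A.windowSum n (A.step c) = 0 then (1 : ℝ)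
      else (A.windowSum n c : ℝ) / (A.windowSum n (A.step c) : ℝ))
    Filter.atTop (nhds 1)

/-! ### The transition table -/

/-- The row of the transition table for the neighborhood state `p`: the `arity` entries of `p`,
followed by the new state `f p`. -/
def tableRow (A : CellularAutomaton d) (p : Fin A.arity → Fin (A.maxState + 1)) : List ℤ :=
  (List.ofFn fun k => ((p k : ℕ) : ℤ)) ++ [((A.rule p : ℕ) : ℤ)]

/-- The transition table: the rows of all `(maxState + 1) ^ arity` neighborhood states `p`, in the
order of the numbers `∑ k, p k * (maxState + 1) ^ k`. -/
def table (A : CellularAutomaton d) : List ℤ :=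
  (List.ofFn fun r : Fin ((A.maxState + 1) ^ A.arity) =>
    A.tableRow (finFunctionFinEquiv.symm r)).flatten

/-- The size of the transition table, that is, the number of states written in it. -/
def tableSize (A : CellularAutomaton d) : ℕ := A.table.length

/-- The description of a cellular automaton that is given to a machine: the dimension, the number of
neighbors and the largest state, then the coordinates of the neighbors, then the table. -/
def encode (A : CellularAutomaton d) : List ℤ :=
  [(d : ℤ), (A.arity : ℤ), (A.maxState : ℤ)] ++
    (List.ofFn fun k => List.ofFn (A.neighbor k)).flatten ++ A.table

end CellularAutomaton

/-! ### Random access machines -/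

namespace RAM

/-- Programs of a random access machine with registers and a memory that hold integers. There is no
multiplication. -/
inductive Prog : Type
  /-- `x := n` -/
  | const (x : ℕ) (n : ℤ)
  /-- `x := y + z` -/
  | add (x y z : ℕ)
  /-- `x := y - z` -/
  | sub (x y z : ℕ)
  /-- `x := mem[y]` -/
  | load (x y : ℕ)
  /-- `mem[x] := y` -/
  | store (x y : ℕ)
  /-- `p; q` -/
  | seq (p q : Prog)
  /-- `if 0 < x then p else q` -/
  | ite (x : ℕ) (p q : Prog)
  /-- `while 0 < x do p` -/
  | loop (x : ℕ) (p : Prog)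

/-- The contents of the registers and of the memory. -/
structure State : Type where
  /-- the registers -/
  reg : ℕ → ℤ
  /-- the memory -/
  mem : ℤ → ℤ

/-- The state `s` with the register `x` set to `n`. -/
def State.setReg (s : State) (x : ℕ) (n : ℤ) : State :=
  { s with reg := Function.update s.reg x n }

/-- The state `s` with the memory cell `a` set to `n`. -/
def State.setMem (s : State) (a n : ℤ) : State :=
  { s with mem := Function.update s.mem a n }

/-- `Exec κ p s s' t`: started in `s`, the program `p` halts in `s'` after time `t`. An access to the
memory cell `a` takes time `κ a`, every other assignment and every test takes time `1`. -/
inductive Exec (κ : ℤ → ℕ) : Prog → State → State → ℕ → Prop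
  | const (x : ℕ) (n : ℤ) (s : State) : Exec κ (.const x n) s (s.setReg x n) 1
  | add (x y z : ℕ) (s : State) : Exec κ (.add x y z) s (s.setReg x (s.reg y + s.reg z)) 1
  | sub (x y z : ℕ) (s : State) : Exec κ (.sub x y z) s (s.setReg x (s.reg y - s.reg z)) 1
  | load (x y : ℕ) (s : State) :
      Exec κ (.load x y) s (s.setReg x (s.mem (s.reg y))) (κ (s.reg y))
  | store (x y : ℕ) (s : State) :
      Exec κ (.store x y) s (s.setMem (s.reg x) (s.reg y)) (κ (s.reg x))
  | seq {p q : Prog} {s₁ s₂ s₃ : State} {t u : ℕ} :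
      Exec κ p s₁ s₂ t → Exec κ q s₂ s₃ u → Exec κ (.seq p q) s₁ s₃ (t + u)
  | ite_pos {x : ℕ} {p q : Prog} {s s' : State} {t : ℕ} :
      0 < s.reg x → Exec κ p s s' t → Exec κ (.ite x p q) s s' (t + 1)
  | ite_neg {x : ℕ} {p q : Prog} {s s' : State} {t : ℕ} :
      ¬ 0 < s.reg x → Exec κ q s s' t → Exec κ (.ite x p q) s s' (t + 1)
  | loop_pos {x : ℕ} {p : Prog} {s₁ s₂ s₃ : State} {t u : ℕ} :
      0 < s₁.reg x → Exec κ p s₁ s₂ t → Exec κ (.loop x p) s₂ s₃ u →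
        Exec κ (.loop x p) s₁ s₃ (t + u + 1)
  | loop_neg {x : ℕ} {p : Prog} {s : State} :
      ¬ 0 < s.reg x → Exec κ (.loop x p) s s 1

/-- Every memory access takes constant time. -/
def constantAccess : ℤ → ℕ := fun _ => 1

/-- A memory access takes time `1` plus the number of binary digits of the address. -/
def logarithmicAccess : ℤ → ℕ := fun a => Nat.size a.natAbs + 1

/-- The initial state on the input `l`: the entries of `l` stand in the memory cells
`0, 1, …, l.length - 1`, and every other cell and every register is zero. -/
def initial (l : List ℤ) : State where
  reg := fun _ => 0
  mem := fun a => if 0 ≤ a then l.getD a.toNat 0 else 0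

end RAM

/-! Write q for the number of states and v for the number of neighbors. Conservation means that the
total of a local observable, the new state minus the state of a fixed neighbor (`excess`), vanishes
on finite configurations. If no translate of the neighborhood covers the support S of c, then every
window misses a cell of S. Toggling that cell cancels the window's contributions in the alternating
sum over the restrictions of c to subsets of S, so the total of c is determined by smaller
configurations. Hence, besides f(0) = 0, only configurations supported in the neighborhood need
testing (`total_eq_zero_of_spread`).

These are ordered by row number. The row a * q^j + r with leading digit a ≠ 0 differs from the row r
in one cell only, and exactly v translates of the neighborhood see that cell. This gives one
equation with v terms per nonzero row (`finiteNumberConserving_iff_forall_row`).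

To evaluate all terms in linear time, fix the leading neighbor j and the neighbor k placed on its
cell. The table offset of the shifted neighborhood state is linear in the digits of r
(`shiftCode_add`, `shiftCode_eq`). So the offsets for all r < q^j arise by repeatedly copying a list
with a constant increment, at constant cost per entry, and a further digit a at j adds a times the
weight of k. Summed over j and k this is O(v * q^v), hence linear in the table size s. Finding the
increments compares all quadruples of neighbors in time O(d * v^4), which is absorbed because v^4 ≤
21 * 2^v and q ≥ 2. The case q = 1 is trivial and treated apart. All addresses are at most (d + 6) *
s, so with logarithmic access every step costs O(log s) for fixed d.

For periodic configurations and for windows, a conserving automaton changes the sum over a finite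
set by at most a boundary term (`abs_sum_sub_sum_step_le`). This is negligible over many periods,
and bounded for intervals. Conversely, the configurations of the test fit into a large torus, and
window sums of finite configurations are eventually constant. -/

set_option linter.unusedSimpArgs false

/-! ### Reduction to configurations supported in the neighborhood. -/

namespace CellularAutomaton

variable {d : ℕ}

/-- The configuration that shows `p` on the neighborhood of the origin and is zero elsewhere. -/
noncomputable def spread (A : CellularAutomaton d) (p : Fin A.arity → Fin (A.maxState + 1)) :
    A.Config :=
  Function.extend A.neighbor p 0

/-- The sum of a local observable `g` over all translates of the neighborhood. -/
noncomputable def total (A : CellularAutomaton d)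
    (g : (Fin A.arity → Fin (A.maxState + 1)) → ℤ) (c : A.Config) : ℤ :=
  ∑ᶠ i, g fun k => c (i + A.neighbor k)

/-- The configuration `c` restricted to `K`. -/
def restrict (A : CellularAutomaton d) (c : A.Config) (K : Finset (Fin d → ℤ)) : A.Config :=
  fun y => if y ∈ K then c y else 0

variable {A : CellularAutomaton d} {g : (Fin A.arity → Fin (A.maxState + 1)) → ℤ}

theorem spread_neighbor (p : Fin A.arity → Fin (A.maxState + 1)) (k : Fin A.arity) :
    A.spread p (A.neighbor k) = p k :=
  A.neighbor.injective.extend_apply _ _ _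

theorem spread_of_notMem (p : Fin A.arity → Fin (A.maxState + 1)) {y : Fin d → ℤ}
    (h : ∀ k, A.neighbor k ≠ y) : A.spread p y = 0 := by
  rw [spread, Function.extend_apply' _ _ _ (by simpa using h)]; rfl

theorem finite_support_spread (p : Fin A.arity → Fin (A.maxState + 1)) :
    {i | A.spread p i ≠ 0}.Finite := by
  refine (Set.finite_range A.neighbor).subset fun y hy => ?_
  by_contra h
  exact hy (spread_of_notMem p fun k hk => h ⟨k, hk⟩)

/-- The translates of the neighborhood that meet the finite set `S`. -/
def windows (A : CellularAutomaton d) (S : Finset (Fin d → ℤ)) : Finset (Fin d → ℤ) :=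
  Finset.univ.biUnion fun k => S.image fun y => y - A.neighbor k

theorem mem_windows {S : Finset (Fin d → ℤ)} {i : Fin d → ℤ} :
    i ∈ A.windows S ↔ ∃ k, i + A.neighbor k ∈ S := by
  simp only [windows, Finset.mem_biUnion, Finset.mem_univ, true_and, Finset.mem_image]
  constructor
  · rintro ⟨k, y, hy, rfl⟩
    exact ⟨k, by simpa using hy⟩
  · rintro ⟨k, hk⟩
    exact ⟨k, _, hk, by simp⟩

theorem window_eq_zero {S : Finset (Fin d → ℤ)} {c : A.Config} (hc : ∀ y, c y ≠ 0 → y ∈ S)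
    {i : Fin d → ℤ} (hi : i ∉ A.windows S) : (fun k => c (i + A.neighbor k)) = 0 := by
  funext k
  by_contra h
  exact hi (mem_windows.2 ⟨k, hc _ h⟩)

theorem total_eq_sum (hg : g 0 = 0) {S : Finset (Fin d → ℤ)} {c : A.Config}
    (hc : ∀ y, c y ≠ 0 → y ∈ S) :
    A.total g c = ∑ i ∈ A.windows S, g fun k => c (i + A.neighbor k) := by
  refine finsum_eq_sum_of_support_subset _ fun i hi => ?_
  by_contra h
  exact hi (by simp only [window_eq_zero hc h, hg])

theorem total_translate (c : A.Config) (t : Fin d → ℤ) :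
    A.total g (fun y => c (t + y)) = A.total g c := by
  simpa [total, add_assoc] using
    finsum_comp_equiv (Equiv.addLeft t) (f := fun i => g fun k => c (i + A.neighbor k))

/-- The window at `i` does not see `y`, so `K` and `insert y K` show the same pattern there and
enter with opposite signs. -/
theorem alternating_sum_eq_zero {S : Finset (Fin d → ℤ)} {c : A.Config} {i y : Fin d → ℤ}
    (hy : y ∈ S) (h : ∀ k, i + A.neighbor k ≠ y) :
    ∑ K ∈ S.powerset, (-1 : ℤ) ^ K.card * g (fun k => A.restrict c K (i + A.neighbor k)) = 0 := by
  classical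
  rw [← Finset.insert_erase hy, Finset.sum_powerset_insert (Finset.notMem_erase y S),
    ← Finset.sum_add_distrib]
  refine Finset.sum_eq_zero fun K hK => ?_
  have hyK : y ∉ K := fun hh => Finset.notMem_erase y S (Finset.mem_powerset.1 hK hh)
  have : (fun k => A.restrict c (insert y K) (i + A.neighbor k)) =
      fun k => A.restrict c K (i + A.neighbor k) := by
    funext k
    simp [restrict, h k]
  rw [this, Finset.card_insert_of_notMem hyK, pow_succ]
  ring

/-- An observable whose total vanishes on the configurations supported in the neighborhood has
vanishing total on all finite configurations. -/
theorem total_eq_zero_of_spread (hg : g 0 = 0) (h : ∀ p, A.total g (A.spread p) = 0)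
    (c : A.Config) (hc : {i | c i ≠ 0}.Finite) : A.total g c = 0 := by
  classical
  induction hn : hc.toFinset.card using Nat.strong_induction_on generalizing c with
  | _ n ih =>
  set S := hc.toFinset with hS
  have hcS : ∀ y, c y ≠ 0 ↔ y ∈ S := fun y => by simp [hS]
  -- Either one translate of the neighborhood covers the support, and `c` is a translate of a
  -- spread, or every window misses a cell of `S` and inclusion–exclusion applies.
  by_cases hcov : ∃ i, ∀ y ∈ S, ∃ k, i + A.neighbor k = y
  · obtain ⟨i, hi⟩ := hcov
    rw [← h fun k => c (i + A.neighbor k), ← total_translate c i]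
    congr 1
    funext y
    by_cases hy : ∃ k, A.neighbor k = y
    · obtain ⟨k, rfl⟩ := hy
      rw [spread_neighbor]
    · rw [spread_of_notMem _ fun k hk => hy ⟨k, hk⟩]
      by_contra hne
      obtain ⟨k, hk⟩ := hi _ ((hcS _).1 hne)
      exact hy ⟨k, add_left_cancel hk⟩
  · push Not at hcov
    have hsub : ∀ K ∈ S.powerset, ∀ y, A.restrict c K y ≠ 0 → y ∈ S := fun K hK y hy => by
      by_cases hyK : y ∈ K
      · exact Finset.mem_powerset.1 hK hyK
      · simp [restrict, hyK] at hy
    have h1 : ∑ K ∈ S.powerset, (-1 : ℤ) ^ K.card * A.total g (A.restrict c K) = 0 := by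
      rw [Finset.sum_congr rfl fun K hK => by rw [total_eq_sum hg (hsub K hK), Finset.mul_sum],
        Finset.sum_comm]
      refine Finset.sum_eq_zero fun i _ => ?_
      obtain ⟨y, hy, hy'⟩ := hcov i
      exact alternating_sum_eq_zero hy hy'
    -- The proper restrictions have smaller support, so by induction only the term of `S` itself
    -- remains.
    rw [Finset.sum_eq_single_of_mem S (Finset.mem_powerset_self S)] at h1
    · have : A.restrict c S = c := by
        funext y
        by_cases hy : y ∈ S
        · simp [restrict, hy]
        · simp only [restrict, hy, if_false]
          exact (not_not.1 fun hh => hy ((hcS y).1 (Ne.symm hh)))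
      rw [this] at h1
      exact (mul_eq_zero.1 h1).resolve_left (pow_ne_zero _ (by norm_num))
    · intro K hK hKS
      have hfin : {i | A.restrict c K i ≠ 0}.Finite :=
        S.finite_toSet.subset fun y hy => hsub K hK y hy
      rw [ih _ ?_ (A.restrict c K) hfin rfl, mul_zero]
      rw [← hn]
      refine Finset.card_lt_card (lt_of_le_of_lt (b := K) (fun y hy => ?_)
        ((Finset.mem_powerset.1 hK).lt_of_ne hKS))
      by_contra hyK
      simp [restrict, hyK] at hy

/-- The difference between the new state and the state of the neighbor `k₀`. -/
def excess (A : CellularAutomaton d) (k₀ : Fin A.arity) (p : Fin A.arity → Fin (A.maxState + 1)) :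
    ℤ :=
  ((A.rule p : ℕ) : ℤ) - ((p k₀ : ℕ) : ℤ)

theorem finite_support_step (h0 : A.rule 0 = 0) {c : A.Config} (hc : {i | c i ≠ 0}.Finite) :
    {i | A.step c i ≠ 0}.Finite := by
  refine (A.windows hc.toFinset).finite_toSet.subset fun i hi => ?_
  by_contra h
  refine hi ?_
  rw [step, window_eq_zero (S := hc.toFinset) (fun y hy => by simpa using hy) h, h0]

theorem finsum_cast {c : A.Config} (hc : {i | c i ≠ 0}.Finite) :
    ((∑ᶠ i, (c i : ℕ) : ℕ) : ℤ) = ∑ᶠ i, ((c i : ℕ) : ℤ) := by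
  rw [← Nat.coe_castAddMonoidHom, AddMonoidHom.map_finsum]
  · exact hc.subset fun i hi h => hi (by simp [h])

/-- Summing the state of the neighbor `k₀` over all windows is a translated sum of `c`, so any
choice of `k₀` turns conservation into the vanishing of a total. -/
theorem total_excess (h0 : A.rule 0 = 0) (k₀ : Fin A.arity) {c : A.Config}
    (hc : {i | c i ≠ 0}.Finite) :
    A.total (A.excess k₀) c =
      ((∑ᶠ i, (A.step c i : ℕ) : ℕ) : ℤ) - ((∑ᶠ i, (c i : ℕ) : ℕ) : ℤ) := by
  rw [finsum_cast hc, finsum_cast (finite_support_step h0 hc),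
    ← finsum_comp_equiv (Equiv.addRight (A.neighbor k₀)) (f := fun i => ((c i : ℕ) : ℤ)),
    ← finsum_sub_distrib]
  · rfl
  · exact (finite_support_step h0 hc).subset fun i hi h => hi (by simp [h])
  · refine (hc.preimage (Equiv.addRight (A.neighbor k₀)).injective.injOn).subset
      fun i hi h => hi ?_
    simp only [h]; rfl

theorem excess_zero (h0 : A.rule 0 = 0) (k₀ : Fin A.arity) : A.excess k₀ 0 = 0 := by
  simp [excess, h0]

theorem rule_zero_of_finite (h : A.FiniteNumberConserving) : A.rule 0 = 0 := by
  obtain ⟨h1, h2⟩ := h 0 (by simp)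
  by_contra hne
  have hs : ∀ i, A.step 0 i = A.rule 0 := fun i => rfl
  simp only [hs] at h1 h2
  -- In dimension 0 the space is finite and the support condition gives no contradiction; there the
  -- equality of the sums does.
  have : Finite (Fin d → ℤ) := Set.finite_univ_iff.1 (h1.subset fun _ _ => hne)
  have := Fintype.ofFinite (Fin d → ℤ)
  rw [finsum_eq_sum_of_fintype, finsum_eq_sum_of_fintype] at h2
  simp at h2
  exact hne h2

/-- A cellular automaton is number-conserving if and only if it is so on the configurations
supported in its neighborhood. -/
theorem finiteNumberConserving_iff_total (k₀ : Fin A.arity) :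
    A.FiniteNumberConserving ↔
      A.rule 0 = 0 ∧ ∀ p, A.total (A.excess k₀) (A.spread p) = 0 := by
  constructor
  · intro h
    have h0 := rule_zero_of_finite h
    refine ⟨h0, fun p => ?_⟩
    rw [total_excess h0 k₀ (finite_support_spread p), (h _ (finite_support_spread p)).2, sub_self]
  · rintro ⟨h0, h⟩ c hc
    refine ⟨finite_support_step h0 hc, ?_⟩
    have := total_eq_zero_of_spread (excess_zero h0 k₀) h c hc
    rw [total_excess h0 k₀ hc] at this
    omega

end CellularAutomaton

/-! ### One equation for each nonzero row of the transition table. -/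

namespace CellularAutomaton

variable {d : ℕ} {A : CellularAutomaton d} {g : (Fin A.arity → Fin (A.maxState + 1)) → ℤ}

/-- What the neighborhood shows of `spread p` when its neighbor `k` lies on the cell of the
neighbor `j`. -/
noncomputable def shifted (A : CellularAutomaton d) (j k : Fin A.arity)
    (p : Fin A.arity → Fin (A.maxState + 1)) : Fin A.arity → Fin (A.maxState + 1) :=
  fun i => A.spread p (A.neighbor j - A.neighbor k + A.neighbor i)

theorem spread_ne_zero {p : Fin A.arity → Fin (A.maxState + 1)} {y : Fin d → ℤ}
    (h : A.spread p y ≠ 0) : y ∈ Finset.univ.map A.neighbor := by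
  by_contra hn
  exact h (spread_of_notMem p fun k hk => hn (by simp [← hk]))

theorem spread_update_of_ne {p : Fin A.arity → Fin (A.maxState + 1)} {j : Fin A.arity}
    {a : Fin (A.maxState + 1)} {y : Fin d → ℤ} (h : A.neighbor j ≠ y) :
    A.spread (Function.update p j a) y = A.spread p y := by
  by_cases hy : ∃ k, A.neighbor k = y
  · obtain ⟨k, rfl⟩ := hy
    rw [spread_neighbor, spread_neighbor, Function.update_of_ne]
    rintro rfl
    exact h rfl
  · rw [spread_of_notMem _ fun k hk => hy ⟨k, hk⟩, spread_of_notMem _ fun k hk => hy ⟨k, hk⟩]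

/-- Changing one state affects only the translates of the neighborhood through its cell. -/
theorem total_update_sub (hg : g 0 = 0) (p : Fin A.arity → Fin (A.maxState + 1))
    (j : Fin A.arity) (a : Fin (A.maxState + 1)) :
    A.total g (A.spread (Function.update p j a)) - A.total g (A.spread p) =
      ∑ k, (g (A.shifted j k (Function.update p j a)) - g (A.shifted j k p)) := by
  classical
  rw [total_eq_sum hg fun y => spread_ne_zero, total_eq_sum hg fun y => spread_ne_zero,
    ← Finset.sum_sub_distrib]
  -- The windows through the cell of the neighbor `j` are those at `x_j - x_k`, one for each `k`;
  -- all other windows cancel.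
  have hinj : Function.Injective fun k => A.neighbor j - A.neighbor k := fun k k' h =>
    A.neighbor.injective (sub_right_injective h)
  refine ((Finset.sum_image (s := Finset.univ) (g := fun k => A.neighbor j - A.neighbor k)
    (f := fun i => g (fun k => A.spread (Function.update p j a) (i + A.neighbor k)) -
      g (fun k => A.spread p (i + A.neighbor k))) hinj.injOn).symm.trans
    (Finset.sum_subset (fun i hi => ?_) fun i _ hi => ?_)).symm
  · obtain ⟨k, -, rfl⟩ := Finset.mem_image.1 hi
    exact mem_windows.2 ⟨k, by simp⟩
  · rw [sub_eq_zero]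
    congr 1
    funext k
    refine spread_update_of_ne fun h => hi ?_
    exact Finset.mem_image.2 ⟨k, Finset.mem_univ _, by rw [h]; simp⟩

theorem shifted_apply_self (j k : Fin A.arity) (p : Fin A.arity → Fin (A.maxState + 1)) :
    A.shifted j k p k = p j := by
  simp [shifted, spread_neighbor]

/-- The subtracted state of the neighbor `k₀` changes only in the window whose neighbor `k₀` lies on
the altered cell, that is, for `k = k₀`, and there it grows from 0 to `a`. -/
theorem total_excess_update_sub (h0 : A.rule 0 = 0) (k₀ : Fin A.arity)
    (p : Fin A.arity → Fin (A.maxState + 1)) (j : Fin A.arity) (hp : p j = 0)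
    (a : Fin (A.maxState + 1)) :
    A.total (A.excess k₀) (A.spread (Function.update p j a)) -
        A.total (A.excess k₀) (A.spread p) =
      ∑ k, (((A.rule (A.shifted j k (Function.update p j a)) : ℕ) : ℤ) -
        ((A.rule (A.shifted j k p) : ℕ) : ℤ) - if k = k₀ then ((a : ℕ) : ℤ) else 0) := by
  rw [total_update_sub (excess_zero h0 k₀)]
  refine Finset.sum_congr rfl fun k _ => ?_
  simp only [excess]
  by_cases hk : k = k₀
  · subst hk
    rw [shifted_apply_self, shifted_apply_self, Function.update_self, hp]
    simp
    ring
  · have : A.shifted j k (Function.update p j a) k₀ = A.shifted j k p k₀ := by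
      refine spread_update_of_ne fun h => hk ?_
      refine A.neighbor.injective ?_
      have : A.neighbor k₀ - A.neighbor k = 0 := by
        rw [← sub_eq_zero.2 h.symm]; abel
      exact (sub_eq_zero.1 this).symm
    rw [this, if_neg hk]
    ring

/-- The neighborhood state in the row `r` of the transition table. -/
def digits (A : CellularAutomaton d) (r : ℕ) : Fin A.arity → Fin (A.maxState + 1) :=
  fun l => ⟨r / (A.maxState + 1) ^ (l : ℕ) % (A.maxState + 1), Nat.mod_lt _ (Nat.succ_pos _)⟩

theorem add_mul_div_pow {q j l a r : ℕ} (hl : l < j) (hq : 0 < q) :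
    (a * q ^ j + r) / q ^ l % q = r / q ^ l % q := by
  obtain ⟨e, rfl⟩ := Nat.exists_eq_add_of_lt hl
  have : a * q ^ (l + e + 1) + r = r + q ^ l * (q * (a * q ^ e)) := by ring
  rw [this, Nat.add_mul_div_left _ _ (pow_pos hq l), Nat.add_mul_mod_self_left]

theorem digits_add (j : Fin A.arity) (a : Fin (A.maxState + 1)) {r : ℕ}
    (hr : r < (A.maxState + 1) ^ (j : ℕ)) :
    A.digits ((a : ℕ) * (A.maxState + 1) ^ (j : ℕ) + r) =
      Function.update (A.digits r) j a := by
  have hq : 0 < A.maxState + 1 := Nat.succ_pos _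
  funext l
  rcases lt_trichotomy l j with h | rfl | h
  · rw [Function.update_of_ne h.ne]
    exact Fin.ext (add_mul_div_pow h hq)
  · rw [Function.update_self]
    refine Fin.ext ?_
    simp only [digits]
    rw [mul_comm, Nat.mul_add_div (pow_pos hq _), Nat.div_eq_of_lt hr, add_zero,
      Nat.mod_eq_of_lt a.2]
  · rw [Function.update_of_ne h.ne']
    refine Fin.ext ?_
    have hle : (A.maxState + 1) ^ ((j : ℕ) + 1) ≤ (A.maxState + 1) ^ (l : ℕ) :=
      Nat.pow_le_pow_right hq h
    have h1 : (a : ℕ) * (A.maxState + 1) ^ (j : ℕ) + r < (A.maxState + 1) ^ ((j : ℕ) + 1) := by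
      have := Nat.mul_le_mul_right ((A.maxState + 1) ^ (j : ℕ)) (Nat.succ_le_of_lt a.2)
      rw [Nat.succ_mul] at this
      rw [pow_succ, mul_comm _ (A.maxState + 1)]
      omega
    simp only [digits]
    rw [Nat.div_eq_of_lt (by omega), Nat.div_eq_of_lt (by omega)]

theorem digits_self_of_lt (j : Fin A.arity) {r : ℕ} (hr : r < (A.maxState + 1) ^ (j : ℕ)) :
    A.digits r j = 0 :=
  Fin.ext (by simp [digits, Nat.div_eq_of_lt hr])

theorem digits_zero : A.digits 0 = 0 := by
  funext l
  exact Fin.ext (by simp [digits])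

theorem digits_surjective (p : Fin A.arity → Fin (A.maxState + 1)) :
    ∃ r < (A.maxState + 1) ^ A.arity, A.digits r = p := by
  refine ⟨finFunctionFinEquiv p, Fin.is_lt _, ?_⟩
  conv_rhs => rw [← finFunctionFinEquiv.symm_apply_apply p]
  rfl

/-- Number conservation as a finite list of equations, one for each row of the transition table but
the first. -/
theorem finiteNumberConserving_iff_forall_row (k₀ : Fin A.arity) :
    A.FiniteNumberConserving ↔
      A.rule 0 = 0 ∧ ∀ (j : Fin A.arity) (a : Fin (A.maxState + 1)), a ≠ 0 →
        ∀ r < (A.maxState + 1) ^ (j : ℕ),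
        ∑ k, (((A.rule (A.shifted j k
            (A.digits ((a : ℕ) * (A.maxState + 1) ^ (j : ℕ) + r))) : ℕ) : ℤ) -
          ((A.rule (A.shifted j k (A.digits r)) : ℕ) : ℤ) -
            if k = k₀ then ((a : ℕ) : ℤ) else 0) = 0 := by
  rw [finiteNumberConserving_iff_total k₀]
  refine and_congr_right fun h0 => ?_
  have key : ∀ (j : Fin A.arity) (a : Fin (A.maxState + 1)) (r : ℕ),
      r < (A.maxState + 1) ^ (j : ℕ) → _ := fun j a r hr =>
    digits_add j a hr ▸
      total_excess_update_sub h0 k₀ (A.digits r) j (digits_self_of_lt j hr) a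
  constructor
  · intro h j a _ r hr
    rw [← key j a r hr, h, h, sub_self]
  · intro h p
    obtain ⟨r, hr, rfl⟩ := digits_surjective p
    -- Deleting the leading nonzero digit gives a smaller row with the same total, so all totals
    -- reduce to that of row 0.
    induction r using Nat.strong_induction_on with
    | _ r ih =>
    rcases Nat.eq_zero_or_pos r with rfl | hpos
    -- Row 0 spreads to the zero configuration, whose empty support meets no window.
    · rw [digits_zero, total_eq_sum (S := ∅) (excess_zero h0 k₀)]
      · exact Finset.sum_eq_zero fun i hi => by simpa using mem_windows.1 hi
      · intro y hy
        refine absurd ?_ hy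
        have := digits_zero (A := A)
        by_cases hy : ∃ k, A.neighbor k = y
        · obtain ⟨k, rfl⟩ := hy
          rw [spread_neighbor]; rfl
        · exact spread_of_notMem _ fun k hk => hy ⟨k, hk⟩
    · have hq : 1 < A.maxState + 1 := by
        rcases Nat.eq_zero_or_pos A.maxState with h | h
        · rw [h] at hr; simp at hr; omega
        · omega
      have hj : Nat.log (A.maxState + 1) r < A.arity := Nat.log_lt_of_lt_pow hpos.ne' hr
      set j : Fin A.arity := ⟨_, hj⟩ with hjd
      have hP : 0 < (A.maxState + 1) ^ (j : ℕ) := pow_pos (by omega) _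
      have h1 : (A.maxState + 1) ^ (j : ℕ) ≤ r := Nat.pow_log_le_self _ hpos.ne'
      have h2 : r < (A.maxState + 1) ^ (j : ℕ) * (A.maxState + 1) :=
        Nat.lt_pow_succ_log_self hq r
      set a : Fin (A.maxState + 1) := ⟨r / (A.maxState + 1) ^ (j : ℕ), Nat.div_lt_of_lt_mul h2⟩
        with had
      have ha : a ≠ 0 := by
        intro hh
        have := congrArg Fin.val hh
        simp only [had, Fin.val_zero] at this
        exact absurd this (Nat.div_pos h1 hP).ne'
      have hrr : (a : ℕ) * (A.maxState + 1) ^ (j : ℕ) + r % (A.maxState + 1) ^ (j : ℕ) = r :=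
        Nat.div_add_mod' _ _
      have hlt := Nat.mod_lt r hP
      have := key j a _ hlt
      rw [h j a ha _ hlt, hrr, ih _ (hlt.trans_le h1)
        ((hlt.trans_le h1).trans hr), sub_zero] at this
      exact this

end CellularAutomaton

/-! ### Boundary estimates, periodic configurations and windows. -/

namespace CellularAutomaton

variable {d : ℕ} {A : CellularAutomaton d}

theorem exists_neighbor_bound (A : CellularAutomaton d) :
    ∃ R : ℕ, ∀ k e, |A.neighbor k e| ≤ R := by
  refine ⟨∑ k, ∑ e, (A.neighbor k e).natAbs, fun k e => ?_⟩
  rw [Int.abs_eq_natAbs, Nat.cast_le]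
  exact (Finset.single_le_sum (f := fun e => (A.neighbor k e).natAbs) (fun _ _ => Nat.zero_le _)
    (Finset.mem_univ e)).trans (Finset.single_le_sum
    (f := fun k => ∑ e, (A.neighbor k e).natAbs) (fun _ _ => Nat.zero_le _) (Finset.mem_univ k))

/-- The cells whose neighborhood does not lie on the same side of `W` as the cell itself. -/
def IsBoundary (A : CellularAutomaton d) (W : Finset (Fin d → ℤ)) (i : Fin d → ℤ) : Prop :=
  ∃ k, ¬ (i ∈ W ↔ i + A.neighbor k ∈ W)

theorem sum_restrict (c : A.Config) (W : Finset (Fin d → ℤ)) :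
    ∑ᶠ i, (A.restrict c W i : ℕ) = ∑ i ∈ W, (c i : ℕ) := by
  rw [finsum_eq_sum_of_support_subset (s := W)]
  · exact Finset.sum_congr rfl fun i hi => by simp [restrict, hi]
  · intro i hi
    by_contra h
    have h' : i ∉ W := h
    simp [restrict, h'] at hi

/-- Inside a finite set, a number-conserving cellular automaton changes the sum of the states at
most by the contribution of the boundary. -/
theorem abs_sum_sub_sum_step_le (h : A.FiniteNumberConserving) (c : A.Config)
    (W V : Finset (Fin d → ℤ)) (hV : ∀ i, A.IsBoundary W i → i ∈ V) :
    |∑ i ∈ W, ((c i : ℕ) : ℤ) - ∑ i ∈ W, ((A.step c i : ℕ) : ℤ)| ≤ V.card * A.maxState := by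
  classical
  have h0 := rule_zero_of_finite h
  have hfin : {i | A.restrict c W i ≠ 0}.Finite := W.finite_toSet.subset fun i hi => by
    by_contra hh
    have hh' : i ∉ W := hh
    simp [restrict, hh'] at hi
  -- Off the boundary, cutting `c` down to `W` before the step has the same effect as cutting down
  -- `A(c)` after it.
  have hdiff : ∀ i, ¬ A.IsBoundary W i →
      ((A.step (A.restrict c W) i : ℕ) : ℤ) = if i ∈ W then ((A.step c i : ℕ) : ℤ) else 0 := by
    intro i hi
    simp only [IsBoundary, not_exists, not_not] at hi
    by_cases hW : i ∈ W
    · rw [if_pos hW]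
      simp only [step, restrict, fun k => (hi k).1 hW, if_true]
    · have hz : (fun k => A.restrict c W (i + A.neighbor k)) = 0 := by
        funext k
        simp [restrict, mt (hi k).2 hW]
      rw [if_neg hW, step, hz, h0]
      rfl
  -- Conservation is applied to the finite configuration cut out by `W`.
  have e1 : ∑ i ∈ W, ((c i : ℕ) : ℤ) = ∑ᶠ i, ((A.step (A.restrict c W) i : ℕ) : ℤ) := by
    rw [← finsum_cast (finite_support_step h0 hfin), ← (h _ hfin).2, sum_restrict]
    push_cast
    rfl
  have e2 : ∑ i ∈ W, ((A.step c i : ℕ) : ℤ) =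
      ∑ᶠ i, if i ∈ W then ((A.step c i : ℕ) : ℤ) else 0 := by
    rw [finsum_eq_sum_of_support_subset (s := W)]
    · exact Finset.sum_congr rfl fun i hi => by simp [hi]
    · intro i hi
      by_contra hh
      have hh' : i ∉ W := hh
      simp [hh'] at hi
  rw [e1, e2, ← finsum_sub_distrib, finsum_eq_sum_of_support_subset (s := V)]
  · refine (Finset.abs_sum_le_sum_abs _ _).trans ?_
    rw [← nsmul_eq_mul]
    refine Finset.sum_le_card_nsmul _ _ _ fun i _ => ?_
    have b1 := (A.step (A.restrict c W) i).is_le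
    have b2 := (A.step c i).is_le
    rw [abs_le]
    split_ifs <;> constructor <;> omega
  · intro i hi
    by_contra hV'
    exact hi (by simp [hdiff i fun hh => hV' (hV i hh)])
  · exact (finite_support_step h0 hfin).subset fun i hi hh => hi (by simp [hh])
  · refine W.finite_toSet.subset fun i hi => ?_
    by_contra hh
    have hh' : i ∉ W := hh
    simp [hh'] at hi

/-- The boundary of a box lies in the box enlarged by `R` on all sides, minus the box shrunk by `R`.
The truncation `toNat` covers the case that the shrunk box is empty. -/
theorem card_boundary_box_le (h : A.FiniteNumberConserving) (c : A.Config) {R : ℕ}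
    (hR : ∀ k e, |A.neighbor k e| ≤ R) (a b : Fin d → ℤ) :
    |∑ i ∈ Fintype.piFinset (fun e => Finset.Ico (a e) (b e)), ((c i : ℕ) : ℤ) -
        ∑ i ∈ Fintype.piFinset (fun e => Finset.Ico (a e) (b e)), ((A.step c i : ℕ) : ℤ)| ≤
      (∏ e, ((b e - a e + 2 * R).toNat : ℤ) - ∏ e, ((b e - a e - 2 * R).toNat : ℤ)) *
        A.maxState := by
  classical
  set V₁ := Fintype.piFinset (fun e => Finset.Ico (a e - R) (b e + R)) with hV₁
  set V₂ := Fintype.piFinset (fun e => Finset.Ico (a e + R) (b e - R)) with hV₂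
  refine (abs_sum_sub_sum_step_le h c _ (V₁ \ V₂) fun i hi => ?_).trans_eq ?_
  · obtain ⟨k, hk⟩ := hi
    have hb : ∀ e, -(R : ℤ) ≤ A.neighbor k e ∧ A.neighbor k e ≤ R := fun e => abs_le.1 (hR k e)
    simp only [hV₁, hV₂, Finset.mem_sdiff, Fintype.mem_piFinset, Finset.mem_Ico] at hk ⊢
    constructor
    · intro e
      by_contra hn
      refine hk ⟨fun hh => absurd (hh e) ?_, fun hh => absurd (hh e) ?_⟩ <;>
      · have := hb e
        try simp only [Pi.add_apply]
        omega
    · intro hn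
      refine hk ⟨fun _ e => ?_, fun _ e => ?_⟩ <;>
      · have := hb e
        have := hn e
        try simp only [Pi.add_apply]
        omega
  · have hsub : V₂ ⊆ V₁ := Fintype.piFinset_subset _ _ fun e =>
      Finset.Ico_subset_Ico (by omega) (by omega)
    rw [Finset.cast_card_sdiff hsub, hV₁, hV₂, Fintype.card_piFinset, Fintype.card_piFinset]
    simp only [Int.card_Ico]
    push_cast
    congr 3 <;>
    · funext e
      congr 2
      ring

/-! ### Periodic configurations -/

theorem periodic_vector {α : Type*} {F : (Fin d → ℤ) → α} {π : Fin d → ℕ}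
    (hF : ∀ k i, F (k + Pi.single i (π i : ℤ)) = F k) (a k : Fin d → ℤ) :
    F ((fun i => a i * (π i : ℤ)) + k) = F k := by
  have : Function.Periodic F (∑ i, a i • Pi.single i (π i : ℤ)) := by
    refine Finset.sum_induction _ (Function.Periodic F) (fun x y => Function.Periodic.add_period)
      (fun x => by simp) fun i _ => ?_
    exact Function.Periodic.zsmul (fun x => hF x i) (a i)
  rw [add_comm, ← this k]
  congr 2
  funext e
  simp [Finset.sum_apply, Pi.single_apply]

/-- Division with remainder in each coordinate cuts the large box into `K ^ d` period boxes. -/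
theorem sum_box_eq {F : (Fin d → ℤ) → ℤ} {π : Fin d → ℕ} (hπ : ∀ i, 0 < π i)
    (hF : ∀ k i, F (k + Pi.single i (π i : ℤ)) = F k) (K : ℕ) :
    ∑ k ∈ Fintype.piFinset (fun i => Finset.Ico (0 : ℤ) (K * π i)), F k =
      (K : ℤ) ^ d * ∑ k ∈ Fintype.piFinset (fun i => Finset.Ico (0 : ℤ) (π i)), F k := by
  have hcard : ((K : ℤ) ^ d) =
      (Fintype.piFinset (fun _ : Fin d => Finset.Ico (0 : ℤ) K)).card := by
    simp [Fintype.card_piFinset]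
  rw [hcard, ← nsmul_eq_mul, ← Finset.sum_const, ← Finset.sum_product']
  symm
  refine Finset.sum_nbij' (fun p => (fun i => p.1 i * (π i : ℤ)) + p.2)
    (fun k => (fun i => k i / π i, fun i => k i % π i)) ?_ ?_ ?_ ?_ ?_
  · rintro ⟨a, b⟩ hab
    simp only [Finset.mem_product, Fintype.mem_piFinset, Finset.mem_Ico, Pi.add_apply] at hab ⊢
    intro i
    obtain ⟨h1, h2⟩ := hab.1 i
    obtain ⟨h3, h4⟩ := hab.2 i
    have hp : (0 : ℤ) ≤ π i := by positivity
    constructor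
    · positivity
    · have := mul_le_mul_of_nonneg_right (show a i + 1 ≤ K by omega) hp
      linarith
  · intro k hk
    simp only [Finset.mem_product, Fintype.mem_piFinset, Finset.mem_Ico] at hk ⊢
    have hp : ∀ i, (0 : ℤ) < π i := fun i => by exact_mod_cast hπ i
    exact ⟨fun i => ⟨Int.ediv_nonneg (hk i).1 (hp i).le, Int.ediv_lt_of_lt_mul (hp i) (hk i).2⟩,
      fun i => ⟨Int.emod_nonneg _ (hp i).ne', Int.emod_lt_of_pos _ (hp i)⟩⟩
  · rintro ⟨a, b⟩ hab
    simp only [Finset.mem_product, Fintype.mem_piFinset, Finset.mem_Ico] at hab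
    have hp : ∀ i, (0 : ℤ) < π i := fun i => by exact_mod_cast hπ i
    refine Prod.ext (funext fun i => ?_) (funext fun i => ?_)
    · simp only [Pi.add_apply]
      rw [add_comm, Int.add_mul_ediv_right _ _ (hp i).ne',
        Int.ediv_eq_zero_of_lt (hab.2 i).1 (hab.2 i).2, zero_add]
    · simp only [Pi.add_apply]
      rw [add_comm, Int.add_mul_emod_self_right, Int.emod_eq_of_lt (hab.2 i).1 (hab.2 i).2]
  · intro k _
    funext i
    simp only [Pi.add_apply]
    exact Int.ediv_mul_add_emod _ _
  · rintro ⟨a, b⟩ _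
    exact (periodic_vector hF a b).symm

/-- Over `K` periods in each direction the defect is multiplied by `K ^ d`, while the boundary term
is of lower order in `K`; dividing and letting `K` grow leaves a zero defect. -/
theorem periodic_of_finite (h : A.FiniteNumberConserving) : A.PeriodicNumberConserving := by
  intro π hπ c hc
  have hstep : ∀ k i, A.step c (k + Pi.single i (π i : ℤ)) = A.step c k := fun k i => by
    simp only [step]
    congr 1
    funext e
    rw [add_right_comm, hc]
  obtain ⟨R, hR⟩ := A.exists_neighbor_bound
  set σ : ℤ := ∑ k ∈ Fintype.piFinset (fun i => Finset.Ico (0 : ℤ) (π i)), ((c k : ℕ) : ℤ) with hσ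
  set τ : ℤ := ∑ k ∈ Fintype.piFinset (fun i => Finset.Ico (0 : ℤ) (π i)),
    ((A.step c k : ℕ) : ℤ) with hτ
  have key : ∀ K : ℕ, 2 * R + 1 ≤ K → |((σ - τ : ℤ) : ℝ)| ≤
      (∏ i, ((π i : ℝ) + 2 * R / K) - ∏ i, ((π i : ℝ) - 2 * R / K)) * A.maxState := by
    intro K hK
    have hK0 : (0 : ℝ) < K := by exact_mod_cast (by omega : 0 < K)
    have h1 := card_boundary_box_le h c hR 0 (fun i => (K : ℤ) * π i)
    simp only [Pi.zero_apply, sub_zero] at h1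
    rw [sum_box_eq hπ (F := fun k => ((c k : ℕ) : ℤ)) (fun k i => by simp only [hc]),
      sum_box_eq hπ (F := fun k => ((A.step c k : ℕ) : ℤ)) (fun k i => by simp only [hstep]),
      ← hσ, ← hτ] at h1
    -- For such `K` the shrunk box has nonnegative sides, so `toNat` does not truncate.
    have hKπ : ∀ i, (2 * R : ℤ) ≤ K * π i := fun i => by
      have : K * 1 ≤ K * π i := Nat.mul_le_mul_left _ (hπ i)
      zify at this hK
      linarith
    have e1 : ∀ i, ((((K : ℤ) * π i + 2 * R).toNat : ℤ) : ℝ) = K * ((π i : ℝ) + 2 * R / K) := by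
      intro i
      rw [Int.toNat_of_nonneg (by positivity)]
      push_cast
      field_simp
    have e2 : ∀ i, ((((K : ℤ) * π i - 2 * R).toNat : ℤ) : ℝ) = K * ((π i : ℝ) - 2 * R / K) := by
      intro i
      rw [Int.toNat_of_nonneg (by linarith [hKπ i])]
      push_cast
      field_simp
    have h2 : |(K : ℝ) ^ d * σ - (K : ℝ) ^ d * τ| ≤
        (∏ i, (K * ((π i : ℝ) + 2 * R / K)) - ∏ i, (K * ((π i : ℝ) - 2 * R / K))) *
          A.maxState := by
      rw [← Finset.prod_congr rfl fun i _ => e1 i, ← Finset.prod_congr rfl fun i _ => e2 i]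
      exact_mod_cast h1
    rw [Finset.prod_mul_distrib, Finset.prod_mul_distrib, Finset.prod_const, Finset.card_univ,
      Fintype.card_fin, ← mul_sub, ← mul_sub, mul_assoc, abs_mul,
      abs_of_pos (by positivity : (0 : ℝ) < K ^ d)] at h2
    have := le_of_mul_le_mul_left h2 (by positivity)
    push_cast
    exact this
  have hlim : Filter.Tendsto (fun K : ℕ =>
      (∏ i, ((π i : ℝ) + 2 * R / K) - ∏ i, ((π i : ℝ) - 2 * R / K)) * A.maxState)
      Filter.atTop (nhds 0) := by
    have h0 : Filter.Tendsto (fun K : ℕ => (2 * R / K : ℝ)) Filter.atTop (nhds 0) :=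
      tendsto_const_div_atTop_nhds_zero_nat _
    have := ((tendsto_finsetProd Finset.univ fun (i : Fin d) _ =>
      (tendsto_const_nhds (x := (π i : ℝ))).add h0).sub
      (tendsto_finsetProd Finset.univ fun (i : Fin d) _ =>
      (tendsto_const_nhds (x := (π i : ℝ))).sub h0)).mul_const (A.maxState : ℝ)
    simpa using this
  have h3 : |((σ - τ : ℤ) : ℝ)| ≤ 0 := ge_of_tendsto hlim
    (Filter.eventually_atTop.2 ⟨2 * R + 1, key⟩)
  have h4 : σ - τ = 0 := by exact_mod_cast abs_nonpos_iff.1 h3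
  have h5 : σ = τ := sub_eq_zero.1 h4
  rw [hσ, hτ] at h5
  exact_mod_cast h5

theorem rule_zero_of_periodic (h : A.PeriodicNumberConserving) : A.rule 0 = 0 := by
  have := h (fun _ => 1) (fun _ => one_pos) 0 fun _ _ => rfl
  have hs : ∀ i, A.step 0 i = A.rule 0 := fun i => rfl
  simp only [hs, Finset.sum_const, Fintype.card_piFinset] at this
  simpa using this.symm

theorem sum_box_sub_eq_finsum {F : (Fin d → ℤ) → ℕ} {R : ℕ}
    (hF : ∀ i, F i ≠ 0 → ∀ e, |i e| ≤ 2 * R) :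
    ∑ k ∈ Fintype.piFinset (fun _ => Finset.Ico (0 : ℤ) ((4 * R + 1 : ℕ) : ℤ)),
      F (k - fun _ => 2 * (R : ℤ)) = ∑ᶠ i, F i := by
  rw [← finsum_comp_equiv (Equiv.subRight fun _ => 2 * (R : ℤ)),
    finsum_eq_sum_of_support_subset]
  · rfl
  · intro i hi
    simp only [Finset.mem_coe, Fintype.mem_piFinset, Finset.mem_Ico]
    intro e
    have := abs_le.1 (hF _ hi e)
    simp only [Equiv.subRight_apply, Pi.sub_apply] at this
    omega

/-- A spread lives in `[-R, R]^d` and its image in `[-2R, 2R]^d`. A torus of side `4R + 1` therefore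
holds both without interference between copies. -/
theorem finite_of_periodic (hA : 0 < A.arity) (h : A.PeriodicNumberConserving) :
    A.FiniteNumberConserving := by
  have h0 := rule_zero_of_periodic h
  refine (finiteNumberConserving_iff_total ⟨0, hA⟩).2 ⟨h0, fun p => ?_⟩
  rw [total_excess h0 _ (finite_support_spread p), sub_eq_zero, Nat.cast_inj]
  obtain ⟨R, hR⟩ := A.exists_neighbor_bound
  set u := A.spread p with hu
  have hu0 : ∀ y e, (R : ℤ) < |y e| → u y = 0 := fun y e hy => spread_of_notMem p fun k hk => by
    have := hR k e
    rw [hk] at this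
    omega
  set L : ℕ := 4 * R + 1 with hL
  have hLpos : (0 : ℤ) < L := by omega
  set c : A.Config := fun i => u ((fun e => i e % (L : ℤ)) - fun _ => 2 * (R : ℤ)) with hc
  have hbox : ∀ i ∈ Fintype.piFinset (fun _ : Fin d => Finset.Ico (0 : ℤ) (L : ℤ)),
      ∀ x : Fin d → ℤ, (∀ e, |x e| ≤ R) → c (i + x) = u (i - (fun _ => 2 * (R : ℤ)) + x) := by
    intro i hi x hx
    simp only [Fintype.mem_piFinset, Finset.mem_Ico] at hi
    -- If the shifted cell leaves the box, the wrapped coordinate and the true coordinate both have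
    -- absolute value above `R` after centering, so both sides vanish.
    by_cases hin : ∀ e, 0 ≤ i e + x e ∧ i e + x e < L
    · simp only [hc]
      congr 1
      funext e
      simp only [Pi.sub_apply, Pi.add_apply]
      rw [Int.emod_eq_of_lt (hin e).1 (hin e).2]
      ring
    · push Not at hin
      obtain ⟨e, he⟩ := hin
      have h1 := abs_le.1 (hx e)
      have h2 := hi e
      rw [hu0 (i - (fun _ => 2 * (R : ℤ)) + x) e]
      · simp only [hc]
        refine hu0 _ e ?_
        simp only [Pi.sub_apply, Pi.add_apply]
        by_cases hneg : i e + x e < 0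
        · rw [← Int.add_emod_right, Int.emod_eq_of_lt (by omega) (by omega), lt_abs]
          omega
        · rw [← Int.sub_emod_right, Int.emod_eq_of_lt (by omega) (by omega), lt_abs]
          omega
      · simp only [Pi.sub_apply, Pi.add_apply]
        rw [lt_abs]
        omega
  have hper := h (fun _ => L) (fun _ => by omega) c fun k i => by
    simp only [hc]
    congr 2
    funext e
    by_cases hei : e = i
    · subst hei; simp
    · simp [Pi.single_eq_of_ne hei]
  have e1 : ∑ k ∈ Fintype.piFinset (fun _ : Fin d => Finset.Ico (0 : ℤ) (L : ℤ)), (c k : ℕ) =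
      ∑ᶠ i, (u i : ℕ) := by
    rw [← sum_box_sub_eq_finsum (R := R)]
    · refine Finset.sum_congr rfl fun i hi => ?_
      have := hbox i hi 0 (by simp)
      rw [add_zero, add_zero] at this
      rw [this]
    · intro i hi e
      by_contra hn
      exact hi (by rw [hu0 i e (by omega)]; rfl)
  have e2 : ∑ k ∈ Fintype.piFinset (fun _ : Fin d => Finset.Ico (0 : ℤ) (L : ℤ)),
      (A.step c k : ℕ) = ∑ᶠ i, (A.step u i : ℕ) := by
    rw [← sum_box_sub_eq_finsum (R := R)]
    · refine Finset.sum_congr rfl fun i hi => ?_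
      simp only [step, fun k => hbox i hi (A.neighbor k) (hR k)]
    · intro i hi e
      by_contra hn
      refine hi ?_
      have hz : (fun k => u (i + A.neighbor k)) = 0 := by
        funext k
        refine hu0 _ e ?_
        have := abs_le.1 (hR k e)
        rw [not_le, lt_abs] at hn
        rw [lt_abs]
        simp only [Pi.add_apply]
        omega
      rw [step, hz, h0]
      rfl
  rw [← e1, ← e2]
  exact hper.symm

/-! ### Windows -/

theorem windowSum_eventually {c : A.Config} (hc : {i | c i ≠ 0}.Finite) :
    ∀ᶠ n in Filter.atTop, A.windowSum n c = ∑ᶠ i, (c i : ℕ) := by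
  refine Filter.eventually_atTop.2 ⟨∑ i ∈ hc.toFinset, ∑ e, (i e).natAbs, fun n hn => ?_⟩
  rw [windowSum, finsum_eq_sum_of_support_subset]
  intro i hi
  have hi' : i ∈ hc.toFinset := by
    simp only [Set.Finite.mem_toFinset, Set.mem_ofPred_eq]
    exact fun hh => hi (by simp [hh])
  simp only [Finset.mem_coe, Fintype.mem_piFinset, Finset.mem_Icc]
  intro e
  have h1 := Finset.single_le_sum (f := fun e => (i e).natAbs) (fun _ _ => Nat.zero_le _)
    (Finset.mem_univ e)
  have h2 := Finset.single_le_sum (f := fun i : Fin d → ℤ => ∑ e, (i e).natAbs)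
    (fun _ _ => Nat.zero_le _) hi'
  omega

theorem finite_of_window (h : A.WindowNumberConserving) : A.FiniteNumberConserving := by
  have h0 : A.rule 0 = 0 := by
    by_contra hne
    have hne' : ((A.rule 0 : ℕ)) ≠ 0 := fun hh => hne (Fin.ext hh)
    have h1 : ∀ n, A.windowSum n (0 : A.Config) = 0 := fun n => by simp [windowSum]
    have h2 : ∀ n, A.windowSum n (A.step 0) ≠ 0 := fun n => by
      have hs : ∀ i, A.step 0 i = A.rule 0 := fun i => rfl
      have : 2 * n + 1 ≠ 0 := by omega
      simp only [windowSum, hs, Finset.sum_const, Fintype.card_piFinset, Int.card_Icc,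
        Finset.prod_const, smul_eq_mul]
      refine mul_ne_zero (pow_ne_zero _ ?_) hne'
      omega
    have := h 0
    simp only [h1, h2, and_false, if_false, Nat.cast_zero, zero_div] at this
    exact zero_ne_one (tendsto_nhds_unique tendsto_const_nhds this)
  intro c hc
  refine ⟨finite_support_step h0 hc, ?_⟩
  set σ := ∑ᶠ i, (c i : ℕ) with hσ
  set τ := ∑ᶠ i, (A.step c i : ℕ) with hτ
  have hlim := (h c).congr' (f₂ := fun _ => if σ = 0 ∧ τ = 0 then (1 : ℝ) else (σ : ℝ) / τ) (by
    filter_upwards [windowSum_eventually hc,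
      windowSum_eventually (finite_support_step h0 hc)] with n h1 h2
    rw [h1, h2])
  have heq := tendsto_nhds_unique tendsto_const_nhds hlim
  split_ifs at heq with hz
  · rw [hz.1, hz.2]
  -- If only the image has sum 0, then division by zero makes the ratio 0, which is not the limit 1.
  · by_cases hτ0 : (τ : ℝ) = 0
    · rw [hτ0, div_zero] at heq
      norm_num at heq
    · rw [div_eq_one_iff_eq hτ0] at heq
      exact_mod_cast heq

theorem tendsto_windowSum {c : A.Config} (hc : {i | c i ≠ 0}.Infinite) :
    Filter.Tendsto (fun n => A.windowSum n c) Filter.atTop Filter.atTop := by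
  refine Filter.tendsto_atTop.2 fun M => ?_
  obtain ⟨S, hS, rfl⟩ := hc.exists_subset_card_eq M
  refine Filter.eventually_atTop.2 ⟨∑ i ∈ S, ∑ e, (i e).natAbs, fun n hn => ?_⟩
  have hsub : S ⊆ Fintype.piFinset (fun _ : Fin d => Finset.Icc (-(n : ℤ)) n) := by
    intro i hi
    simp only [Fintype.mem_piFinset, Finset.mem_Icc]
    intro e
    have h1 := Finset.single_le_sum (f := fun e => (i e).natAbs) (fun _ _ => Nat.zero_le _)
      (Finset.mem_univ e)
    have h2 := Finset.single_le_sum (f := fun i : Fin d → ℤ => ∑ e, (i e).natAbs)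
      (fun _ _ => Nat.zero_le _) hi
    omega
  calc S.card = ∑ i ∈ S, 1 := by simp
    _ ≤ ∑ i ∈ S, (c i : ℕ) := Finset.sum_le_sum fun i hi =>
      Nat.one_le_iff_ne_zero.2 fun hh => hS hi (Fin.ext hh)
    _ ≤ A.windowSum n c := Finset.sum_le_sum_of_subset hsub

/-- In dimension 1 the boundary of a window has a size independent of `n`. For infinite support the
window sums tend to infinity, so a bounded difference forces the ratio to 1. -/
theorem window_of_finite {A : CellularAutomaton 1} (h : A.FiniteNumberConserving) :
    A.WindowNumberConserving := by
  intro c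
  have h0 := rule_zero_of_finite h
  by_cases hc : {i | c i ≠ 0}.Finite
  · refine tendsto_const_nhds.congr' ?_
    filter_upwards [windowSum_eventually hc,
      windowSum_eventually (finite_support_step h0 hc)] with n h1 h2
    rw [h1, h2, ← (h c hc).2]
    split_ifs with hz
    · rfl
    · rw [div_self]
      exact_mod_cast fun hh => hz ⟨hh, hh⟩
  · obtain ⟨R, hR⟩ := A.exists_neighbor_bound
    have hbd : ∀ n, |(A.windowSum n c : ℝ) - A.windowSum n (A.step c)| ≤ 4 * R * A.maxState := by
      intro n
      have h1 := card_boundary_box_le h c hR (fun _ => -(n : ℤ)) (fun _ => (n : ℤ) + 1)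
      simp only [Finset.univ_unique, Finset.prod_singleton] at h1
      have h2 : (((n : ℤ) + 1 - -n + 2 * R).toNat : ℤ) - (((n : ℤ) + 1 - -n - 2 * R).toNat : ℤ) ≤
          4 * R := by omega
      have h3 := h1.trans (mul_le_mul_of_nonneg_right h2 (Int.natCast_nonneg A.maxState))
      have h4 : Finset.Ico (-(n : ℤ)) (n + 1) = Finset.Icc (-(n : ℤ)) n := by
        ext z
        simp only [Finset.mem_Ico, Finset.mem_Icc]
        omega
      rw [h4] at h3
      simp only [windowSum]
      exact_mod_cast h3
    have ha : Filter.Tendsto (fun n => (A.windowSum n c : ℝ)) Filter.atTop Filter.atTop :=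
      tendsto_natCast_atTop_atTop.comp (tendsto_windowSum hc)
    have hb : Filter.Tendsto (fun n => (A.windowSum n (A.step c) : ℝ)) Filter.atTop
        Filter.atTop := by
      refine Filter.tendsto_atTop_mono (fun n => ?_)
        (Filter.tendsto_atTop_add_const_right _ (-(4 * R * A.maxState : ℝ)) ha)
      have := (abs_le.1 (hbd n)).2
      linarith
    have hq : Filter.Tendsto (fun n => ((A.windowSum n c : ℝ) - A.windowSum n (A.step c)) /
        A.windowSum n (A.step c)) Filter.atTop (nhds 0) := by
      refine squeeze_zero_norm (fun n => ?_)
        (tendsto_const_nhds (x := (4 * R * A.maxState : ℝ)).div_atTop hb)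
      rw [Real.norm_eq_abs, abs_div, Nat.abs_cast]
      exact div_le_div_of_nonneg_right (hbd n) (Nat.cast_nonneg _)
    have := hq.add_const 1
    rw [zero_add] at this
    refine this.congr' ?_
    filter_upwards [hb.eventually_gt_atTop 0] with n hn
    have hn' : A.windowSum n (A.step c) ≠ 0 := by
      intro hh
      rw [hh] at hn
      simp at hn
    rw [if_neg fun hh => hn' hh.2]
    field_simp
    ring

end CellularAutomaton

/-! ### A calculus for the correctness and running time of programs. -/

namespace RAM

/-- The program `p` takes `s` to `s'` in time at most `T`, up to a factor that bounds the cost of an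
access to the memory cells of absolute address at most `B`, and it accesses no others. -/
def Runs (B : ℕ) (p : Prog) (s s' : State) (T : ℕ) : Prop :=
  ∀ (κ : ℤ → ℕ) (K : ℕ), 1 ≤ K → (∀ a : ℤ, a.natAbs ≤ B → κ a ≤ K) →
    ∃ t ≤ K * T, Exec κ p s s' t

/-- Started in `s`, the program `p` ends within time `T` in a state with the property `Q`. -/
def Ends (B : ℕ) (p : Prog) (s : State) (T : ℕ) (Q : State → Prop) : Prop :=
  ∃ s', Q s' ∧ Runs B p s s' T

variable {B : ℕ} {p q : Prog} {s s' : State} {T U : ℕ} {Q R : State → Prop} {x y z : ℕ} {n : ℤ}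

@[simp] theorem State.reg_setReg : (s.setReg x n).reg y = if y = x then n else s.reg y := by
  simp [State.setReg, Function.update_apply]

@[simp] theorem State.mem_setReg : (s.setReg x n).mem = s.mem := rfl

@[simp] theorem State.reg_setMem {a : ℤ} : (s.setMem a n).reg = s.reg := rfl

@[simp] theorem State.mem_setMem {a b : ℤ} :
    (s.setMem a n).mem b = if b = a then n else s.mem b := by
  simp [State.setMem, Function.update_apply]

/-- The registers below `N` are the same in `s` and `s'`. -/
def Same (N : ℕ) (s s' : State) : Prop := ∀ x < N, s'.reg x = s.reg x

theorem Same.refl (N : ℕ) (s : State) : Same N s s := fun _ _ => rfl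

theorem Same.trans {N : ℕ} {s s' s'' : State} (h : Same N s s') (h' : Same N s' s'') :
    Same N s s'' :=
  fun x hx => (h' x hx).trans (h x hx)

theorem Same.le {N M : ℕ} {s s' : State} (h : Same N s s') (hM : M ≤ N) : Same M s s' :=
  fun x hx => h x (hx.trans_le hM)

theorem same_setReg {N : ℕ} (hx : N ≤ x) : Same N s (s'.setReg x n) ↔ Same N s s' :=
  forall₂_congr fun w hw => by rw [State.reg_setReg, if_neg (by omega)]

theorem same_setMem {N : ℕ} {a : ℤ} : Same N s (s'.setMem a n) ↔ Same N s s' := Iff.rfl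

theorem Ends.mono (h : Ends B p s T Q) (hT : T ≤ U) (hQ : ∀ s', Q s' → R s') :
    Ends B p s U R := by
  obtain ⟨s', h1, h2⟩ := h
  refine ⟨s', hQ _ h1, fun κ K hK hκ => ?_⟩
  obtain ⟨t, ht, he⟩ := h2 κ K hK hκ
  exact ⟨t, ht.trans (Nat.mul_le_mul_left K hT), he⟩

theorem Ends.seq (h : Ends B p s T fun s' => Ends B q s' U Q) :
    Ends B (p.seq q) s (T + U) Q := by
  obtain ⟨s₁, ⟨s₂, h1, h2⟩, h3⟩ := h
  refine ⟨s₂, h1, fun κ K hK hκ => ?_⟩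
  obtain ⟨t, ht, he⟩ := h3 κ K hK hκ
  obtain ⟨u, hu, hf⟩ := h2 κ K hK hκ
  exact ⟨t + u, by rw [mul_add]; exact Nat.add_le_add ht hu, .seq he hf⟩

theorem Ends.seq_le {V : ℕ} (h : Ends B p s T R) (hq : ∀ s', R s' → Ends B q s' U Q)
    (hV : T + U ≤ V) : Ends B (p.seq q) s V Q :=
  (Ends.seq (h.mono le_rfl hq)).mono hV fun _ => id

theorem Ends.const (h : Q (s.setReg x n)) : Ends B (.const x n) s 1 Q :=
  ⟨_, h, fun _ _ hK _ => ⟨1, by simpa using hK, .const x n s⟩⟩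

theorem Ends.add (h : Q (s.setReg x (s.reg y + s.reg z))) : Ends B (.add x y z) s 1 Q :=
  ⟨_, h, fun _ _ hK _ => ⟨1, by simpa using hK, .add x y z s⟩⟩

theorem Ends.sub (h : Q (s.setReg x (s.reg y - s.reg z))) : Ends B (.sub x y z) s 1 Q :=
  ⟨_, h, fun _ _ hK _ => ⟨1, by simpa using hK, .sub x y z s⟩⟩

theorem Ends.load (hB : (s.reg y).natAbs ≤ B) (h : Q (s.setReg x (s.mem (s.reg y)))) :
    Ends B (.load x y) s 1 Q :=
  ⟨_, h, fun _ _ _ hκ => ⟨_, by simpa using hκ _ hB, .load x y s⟩⟩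

theorem Ends.store (hB : (s.reg x).natAbs ≤ B) (h : Q (s.setMem (s.reg x) (s.reg y))) :
    Ends B (.store x y) s 1 Q :=
  ⟨_, h, fun _ _ _ hκ => ⟨_, by simpa using hκ _ hB, .store x y s⟩⟩

theorem Ends.const_seq (h : Ends B q (s.setReg x n) T Q) :
    Ends B ((Prog.const x n).seq q) s (T + 1) Q :=
  Nat.add_comm T 1 ▸ Ends.seq (.const h)

theorem Ends.add_seq (h : Ends B q (s.setReg x (s.reg y + s.reg z)) T Q) :
    Ends B ((Prog.add x y z).seq q) s (T + 1) Q :=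
  Nat.add_comm T 1 ▸ Ends.seq (.add h)

theorem Ends.sub_seq (h : Ends B q (s.setReg x (s.reg y - s.reg z)) T Q) :
    Ends B ((Prog.sub x y z).seq q) s (T + 1) Q :=
  Nat.add_comm T 1 ▸ Ends.seq (.sub h)

theorem Ends.load_seq (hB : (s.reg y).natAbs ≤ B)
    (h : Ends B q (s.setReg x (s.mem (s.reg y))) T Q) :
    Ends B ((Prog.load x y).seq q) s (T + 1) Q :=
  Nat.add_comm T 1 ▸ Ends.seq (.load hB h)

theorem Ends.store_seq (hB : (s.reg x).natAbs ≤ B)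
    (h : Ends B q (s.setMem (s.reg x) (s.reg y)) T Q) :
    Ends B ((Prog.store x y).seq q) s (T + 1) Q :=
  Nat.add_comm T 1 ▸ Ends.seq (.store hB h)

theorem Ends.ite (h1 : 0 < s.reg x → Ends B p s T Q) (h2 : ¬ 0 < s.reg x → Ends B q s T Q) :
    Ends B (.ite x p q) s (T + 1) Q := by
  by_cases hx : 0 < s.reg x
  · obtain ⟨s', h, hr⟩ := h1 hx
    refine ⟨s', h, fun κ K hK hκ => ?_⟩
    obtain ⟨t, ht, he⟩ := hr κ K hK hκ
    exact ⟨t + 1, by rw [mul_add]; omega, .ite_pos hx he⟩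
  · obtain ⟨s', h, hr⟩ := h2 hx
    refine ⟨s', h, fun κ K hK hκ => ?_⟩
    obtain ⟨t, ht, he⟩ := hr κ K hK hκ
    exact ⟨t + 1, by rw [mul_add]; omega, .ite_neg hx he⟩

/-- The conditional assignment `if 0 < x then y := n`, with `z` as a dummy. -/
theorem Ends.ite_const_seq {n' : ℤ} (hyz : y ≠ z) (h : Ends B q
      ((s.setReg y (if 0 < s.reg x then n else s.reg y)).setReg z
        (if 0 < s.reg x then s.reg z else n')) T Q) :
    Ends B ((Prog.ite x (.const y n) (.const z n')).seq q) s (T + 2) Q := by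
  rw [Nat.add_comm T 2]
  refine Ends.seq (Ends.ite (fun hx => Ends.const ?_) fun hx => Ends.const ?_)
  · simp only [if_pos hx] at h
    convert h using 1
    simp only [State.setReg]
    congr 1
    funext w
    by_cases hw : w = z
    · subst hw; simp [Function.update_of_ne hyz.symm]
    · simp [Function.update_of_ne hw]
  · simp only [if_neg hx] at h
    convert h using 1
    simp [State.setReg]

/-- Rule for counted loops: the tested register holds the number of rounds left, `I i` is the
invariant after `i` rounds, and each round pays 1 for its test. -/
theorem Ends.loop (I : ℕ → State → Prop) (f : ℕ → ℕ) (N : ℕ)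
    (hx : ∀ i ≤ N, ∀ s, I i s → s.reg x = N - i)
    (hstep : ∀ i < N, ∀ s, I i s → Ends B p s (f i) (I (i + 1))) (h0 : I 0 s) :
    Ends B (.loop x p) s (∑ i ∈ Finset.range N, (f i + 1) + 1) (I N) := by
  suffices h : ∀ k ≤ N, ∀ s, I (N - k) s →
      Ends B (.loop x p) s (∑ i ∈ Finset.Ico (N - k) N, (f i + 1) + 1) (I N) by
    have := h N le_rfl s (by rwa [Nat.sub_self])
    rwa [Nat.sub_self, ← Finset.range_eq_Ico] at this
  intro k
  induction k with
  | zero =>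
    intro _ s hs
    have hz : ¬ 0 < s.reg x := by
      rw [hx _ (Nat.sub_le _ _) s hs]; simp
    exact ⟨s, hs, fun κ K hK _ => ⟨1, by simpa using hK, .loop_neg hz⟩⟩
  | succ k ih =>
    intro hk s hs
    have hpos : 0 < s.reg x := by
      rw [hx _ (Nat.sub_le _ _) s hs]; omega
    obtain ⟨s₁, h1, hr1⟩ := hstep (N - (k + 1)) (by omega) s hs
    have he : N - (k + 1) + 1 = N - k := by omega
    rw [he] at h1
    obtain ⟨s₂, h2, hr2⟩ := ih (by omega) s₁ h1
    refine ⟨s₂, h2, fun κ K hK hκ => ?_⟩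
    obtain ⟨t, ht, het⟩ := hr1 κ K hK hκ
    obtain ⟨u, hu, heu⟩ := hr2 κ K hK hκ
    refine ⟨t + u + 1, ?_, .loop_pos hpos het heu⟩
    rw [Finset.sum_eq_sum_Ico_succ_bot (by omega), he]
    rw [mul_add] at hu ⊢
    rw [mul_add, mul_add]
    omega

theorem Ends.loop_const (I : ℕ → State → Prop) (T N : ℕ)
    (hx : ∀ i ≤ N, ∀ s, I i s → s.reg x = N - i)
    (hstep : ∀ i < N, ∀ s, I i s → Ends B p s T (I (i + 1))) (h0 : I 0 s) :
    Ends B (.loop x p) s (N * (T + 1) + 1) (I N) := by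
  simpa using Ends.loop I (fun _ => T) N hx hstep h0

end RAM

namespace RAM

local infixr:60 " ⨟ " => Prog.seq

/-! ### The program -/

/-- One coordinate of the comparison of neighbor differences. -/
def compareBody : Prog :=
  -- Registers 46 to 49 run through the coordinates of four vectors, and 44 is the flag for
  -- equality. Only positivity can be tested, so both the value and its negative are.
  .load 50 46 ⨟ .load 51 47 ⨟ .sub 50 50 51 ⨟ .load 51 48 ⨟ .sub 50 50 51 ⨟ .load 51 49 ⨟
  .add 50 50 51 ⨟ .ite 50 (.const 44 0) (.const 51 0) ⨟ .sub 50 9 50 ⨟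
  .ite 50 (.const 44 0) (.const 51 0) ⨟
  .add 46 46 1 ⨟ .add 47 47 1 ⨟ .add 48 48 1 ⨟ .add 49 49 1 ⨟ .sub 45 45 1

/-- One neighbor in the search for a translate of a neighbor. -/
def searchBody : Prog :=
  -- Registers 42, 25, 21, 17 point to the vectors of the candidate `i` and of `l`, `k`, `j`;
  -- register 9 is always 0, so adding it copies. Register 43 is the address of the weight of `i`.
  .const 44 1 ⨟ .add 45 2 9 ⨟ .add 46 42 9 ⨟ .add 47 25 9 ⨟ .add 48 21 9 ⨟ .add 49 17 9 ⨟
  .loop 45 compareBody ⨟ .add 42 46 9 ⨟ .load 50 43 ⨟ .ite 44 (.const 51 0) (.const 50 0) ⨟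
  .add 40 40 50 ⨟ .sub 43 43 1 ⨟ .sub 41 41 1

/-- Puts the weight of the translate of a neighbor into register 40. -/
def search : Prog :=
  .const 40 0 ⨟ .add 41 3 9 ⨟ .add 42 8 9 ⨟ .sub 43 9 1 ⨟ .loop 41 searchBody

/-- One cell of a copy of the table of codes. -/
def fillBody : Prog :=
  .load 33 31 ⨟ .add 33 33 28 ⨟ .store 30 33 ⨟ .add 30 30 1 ⨟ .add 31 31 1 ⨟ .sub 32 32 1

/-- One shifted copy of the table of codes. -/
def copyBody : Prog :=
  .add 28 28 26 ⨟ .add 31 7 9 ⨟ .add 32 27 9 ⨟ .loop 32 fillBody ⨟ .sub 29 29 1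

/-- Extends the table of codes by one more digit. -/
def layerBody : Prog :=
  search ⨟ .add 26 40 9 ⨟ .add 28 9 9 ⨟ .add 29 4 9 ⨟ .sub 27 30 7 ⨟ .loop 29 copyBody ⨟
  .add 25 25 2 ⨟ .sub 24 24 1

/-- Builds the table of the codes of shifted neighborhood states. -/
def build : Prog :=
  .store 7 9 ⨟ .add 30 7 1 ⨟ .add 24 19 9 ⨟ .add 25 8 9 ⨟ .loop 24 layerBody

/-- One cell of the accumulation. -/
def accumulateBody : Prog :=
  -- The code at 31 leads to two new states: register 28 is the base address with the leading digit
  -- set, register 6 the base address without it. Register 27 is the state to subtract.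
  .load 33 31 ⨟ .add 34 33 28 ⨟ .load 34 34 ⨟ .add 33 33 6 ⨟ .load 33 33 ⨟ .sub 34 34 33 ⨟
  .sub 34 34 27 ⨟ .load 33 30 ⨟ .add 33 33 34 ⨟ .store 30 33 ⨟
  .add 30 30 1 ⨟ .add 31 31 1 ⨟ .sub 32 32 1

/-- The accumulation for one state of the leading neighbor. -/
def stateBody : Prog :=
  .add 28 28 24 ⨟ .add 27 27 23 ⨟ .add 31 7 9 ⨟ .add 32 18 9 ⨟ .loop 32 accumulateBody ⨟
  .sub 29 29 1

/-- The accumulation for one translate of the leading neighbor. -/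
def translateBody : Prog :=
  build ⨟ .load 24 22 ⨟ .add 28 6 9 ⨟ .add 27 9 9 ⨟ .add 30 15 9 ⨟ .add 29 4 9 ⨟
  .loop 29 stateBody ⨟ .add 21 21 2 ⨟ .sub 22 22 1 ⨟ .add 23 9 9 ⨟ .sub 20 20 1

/-- The accumulation for one leading neighbor. -/
def leadBody : Prog :=
  -- Register 23 is 1 in the first round only: the neighbor 0 serves as `k₀`.
  .add 20 3 9 ⨟ .add 21 8 9 ⨟ .sub 22 9 1 ⨟ .add 23 1 9 ⨟ .loop 20 translateBody ⨟
  .sub 33 30 15 ⨟ .add 18 18 33 ⨟ .add 15 30 9 ⨟ .add 17 17 2 ⨟ .add 19 19 1 ⨟ .sub 16 16 1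

/-- Clears register 0 unless the memory cell is zero. -/
def zeroBody : Prog :=
  .load 18 16 ⨟ .ite 18 (.const 0 0) (.const 19 0) ⨟ .sub 18 9 18 ⨟
  .ite 18 (.const 0 0) (.const 19 0) ⨟ .add 16 16 1 ⨟ .sub 17 17 1

/-- Multiplies the weight by the number of states, and stores it. -/
def weightBody : Prog :=
  .store 12 11 ⨟ .sub 12 12 1 ⨟ .add 13 11 9 ⨟ .add 14 4 9 ⨟
  .loop 14 (.add 11 11 13 ⨟ .sub 14 14 1) ⨟ .sub 10 10 1

/-- The case of at least two states. -/
def mainCase : Prog :=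
  -- Memory layout: the weights at negative addresses, the input up to the cell before register 7,
  -- the codes from there on, and one table size further the accumulators, indexed by row number.
  -- Register 15 starts at the accumulator of row 1.
  .add 5 8 9 ⨟ .add 10 3 9 ⨟ .loop 10 (.add 5 5 2 ⨟ .sub 10 10 1) ⨟ .add 6 5 3 ⨟
  .add 11 3 1 ⨟ .sub 12 9 1 ⨟ .add 10 3 9 ⨟ .loop 10 weightBody ⨟
  .add 7 5 11 ⨟ .add 15 7 11 ⨟ .add 15 15 1 ⨟
  .load 16 6 ⨟ .ite 16 (.const 0 0) (.const 17 0) ⨟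
  .add 16 3 9 ⨟ .add 17 8 9 ⨟ .const 18 1 ⨟ .const 19 0 ⨟ .loop 16 leadBody ⨟
  .add 16 7 11 ⨟ .sub 17 15 16 ⨟ .loop 17 zeroBody

/-- The program that decides number conservation. -/
def decider : Prog :=
  .const 1 1 ⨟ .load 2 9 ⨟ .load 3 1 ⨟ .const 8 2 ⨟ .load 4 8 ⨟ .const 0 1 ⨟ .const 8 3 ⨟
  .ite 4 mainCase (.const 10 0)

/-! ### What the program computes -/

/-- One coordinate of the difference of two neighbor differences. -/
def offset (M : ℤ → ℤ) (a b c e : ℤ) (i : ℕ) : ℤ :=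
  M (a + i) - M (b + i) - M (c + i) + M (e + i)

/-- The vectors at these addresses satisfy `x_a - x_b - x_c + x_e = 0`. -/
def Balanced (M : ℤ → ℤ) (d : ℕ) (a b c e : ℤ) : Prop :=
  ∀ i < d, offset M a b c e i = 0

theorem balanced_congr {M M' : ℤ → ℤ} {d : ℕ} {a b c e : ℤ}
    (h : ∀ i < d, M (a + i) = M' (a + i) ∧ M (b + i) = M' (b + i) ∧ M (c + i) = M' (c + i) ∧
      M (e + i) = M' (e + i)) : Balanced M d a b c e ↔ Balanced M' d a b c e := by
  refine forall₂_congr fun i hi => ?_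
  obtain ⟨h1, h2, h3, h4⟩ := h i hi
  simp only [offset, h1, h2, h3, h4]

/-- The address of the vector `i`. -/
def vecAddr (d i : ℕ) : ℤ := 3 + (i : ℤ) * d

theorem vecAddr_succ (d i : ℕ) : vecAddr d (i + 1) = vecAddr d i + d := by
  simp only [vecAddr]; push_cast; ring

theorem vecAddr_zero (d : ℕ) : vecAddr d 0 = 3 := by simp [vecAddr]

theorem vecAddr_nonneg (d i : ℕ) : 0 ≤ vecAddr d i := by
  simp only [vecAddr]; positivity

theorem vecAddr_add_le {d i v : ℕ} (h : i < v) : vecAddr d i + d ≤ vecAddr d v := by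
  rw [← vecAddr_succ]
  simp only [vecAddr]
  have : ((i + 1 : ℕ) : ℤ) * d ≤ v * d :=
    mul_le_mul_of_nonneg_right (by exact_mod_cast h) (by positivity)
  linarith

/-- The distance in the table between rows that differ by one in the digit `l`. -/
def weight (v m l : ℕ) : ℤ := (v + 1) * (m + 1) ^ l

open Classical in
/-- The weight of the neighbor `i` with `x_i = x_l + x_k - x_j`, if there is one. -/
noncomputable def shiftWeight (M : ℤ → ℤ) (d v m j k l n : ℕ) : ℤ :=
  ∑ i ∈ Finset.range n,
    if Balanced M d (vecAddr d i) (vecAddr d l) (vecAddr d k) (vecAddr d j) then weight v m i else 0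

/-! ### Verification -/

theorem compare_spec {B d : ℕ} {s : State} {a b c e : ℤ} (h1 : s.reg 1 = 1) (h9 : s.reg 9 = 0)
    (h44 : s.reg 44 = 1) (h45 : s.reg 45 = d) (h46 : s.reg 46 = a) (h47 : s.reg 47 = b)
    (h48 : s.reg 48 = c) (h49 : s.reg 49 = e) (ha : 0 ≤ a ∧ a + d ≤ B) (hb : 0 ≤ b ∧ b + d ≤ B)
    (hc : 0 ≤ c ∧ c + d ≤ B) (he : 0 ≤ e ∧ e + d ≤ B) :
    Ends B (.loop 45 compareBody) s (d * 18 + 1) fun s' =>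
      Same 44 s s' ∧ s'.mem = s.mem ∧ s'.reg 46 = a + d ∧
      (Balanced s.mem d a b c e → s'.reg 44 = 1) ∧
      (¬ Balanced s.mem d a b c e → s'.reg 44 = 0) := by
  classical
  refine (Ends.loop_const (I := fun i s' => Same 44 s s' ∧ s'.mem = s.mem ∧
    (s'.reg 45 = d - i ∧ s'.reg 46 = a + i ∧ s'.reg 47 = b + i ∧ s'.reg 48 = c + i ∧
    s'.reg 49 = e + i) ∧ s'.reg 44 = if Balanced s.mem i a b c e then 1 else 0) 17 d
    (fun i _ s h => h.2.2.1.1) ?_ ?_).mono le_rfl fun s' h => ⟨h.1, h.2.1, h.2.2.1.2.1,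
      fun hb => by rw [h.2.2.2, if_pos hb], fun hb => by rw [h.2.2.2, if_neg hb]⟩
  · rintro i hi s' ⟨hf, hm, ⟨g45, g46, g47, g48, g49⟩, g44⟩
    have g1 := (hf 1 (by norm_num)).trans h1
    have g9 := (hf 9 (by norm_num)).trans h9
    obtain ⟨w₁, k1⟩ : ∃ w, s'.mem (a + i) = w := ⟨_, rfl⟩
    obtain ⟨w₂, k2⟩ : ∃ w, s'.mem (b + i) = w := ⟨_, rfl⟩
    obtain ⟨w₃, k3⟩ : ∃ w, s'.mem (c + i) = w := ⟨_, rfl⟩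
    obtain ⟨w₄, k4⟩ : ∃ w, s'.mem (e + i) = w := ⟨_, rfl⟩
    have hof : Balanced s.mem (i + 1) a b c e ↔
        Balanced s.mem i a b c e ∧ w₁ - w₂ - w₃ + w₄ = 0 := by
      rw [← k1, ← k2, ← k3, ← k4, hm]
      exact Nat.forall_lt_succ_right
    unfold compareBody
    repeat
      first
      | refine Ends.add_seq ?_
      | refine Ends.sub_seq ?_
      | refine Ends.const_seq ?_
      | refine Ends.ite_const_seq (by decide) ?_
      | refine Ends.load_seq (by
          simp only [State.reg_setReg, State.mem_setReg, State.reg_setMem, Nat.reduceEqDiff,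
            reduceIte, g1, g9, g44, g45, g46, g47, g48, g49, k1, k2, k3, k4]; omega) ?_
      try simp only [State.reg_setReg, State.mem_setReg, State.reg_setMem, Nat.reduceEqDiff,
        reduceIte, g1, g9, g44, g45, g46, g47, g48, g49, k1, k2, k3, k4]
    refine Ends.sub ?_
    simp only [State.reg_setReg, State.mem_setReg, Nat.reduceEqDiff, reduceIte, g1, g44, g45, g46,
      g47, g48, g49, hof, same_setReg, Nat.reduceLeDiff]
    refine ⟨hf, hm, by omega, ?_⟩
    by_cases hp : Balanced s.mem i a b c e
    · simp only [eq_true hp, true_and, if_true]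
      split_ifs <;> omega
    · simp only [hp, false_and, if_false]
      split_ifs <;> rfl
  · refine ⟨Same.refl _ _, rfl, by simp [*], by simp [h44, Balanced]⟩

theorem search_spec {B d v m j k l : ℕ} {s : State} (h1 : s.reg 1 = 1) (h2 : s.reg 2 = d)
    (h3 : s.reg 3 = v) (h8 : s.reg 8 = 3) (h9 : s.reg 9 = 0) (h17 : s.reg 17 = vecAddr d j)
    (h21 : s.reg 21 = vecAddr d k) (h25 : s.reg 25 = vecAddr d l) (hj : j < v) (hk : k < v)
    (hl : l < v) (hB : vecAddr d v ≤ B) (hB' : v ≤ B)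
    (hw : ∀ i < v, s.mem (-1 - (i : ℤ)) = weight v m i) :
    Ends B search s (v * (d * 18 + 15) + 5) fun s' =>
      Same 40 s s' ∧ s'.mem = s.mem ∧ s'.reg 40 = shiftWeight s.mem d v m j k l v := by
  classical
  unfold search
  repeat
    first
    | refine Ends.add_seq ?_
    | refine Ends.sub_seq ?_
    | refine Ends.const_seq ?_
    | refine Ends.ite_const_seq (by decide) ?_
    try simp only [State.reg_setReg, State.mem_setReg, State.reg_setMem, Nat.reduceEqDiff,
      reduceIte, h3, h8, h9, h1]
  refine (Ends.loop_const (I := fun i s' => Same 40 s s' ∧ s'.mem = s.mem ∧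
    (s'.reg 41 = v - i ∧ s'.reg 42 = vecAddr d i ∧ s'.reg 43 = -1 - i) ∧
    s'.reg 40 = shiftWeight s.mem d v m j k l i) (d * 18 + 14) v
    (fun i _ s h => h.2.2.1.1) ?_ ?_).mono le_rfl fun s' h => ⟨h.1, h.2.1, h.2.2.2⟩
  · rintro i hi s' ⟨hf, hm, ⟨g41, g42, g43⟩, g40⟩
    have g1 := (hf 1 (by norm_num)).trans h1
    have g2 := (hf 2 (by norm_num)).trans h2
    have g9 := (hf 9 (by norm_num)).trans h9
    have g17 := (hf 17 (by norm_num)).trans h17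
    have g21 := (hf 21 (by norm_num)).trans h21
    have g25 := (hf 25 (by norm_num)).trans h25
    unfold searchBody
    repeat
      first
      | refine Ends.add_seq ?_
      | refine Ends.sub_seq ?_
      | refine Ends.const_seq ?_
      | refine Ends.ite_const_seq (by decide) ?_
      try simp only [State.reg_setReg, State.mem_setReg, State.reg_setMem, Nat.reduceEqDiff,
        reduceIte, g1, g2, g9, g17, g21, g25, g41, g42, g43, add_zero]
    have hr : ∀ i < v, 0 ≤ vecAddr d i ∧ vecAddr d i + d ≤ B := fun i hi =>
      ⟨vecAddr_nonneg d i, (vecAddr_add_le hi).trans hB⟩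
    refine Ends.seq_le (U := 7) (compare_spec (a := vecAddr d i) (b := vecAddr d l)
      (c := vecAddr d k) (e := vecAddr d j) ?_ ?_ ?_ ?_ ?_ ?_ ?_ ?_ (hr i hi) (hr l hl)
      (hr k hk) (hr j hj)) ?_ (by omega)
    iterate 8
      simp only [State.reg_setReg, Nat.reduceEqDiff, reduceIte, g1, g2, g9, g17, g21, g25, g42]
    rintro s₁ ⟨hf₁, hm₁, e46, e44, e44'⟩
    simp only [State.mem_setReg, hm] at hm₁ e44 e44'
    have hf₂ : Same 40 s s₁ := hf.trans ((show Same 40 s' _ by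
      simp only [same_setReg, Nat.reduceLeDiff]; exact Same.refl _ _).trans (hf₁.le (by norm_num)))
    have e1 := (hf₂ 1 (by norm_num)).trans h1
    have e9 := (hf₂ 9 (by norm_num)).trans h9
    have e40 := hf₁ 40 (by norm_num)
    have e41 := hf₁ 41 (by norm_num)
    have e43 := hf₁ 43 (by norm_num)
    simp only [State.reg_setReg, Nat.reduceEqDiff, reduceIte, g40, g41, g43] at e40 e41 e43
    have hwi : s₁.mem (-1 - i) = weight v m i := by rw [hm₁]; exact hw i hi
    repeat
      first
      | refine Ends.add_seq ?_
      | refine Ends.sub_seq ?_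
      | refine Ends.const_seq ?_
      | refine Ends.ite_const_seq (by decide) ?_
      | refine Ends.load_seq (by
          simp only [State.reg_setReg, State.mem_setReg, State.reg_setMem, Nat.reduceEqDiff,
            reduceIte, e1, e9, e40, e41, e43, e46, hwi, add_zero]; omega) ?_
      try simp only [State.reg_setReg, State.mem_setReg, State.reg_setMem, Nat.reduceEqDiff,
        reduceIte, e1, e9, e40, e41, e43, e46, hwi, add_zero]
    refine Ends.sub ?_
    simp only [State.reg_setReg, State.mem_setReg, Nat.reduceEqDiff, reduceIte, e1, e40, e41, e43,
      same_setReg, Nat.reduceLeDiff, e46]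
    refine ⟨hf₂, hm₁, ⟨by omega, (vecAddr_succ d i).symm, by push_cast; ring⟩, ?_⟩
    rw [shiftWeight, shiftWeight, Finset.sum_range_succ]
    by_cases hb : Balanced s.mem d (vecAddr d i) (vecAddr d l) (vecAddr d k) (vecAddr d j)
    · rw [e44 hb, if_pos hb]; simp
    · rw [e44' hb, if_neg hb]; simp
  · simp only [State.reg_setReg, State.mem_setReg, Nat.reduceEqDiff, reduceIte,
      same_setReg, Nat.reduceLeDiff]
    refine ⟨Same.refl _ _, trivial, ⟨by simp, by simp [vecAddr_zero], by simp⟩,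
      by simp [shiftWeight]⟩

end RAM

/-! ### Correctness of the table of codes. -/

namespace RAM

theorem fill_spec {B N P : ℕ} {T c : ℤ} {s : State} (h1 : s.reg 1 = 1) (h28 : s.reg 28 = c)
    (h30 : s.reg 30 = T + P) (h31 : s.reg 31 = T) (h32 : s.reg 32 = N) (hT : 0 ≤ T) (hN : N ≤ P)
    (hB : T + P + N ≤ B) :
    Ends B (.loop 32 fillBody) s (N * 7 + 1) fun s' =>
      Same 30 s s' ∧ s'.reg 30 = T + P + N ∧
      ∀ a, s'.mem a = if T + P ≤ a ∧ a < T + P + N then s.mem (a - P) + c else s.mem a := by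
  refine (Ends.loop_const (I := fun i s' => Same 30 s s' ∧
    (s'.reg 32 = N - i ∧ s'.reg 31 = T + i ∧ s'.reg 30 = T + P + i) ∧
    ∀ a, s'.mem a = if T + P ≤ a ∧ a < T + P + i then s.mem (a - P) + c else s.mem a) 6 N
    (fun i _ s h => h.2.1.1) ?_ ?_).mono le_rfl fun s' h => ⟨h.1, h.2.1.2.2, h.2.2⟩
  · rintro i hi s' ⟨hf, ⟨g32, g31, g30⟩, hm⟩
    have g1 := (hf 1 (by norm_num)).trans h1
    have g28 := (hf 28 (by norm_num)).trans h28
    -- The source cell lies below the written range because `i < N ≤ P`.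
    have k := hm (T + i)
    rw [if_neg (by omega)] at k
    unfold fillBody
    repeat
      first
      | refine Ends.add_seq ?_
      | refine Ends.sub_seq ?_
      | refine Ends.const_seq ?_
      | refine Ends.ite_const_seq (by decide) ?_
      | refine Ends.load_seq (by
          simp only [State.reg_setReg, State.mem_setReg, State.reg_setMem, Nat.reduceEqDiff,
            reduceIte, g1, g28, g30, g31, g32, k]; omega) ?_
      | refine Ends.store_seq (by
          simp only [State.reg_setReg, State.mem_setReg, State.reg_setMem, Nat.reduceEqDiff,
            reduceIte, g1, g28, g30, g31, g32, k]; omega) ?_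
      try simp only [State.reg_setReg, State.mem_setReg, State.reg_setMem, Nat.reduceEqDiff,
        reduceIte, g1, g28, g30, g31, g32, k]
    refine Ends.sub ?_
    simp only [State.reg_setReg, State.mem_setReg, State.reg_setMem, State.mem_setMem,
      Nat.reduceEqDiff, reduceIte, g1, g30, g31, g32, same_setReg, same_setMem, Nat.reduceLeDiff]
    refine ⟨hf, by omega, fun a => ?_⟩
    rw [hm]
    by_cases ha : a = T + P + i
    · rw [if_pos ha, if_pos (by omega)]
      congr 2
      omega
    · rw [if_neg ha]
      refine if_congr (by omega) rfl rfl
  · exact ⟨Same.refl _ _, by simp [*], fun a => by rw [if_neg (by omega)]⟩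

theorem copy_spec {B N m : ℕ} {T w : ℤ} {s : State} (h1 : s.reg 1 = 1) (h9 : s.reg 9 = 0)
    (h7 : s.reg 7 = T) (h26 : s.reg 26 = w) (h27 : s.reg 27 = N) (h28 : s.reg 28 = 0)
    (h29 : s.reg 29 = m) (h30 : s.reg 30 = T + N) (hT : 0 ≤ T)
    (hB : T + ((m + 1) * N : ℕ) ≤ B) :
    Ends B (.loop 29 copyBody) s (m * (N * 7 + 6) + 1) fun s' =>
      Same 28 s s' ∧ s'.reg 30 = T + ((m + 1) * N : ℕ) ∧
      (∀ x ≤ m, ∀ r < N, s'.mem (T + (x * N : ℕ) + r) = s.mem (T + r) + x * w) ∧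
      ∀ a, a < T + N ∨ T + ((m + 1) * N : ℕ) ≤ a → s'.mem a = s.mem a := by
  refine (Ends.loop_const (I := fun i s' => Same 28 s s' ∧
    (s'.reg 29 = m - i ∧ s'.reg 28 = i * w ∧ s'.reg 30 = T + ((i + 1) * N : ℕ)) ∧
    (∀ x ≤ i, ∀ r < N, s'.mem (T + (x * N : ℕ) + r) = s.mem (T + r) + x * w) ∧
    ∀ a, a < T + N ∨ T + ((i + 1) * N : ℕ) ≤ a → s'.mem a = s.mem a) (N * 7 + 5) m
    (fun i _ s h => h.2.1.1) ?_ ?_).mono le_rfl fun s' h => ⟨h.1, h.2.1.2.2, h.2.2⟩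
  · rintro i hi s' ⟨hf, ⟨g29, g28, g30⟩, hm, hm'⟩
    have g1 := (hf 1 (by norm_num)).trans h1
    have g7 := (hf 7 (by norm_num)).trans h7
    have g9 := (hf 9 (by norm_num)).trans h9
    have g26 := (hf 26 (by norm_num)).trans h26
    have g27 := (hf 27 (by norm_num)).trans h27
    have hle : (i + 1) * N + N ≤ (m + 1) * N := by
      rw [← Nat.succ_mul]; exact Nat.mul_le_mul_right N (by omega)
    have hN : N ≤ (i + 1) * N := Nat.le_mul_of_pos_left N (by omega)
    have hs : (i + 1 + 1) * N = (i + 1) * N + N := Nat.succ_mul _ _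
    unfold copyBody
    repeat
      first
      | refine Ends.add_seq ?_
      | refine Ends.sub_seq ?_
      | refine Ends.const_seq ?_
      | refine Ends.ite_const_seq (by decide) ?_
      try simp only [State.reg_setReg, State.mem_setReg, State.reg_setMem, Nat.reduceEqDiff,
        reduceIte, g1, g7, g9, g26, g27, g28, g29, g30, add_zero]
    refine Ends.seq_le (U := 1) (fill_spec (N := N) (P := (i + 1) * N) (T := T)
      (c := i * w + w) ?_ ?_ ?_ ?_ ?_ hT hN (by omega)) ?_ (by omega)
    iterate 5
      simp only [State.reg_setReg, Nat.reduceEqDiff, reduceIte, g1, g7, g27, g30]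
    rintro s₁ ⟨hf₁, e30, hm₁⟩
    simp only [State.mem_setReg] at hm₁
    have hf₂ : Same 28 s s₁ := hf.trans ((show Same 28 s' _ by
      simp only [same_setReg, Nat.reduceLeDiff]; exact Same.refl _ _).trans (hf₁.le (by norm_num)))
    have e1 := (hf₂ 1 (by norm_num)).trans h1
    have e28 := hf₁ 28 (by norm_num)
    have e29 := hf₁ 29 (by norm_num)
    simp only [State.reg_setReg, Nat.reduceEqDiff, reduceIte, g29] at e28 e29
    refine Ends.sub ?_
    simp only [State.reg_setReg, State.mem_setReg, Nat.reduceEqDiff, reduceIte, e1, e28, e29, e30,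
      same_setReg, Nat.reduceLeDiff]
    refine ⟨hf₂, ⟨by omega, by push_cast; ring, by omega⟩, fun x hx r hr => ?_, fun a ha => ?_⟩
    · rw [hm₁]
      rcases Nat.lt_or_ge x (i + 1) with hlt | hge
      · have : x * N + N ≤ (i + 1) * N := by
          rw [← Nat.succ_mul]; exact Nat.mul_le_mul_right N (by omega)
        rw [if_neg (by omega), hm x (by omega) r hr]
      · obtain rfl : x = i + 1 := by omega
        rw [if_pos (by omega)]
        have := hm 0 (Nat.zero_le _) r hr
        simp only [Nat.zero_mul, Nat.cast_zero, add_zero, zero_mul] at this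
        have h3 : T + ((i + 1) * N : ℕ) + r - ((i + 1) * N : ℕ) = T + r := by ring
        rw [h3, this]
        push_cast
        ring
    · rw [hm₁, if_neg (by omega), hm' a (by omega)]
  · refine ⟨Same.refl _ _, by simp [*], fun x hx r hr => ?_, fun a _ => rfl⟩
    obtain rfl : x = 0 := by omega
    simp

/-- The registers that keep their contents during the main loop. -/
structure Globals (d v m : ℕ) (F T : ℤ) (s : State) : Prop where
  one : s.reg 1 = 1
  dim : s.reg 2 = d
  arity : s.reg 3 = v
  states : s.reg 4 = m
  values : s.reg 6 = F
  codes : s.reg 7 = T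
  three : s.reg 8 = 3
  zero : s.reg 9 = 0

theorem Globals.of_same {d v m : ℕ} {F T : ℤ} {s s' : State} (h : Globals d v m F T s)
    (hs : Same 10 s s') : Globals d v m F T s' where
  one := (hs 1 (by norm_num)).trans h.one
  dim := (hs 2 (by norm_num)).trans h.dim
  arity := (hs 3 (by norm_num)).trans h.arity
  states := (hs 4 (by norm_num)).trans h.states
  values := (hs 6 (by norm_num)).trans h.values
  codes := (hs 7 (by norm_num)).trans h.codes
  three := (hs 8 (by norm_num)).trans h.three
  zero := (hs 9 (by norm_num)).trans h.zero

/-- The offset in the table of the row of a shifted neighborhood state. -/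
noncomputable def shiftCode (M : ℤ → ℤ) (d v m j k r : ℕ) : ℤ :=
  ∑ l ∈ Finset.range v, ((r / (m + 1) ^ l % (m + 1) : ℕ) : ℤ) * shiftWeight M d v m j k l v

theorem digit_add {m l x r : ℕ} (hx : x ≤ m) (hr : r < (m + 1) ^ l) (l' : ℕ) :
    (x * (m + 1) ^ l + r) / (m + 1) ^ l' % (m + 1) =
      r / (m + 1) ^ l' % (m + 1) + if l' = l then x else 0 := by
  have hq : 0 < m + 1 := Nat.succ_pos _
  rcases lt_trichotomy l' l with h | rfl | h
  · rw [if_neg h.ne, add_zero, CellularAutomaton.add_mul_div_pow h hq]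
  · rw [if_pos rfl, mul_comm, Nat.mul_add_div (pow_pos hq _), Nat.div_eq_of_lt hr, add_zero,
      Nat.zero_mod, zero_add, Nat.mod_eq_of_lt (by omega)]
  · have hle : (m + 1) ^ (l + 1) ≤ (m + 1) ^ l' := Nat.pow_le_pow_right hq h
    have h1 : (x + 1) * (m + 1) ^ l ≤ (m + 1) ^ (l + 1) := by
      rw [pow_succ, mul_comm _ (m + 1)]
      exact Nat.mul_le_mul_right _ (by omega)
    rw [Nat.succ_mul] at h1
    rw [if_neg h.ne', Nat.div_eq_of_lt (by omega), Nat.div_eq_of_lt (by omega), add_zero]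

/-- Linearity of the code in the digits: prepending a digit `x` adds a constant to a whole block,
which is why shifted copies build the table. -/
theorem shiftCode_add {M : ℤ → ℤ} {d v m j k l x r : ℕ} (hx : x ≤ m) (hr : r < (m + 1) ^ l)
    (hl : l < v) : shiftCode M d v m j k (x * (m + 1) ^ l + r) =
      shiftCode M d v m j k r + x * shiftWeight M d v m j k l v := by
  simp only [shiftCode, digit_add hx hr]
  push_cast
  simp only [add_mul, Finset.sum_add_distrib, ite_mul, zero_mul, Finset.sum_ite_eq',
    Finset.mem_range, hl, if_true]

theorem shiftCode_zero {M : ℤ → ℤ} {d v m j k : ℕ} : shiftCode M d v m j k 0 = 0 := by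
  simp [shiftCode]

theorem shiftWeight_congr {M M' : ℤ → ℤ} {d v m j k l n : ℕ} (hj : j < v) (hk : k < v)
    (hl : l < v) (hn : n ≤ v) (h : ∀ a < vecAddr d v, M a = M' a) :
    shiftWeight M d v m j k l n = shiftWeight M' d v m j k l n := by
  classical
  have hc : ∀ i < v, ∀ e < d, M (vecAddr d i + e) = M' (vecAddr d i + e) := fun i hi e he =>
    h _ (by have := vecAddr_add_le (d := d) hi; omega)
  refine Finset.sum_congr rfl fun i hi => if_congr (balanced_congr fun e he => ?_) rfl rfl
  exact ⟨hc i ((Finset.mem_range.1 hi).trans_le hn) e he, hc l hl e he, hc k hk e he,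
    hc j hj e he⟩

/-- Here and below `M` is a fixed reference memory that agrees with the machine below `T`, where
nothing is written any more. -/
theorem layer_spec {B d v m j k l : ℕ} {F T : ℤ} {M : ℤ → ℤ} {s : State}
    (hg : Globals d v m F T s) (h17 : s.reg 17 = vecAddr d j) (h21 : s.reg 21 = vecAddr d k)
    (h25 : s.reg 25 = vecAddr d l) (h30 : s.reg 30 = T + ((m + 1) ^ l : ℕ))
    (hj : j < v) (hk : k < v) (hl : l < v) (hT : vecAddr d v ≤ T)
    (hB : T + ((m + 1) ^ v : ℕ) ≤ B) (hB' : v ≤ B)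
    (hw : ∀ i < v, M (-1 - (i : ℤ)) = weight v m i) (hM : ∀ a < T, s.mem a = M a)
    (hc : ∀ r < (m + 1) ^ l, s.mem (T + r) = shiftCode M d v m j k r) :
    Ends B layerBody s (v * (d * 18 + 15) + m * ((m + 1) ^ l * 7 + 6) + 12) fun s' =>
      Same 24 s s' ∧ s'.reg 24 = s.reg 24 - 1 ∧ s'.reg 25 = vecAddr d (l + 1) ∧
      s'.reg 30 = T + ((m + 1) ^ (l + 1) : ℕ) ∧
      (∀ r < (m + 1) ^ (l + 1), s'.mem (T + r) = shiftCode M d v m j k r) ∧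
      ∀ a, a < T ∨ T + ((m + 1) ^ (l + 1) : ℕ) ≤ a → s'.mem a = s.mem a := by
  have hT0 : 0 ≤ T := (vecAddr_nonneg d v).trans hT
  have hpow : (m + 1) ^ (l + 1) = (m + 1) * (m + 1) ^ l := by rw [pow_succ, mul_comm]
  have hpos : 0 < (m + 1) ^ l := by positivity
  have hle : (m + 1) ^ (l + 1) ≤ (m + 1) ^ v := Nat.pow_le_pow_right (Nat.succ_pos _) hl
  have hle' : (m + 1) ^ l ≤ (m + 1) ^ (l + 1) := Nat.pow_le_pow_right (Nat.succ_pos _) (by omega)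
  unfold layerBody
  refine Ends.seq_le (U := m * ((m + 1) ^ l * 7 + 6) + 7)
    (search_spec (B := B) (m := m) hg.one hg.dim hg.arity hg.three hg.zero h17
      h21 h25 hj hk hl (by omega) hB' fun i hi => ?_) ?_ (by omega)
  · rw [hM _ (by omega), hw i hi]
  rintro s₁ ⟨hf₁, hm₁, e40⟩
  rw [shiftWeight_congr hj hk hl le_rfl fun a ha => hM a (by omega)] at e40
  have g₁ := hg.of_same (hf₁.le (by norm_num))
  have f25 := (hf₁ 25 (by norm_num)).trans h25
  have f30 := (hf₁ 30 (by norm_num)).trans h30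
  repeat
    first
    | refine Ends.add_seq ?_
    | refine Ends.sub_seq ?_
    | refine Ends.const_seq ?_
    | refine Ends.ite_const_seq (by decide) ?_
    try simp only [State.reg_setReg, State.mem_setReg, State.reg_setMem, Nat.reduceEqDiff,
      reduceIte, g₁.zero, g₁.states, g₁.codes, e40, f30, add_zero, add_sub_cancel_left]
  refine Ends.seq_le (U := 2) (copy_spec (B := B) (N := (m + 1) ^ l) (m := m) (T := T)
    (w := shiftWeight M d v m j k l v) ?_ ?_ ?_ ?_ ?_ ?_ ?_ ?_ hT0 (by omega)) ?_ (by omega)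
  iterate 8
    simp only [State.reg_setReg, Nat.reduceEqDiff, reduceIte, g₁.one, g₁.zero, g₁.codes, f30]
  rintro s₂ ⟨hf₂, e30, hm₂, hm₂'⟩
  simp only [State.mem_setReg, hm₁] at hm₂ hm₂'
  have hf₃ : Same 24 s s₂ := (hf₁.le (by norm_num)).trans ((show Same 24 s₁ _ by
    simp only [same_setReg, Nat.reduceLeDiff]; exact Same.refl _ _).trans (hf₂.le (by norm_num)))
  have g₂ := hg.of_same (hf₃.le (by norm_num))
  have e24 := hf₂ 24 (by norm_num)
  have e25 := hf₂ 25 (by norm_num)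
  simp only [State.reg_setReg, Nat.reduceEqDiff, reduceIte, f25] at e24 e25
  rw [hf₁ 24 (by norm_num)] at e24
  repeat
    first
    | refine Ends.add_seq ?_
    | refine Ends.sub_seq ?_
    | refine Ends.const_seq ?_
    | refine Ends.ite_const_seq (by decide) ?_
    try simp only [State.reg_setReg, State.mem_setReg, State.reg_setMem, Nat.reduceEqDiff,
      reduceIte, g₂.dim, e24, e25]
  refine Ends.sub ?_
  simp only [State.reg_setReg, State.mem_setReg, Nat.reduceEqDiff, reduceIte, g₂.one, e24, e25, e30,
    same_setReg, Nat.reduceLeDiff]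
  refine ⟨hf₃, trivial, (vecAddr_succ d l).symm, by rw [hpow], fun r hr => ?_, fun a ha => ?_⟩
  · have hdiv : r / (m + 1) ^ l ≤ m := by
      rw [hpow, mul_comm] at hr
      exact Nat.le_of_lt_succ (Nat.div_lt_of_lt_mul hr)
    have hlt := Nat.mod_lt r hpos
    have hr' := Nat.div_add_mod' r ((m + 1) ^ l)
    have := hm₂ _ hdiv _ hlt
    rw [hc _ hlt, ← shiftCode_add hdiv hlt hl, hr', add_assoc, ← Nat.cast_add, hr'] at this
    exact this
  · exact hm₂' a (by omega)

theorem sum_mul_pow_le (m j : ℕ) : ∑ l ∈ Finset.range j, m * (m + 1) ^ l + 1 = (m + 1) ^ j := by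
  induction j with
  | zero => simp
  | succ j ih => rw [Finset.sum_range_succ, add_right_comm, ih, pow_succ]; ring

theorem build_spec {B d v m j k : ℕ} {F T : ℤ} {M : ℤ → ℤ} {s : State}
    (hg : Globals d v m F T s) (h17 : s.reg 17 = vecAddr d j) (h19 : s.reg 19 = j)
    (h21 : s.reg 21 = vecAddr d k)
    (hj : j < v) (hk : k < v) (hT : vecAddr d v ≤ T)
    (hB : T + ((m + 1) ^ v : ℕ) ≤ B) (hB' : v ≤ B)
    (hw : ∀ i < v, M (-1 - (i : ℤ)) = weight v m i) (hM : ∀ a < T, s.mem a = M a) :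
    Ends B build s (v * (v * (d * 18 + 15) + 13) + 13 * (m + 1) ^ j + 5) fun s' =>
      Same 24 s s' ∧
      (∀ r < (m + 1) ^ j, s'.mem (T + r) = shiftCode M d v m j k r) ∧
      ∀ a, a < T ∨ T + ((m + 1) ^ j : ℕ) ≤ a → s'.mem a = s.mem a := by
  have hT0 : 0 ≤ T := (vecAddr_nonneg d v).trans hT
  have hpv : 0 < (m + 1) ^ v := by positivity
  -- The copying costs form a geometric series, so they are linear in the length of the final table;
  -- the searches cost the same in every layer.
  have htime : ∑ l ∈ Finset.range j, (v * (d * 18 + 15) + m * ((m + 1) ^ l * 7 + 6) + 12 + 1) ≤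
      v * (v * (d * 18 + 15) + 13) + 13 * (m + 1) ^ j := by
    calc _ ≤ ∑ l ∈ Finset.range j, ((v * (d * 18 + 15) + 13) + 13 * (m * (m + 1) ^ l)) := by
          refine Finset.sum_le_sum fun l _ => ?_
          have : m * 1 ≤ m * (m + 1) ^ l := Nat.mul_le_mul_left m (Nat.one_le_pow _ _ (by omega))
          have h2 : m * ((m + 1) ^ l * 7 + 6) = 7 * (m * (m + 1) ^ l) + 6 * m := by ring
          omega
      _ ≤ _ := by
          rw [Finset.sum_add_distrib, ← Finset.mul_sum, Finset.sum_const, Finset.card_range,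
            smul_eq_mul, ← sum_mul_pow_le m j]
          have := Nat.mul_le_mul_right (v * (d * 18 + 15) + 13) hj.le
          omega
  unfold build
  repeat
    first
    | refine Ends.add_seq ?_
    | refine Ends.sub_seq ?_
    | refine Ends.const_seq ?_
    | refine Ends.ite_const_seq (by decide) ?_
    | refine Ends.store_seq (by
        simp only [State.reg_setReg, State.mem_setReg, State.reg_setMem, Nat.reduceEqDiff,
          reduceIte, hg.codes, hg.zero, hg.one, hg.three, h19, add_zero]; omega) ?_
    try simp only [State.reg_setReg, State.mem_setReg, State.reg_setMem, Nat.reduceEqDiff,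
      reduceIte, hg.codes, hg.zero, hg.one, hg.three, h19, add_zero]
  refine (Ends.loop (I := fun l s' => Same 24 s s' ∧ (s'.reg 24 = j - l ∧
    s'.reg 25 = vecAddr d l ∧ s'.reg 30 = T + ((m + 1) ^ l : ℕ)) ∧
    (∀ r < (m + 1) ^ l, s'.mem (T + r) = shiftCode M d v m j k r) ∧
    ∀ a, a < T ∨ T + ((m + 1) ^ l : ℕ) ≤ a → s'.mem a = s.mem a)
    (fun l => v * (d * 18 + 15) + m * ((m + 1) ^ l * 7 + 6) + 12) j
    (fun i _ s h => h.2.1.1) ?_ ?_).mono (by omega) fun s' h => ⟨h.1, h.2.2⟩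
  · rintro l hl s' ⟨hf, ⟨g24, g25, g30⟩, hm, hm'⟩
    refine (layer_spec (hg.of_same (hf.le (by norm_num))) ((hf 17 (by norm_num)).trans h17)
      ((hf 21 (by norm_num)).trans h21) g25 g30 hj hk (by omega) hT hB hB' hw
      (fun a ha => (hm' a (Or.inl ha)).trans (hM a ha)) hm).mono le_rfl ?_
    rintro s₁ ⟨hf₁, e24, e25, e30, hm₁, hm₁'⟩
    refine ⟨hf.trans hf₁, ⟨by rw [e24, g24]; push_cast; ring, e25, e30⟩, hm₁, fun a ha => ?_⟩
    have : (m + 1) ^ l ≤ (m + 1) ^ (l + 1) := Nat.pow_le_pow_right (Nat.succ_pos _) (by omega)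
    rw [hm₁' a ha, hm' a (by omega)]
  · simp only [State.reg_setReg, State.mem_setReg, State.reg_setMem, State.mem_setMem,
      Nat.reduceEqDiff, reduceIte, same_setReg, same_setMem, Nat.reduceLeDiff, h19]
    refine ⟨Same.refl _ _, ⟨by simp, (vecAddr_zero d).symm, by simp⟩, fun r hr => ?_,
      fun a ha => if_neg ?_⟩
    · obtain rfl : r = 0 := by simpa using hr
      simp [shiftCode_zero]
    · simp only [pow_zero, Nat.cast_one] at ha
      omega

end RAM

/-! ### Correctness of the accumulation. -/

namespace RAM

theorem accumulate_spec {B N : ℕ} {F T c δ g : ℤ} {M : ℤ → ℤ} {t : ℕ → ℤ} {s : State}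
    (h1 : s.reg 1 = 1) (h6 : s.reg 6 = F) (h27 : s.reg 27 = δ) (h28 : s.reg 28 = c)
    (h30 : s.reg 30 = g) (h31 : s.reg 31 = T) (h32 : s.reg 32 = N) (_hT : 0 ≤ T)
    (hg : T + N ≤ g) (hB : g + N ≤ B) (hM : ∀ a < T, s.mem a = M a)
    (ht : ∀ r < N, s.mem (T + r) = t r) (hr : ∀ r < N, 0 ≤ t r + F ∧ t r + F < T)
    (hr' : ∀ r < N, 0 ≤ t r + c ∧ t r + c < T) :
    Ends B (.loop 32 accumulateBody) s (N * 14 + 1) fun s' =>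
      Same 30 s s' ∧ s'.reg 30 = g + N ∧
      (∀ r < N, s'.mem (g + r) = s.mem (g + r) + (M (t r + c) - M (t r + F) - δ)) ∧
      ∀ a, a < g ∨ g + N ≤ a → s'.mem a = s.mem a := by
  refine (Ends.loop_const (I := fun i s' => Same 30 s s' ∧
    (s'.reg 32 = N - i ∧ s'.reg 31 = T + i ∧ s'.reg 30 = g + i) ∧
    (∀ r < i, s'.mem (g + r) = s.mem (g + r) + (M (t r + c) - M (t r + F) - δ)) ∧
    ∀ a, a < g ∨ g + i ≤ a → s'.mem a = s.mem a) 13 N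
    (fun i _ s h => h.2.1.1) ?_ ?_).mono le_rfl fun s' h => ⟨h.1, h.2.1.2.2, h.2.2⟩
  · rintro i hi s' ⟨hf, ⟨g32, g31, g30⟩, hm, hm'⟩
    have g1 := (hf 1 (by norm_num)).trans h1
    have g6 := (hf 6 (by norm_num)).trans h6
    have g27 := (hf 27 (by norm_num)).trans h27
    have g28 := (hf 28 (by norm_num)).trans h28
    have b1 := hr i hi
    have b2 := hr' i hi
    have k1 : s'.mem (T + i) = t i := (hm' _ (by omega)).trans (ht i hi)
    have k2 : s'.mem (t i + F) = M (t i + F) := (hm' _ (by omega)).trans (hM _ (by omega))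
    have k3 : s'.mem (t i + c) = M (t i + c) := (hm' _ (by omega)).trans (hM _ (by omega))
    have k4 : s'.mem (g + i) = s.mem (g + i) := hm' _ (by omega)
    unfold accumulateBody
    repeat
      first
      | refine Ends.add_seq ?_
      | refine Ends.sub_seq ?_
      | refine Ends.const_seq ?_
      | refine Ends.ite_const_seq (by decide) ?_
      | refine Ends.load_seq (by
          simp only [State.reg_setReg, State.mem_setReg, State.reg_setMem, Nat.reduceEqDiff,
            reduceIte, g1, g6, g27, g28, g30, g31, g32, k1, k2, k3, k4]; omega) ?_
      | refine Ends.store_seq (by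
          simp only [State.reg_setReg, State.mem_setReg, State.reg_setMem, Nat.reduceEqDiff,
            reduceIte, g1, g6, g27, g28, g30, g31, g32, k1, k2, k3, k4]; omega) ?_
      try simp only [State.reg_setReg, State.mem_setReg, State.reg_setMem, Nat.reduceEqDiff,
        reduceIte, g1, g6, g27, g28, g30, g31, g32, k1, k2, k3, k4]
    refine Ends.sub ?_
    simp only [State.reg_setReg, State.mem_setReg, State.reg_setMem, State.mem_setMem,
      Nat.reduceEqDiff, reduceIte, g1, g30, g31, g32, same_setReg, same_setMem, Nat.reduceLeDiff]
    refine ⟨hf, by omega, fun r hr => ?_, fun a ha => ?_⟩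
    · rcases Nat.lt_succ_iff_lt_or_eq.1 hr with h | rfl
      · rw [if_neg (by omega), hm r h]
      · rw [if_pos rfl]
    · rw [if_neg (by omega), hm' a (by omega)]
  · exact ⟨Same.refl _ _, by simp [*], fun r hr => absurd hr (Nat.not_lt_zero r), fun a _ => rfl⟩

theorem state_spec {B N m : ℕ} {F T w δ g : ℤ} {M : ℤ → ℤ} {t : ℕ → ℤ} {s : State}
    (h1 : s.reg 1 = 1) (h6 : s.reg 6 = F) (h7 : s.reg 7 = T) (h9 : s.reg 9 = 0)
    (h18 : s.reg 18 = N) (h23 : s.reg 23 = δ) (h24 : s.reg 24 = w)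
    (h27 : s.reg 27 = 0) (h28 : s.reg 28 = F) (h29 : s.reg 29 = m) (h30 : s.reg 30 = g)
    (hT : 0 ≤ T) (hg : T + N ≤ g) (hB : g + (m * N : ℕ) ≤ B) (hM : ∀ a < T, s.mem a = M a)
    (ht : ∀ r < N, s.mem (T + r) = t r)
    (hr : ∀ x ≤ m, ∀ r < N, 0 ≤ t r + (F + x * w) ∧ t r + (F + x * w) < T) :
    Ends B (.loop 29 stateBody) s (m * (N * 14 + 7) + 1) fun s' =>
      Same 27 s s' ∧ s'.reg 30 = g + (m * N : ℕ) ∧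
      (∀ x < m, ∀ r < N, s'.mem (g + (x * N : ℕ) + r) = s.mem (g + (x * N : ℕ) + r) +
        (M (t r + (F + ((x + 1 : ℕ) : ℤ) * w)) - M (t r + F) - ((x + 1 : ℕ) : ℤ) * δ)) ∧
      ∀ a, a < g ∨ g + (m * N : ℕ) ≤ a → s'.mem a = s.mem a := by
  refine (Ends.loop_const (I := fun i s' => Same 27 s s' ∧
    (s'.reg 29 = m - i ∧ s'.reg 28 = F + i * w ∧ s'.reg 27 = i * δ ∧
      s'.reg 30 = g + (i * N : ℕ)) ∧
    (∀ x < i, ∀ r < N, s'.mem (g + (x * N : ℕ) + r) = s.mem (g + (x * N : ℕ) + r) +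
      (M (t r + (F + ((x + 1 : ℕ) : ℤ) * w)) - M (t r + F) - ((x + 1 : ℕ) : ℤ) * δ)) ∧
    ∀ a, a < g ∨ g + (i * N : ℕ) ≤ a → s'.mem a = s.mem a) (N * 14 + 6) m
    (fun i _ s h => h.2.1.1) ?_ ?_).mono le_rfl fun s' h => ⟨h.1, h.2.1.2.2.2, h.2.2⟩
  · rintro i hi s' ⟨hf, ⟨g29, g28, g27, g30⟩, hm, hm'⟩
    have g1 := (hf 1 (by norm_num)).trans h1
    have g6 := (hf 6 (by norm_num)).trans h6
    have g7 := (hf 7 (by norm_num)).trans h7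
    have g9 := (hf 9 (by norm_num)).trans h9
    have g18 := (hf 18 (by norm_num)).trans h18
    have g23 := (hf 23 (by norm_num)).trans h23
    have g24 := (hf 24 (by norm_num)).trans h24
    have hle : i * N + N ≤ m * N := by
      rw [← Nat.succ_mul]; exact Nat.mul_le_mul_right N (by omega)
    have hs : (i + 1) * N = i * N + N := Nat.succ_mul _ _
    have hc : F + (i : ℤ) * w + w = F + ((i + 1 : ℕ) : ℤ) * w := by push_cast; ring
    have hδ : (i : ℤ) * δ + δ = ((i + 1 : ℕ) : ℤ) * δ := by push_cast; ring
    unfold stateBody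
    repeat
      first
      | refine Ends.add_seq ?_
      | refine Ends.sub_seq ?_
      | refine Ends.const_seq ?_
      | refine Ends.ite_const_seq (by decide) ?_
      try simp only [State.reg_setReg, State.mem_setReg, State.reg_setMem, Nat.reduceEqDiff,
        reduceIte, g1, g7, g9, g18, g23, g24, g27, g28, g29, g30, add_zero, hc, hδ]
    refine Ends.seq_le (U := 1) (accumulate_spec (N := N) (T := T) (F := F) (M := M) (t := t)
      (c := F + ((i + 1 : ℕ) : ℤ) * w) (δ := ((i + 1 : ℕ) : ℤ) * δ) (g := g + (i * N : ℕ))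
      ?_ ?_ ?_ ?_ ?_ ?_ ?_ hT (by omega) (by omega) ?_ ?_ ?_ (hr (i + 1) hi)) ?_ (by omega)
    iterate 7
      simp only [State.reg_setReg, Nat.reduceEqDiff, reduceIte, g1, g6, g7, g18, g30]
    · exact fun a ha => (hm' a (by omega)).trans (hM a ha)
    · exact fun r hr => (hm' _ (by omega)).trans (ht r hr)
    -- The subtracted row is the one with leading digit 0.
    · exact fun r hrN => by simpa using hr 0 (Nat.zero_le _) r hrN
    rintro s₁ ⟨hf₁, e30, hm₁, hm₁'⟩
    simp only [State.mem_setReg] at hm₁ hm₁'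
    have hf₂ : Same 27 s s₁ := hf.trans ((show Same 27 s' _ by
      simp only [same_setReg, Nat.reduceLeDiff]; exact Same.refl _ _).trans (hf₁.le (by norm_num)))
    have e1 := (hf₂ 1 (by norm_num)).trans h1
    have e27 := hf₁ 27 (by norm_num)
    have e28 := hf₁ 28 (by norm_num)
    have e29 := hf₁ 29 (by norm_num)
    simp only [State.reg_setReg, Nat.reduceEqDiff, reduceIte, g29] at e27 e28 e29
    refine Ends.sub ?_
    simp only [State.reg_setReg, State.mem_setReg, Nat.reduceEqDiff, reduceIte, e1, e27, e28, e29,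
      e30, same_setReg, Nat.reduceLeDiff]
    refine ⟨hf₂, ⟨by omega, trivial, trivial, by omega⟩, fun x hx r hr => ?_, fun a ha => ?_⟩
    · rcases Nat.lt_succ_iff_lt_or_eq.1 hx with h | rfl
      · have : x * N + N ≤ i * N := by
          rw [← Nat.succ_mul]; exact Nat.mul_le_mul_right N (by omega)
        rw [hm₁' _ (by omega), hm x h r hr]
      · rw [hm₁ r hr, hm' _ (by omega)]
    · rw [hm₁' a (by omega), hm' a (by omega)]
  · exact ⟨Same.refl _ _, by simp [*], fun r hr => absurd hr (Nat.not_lt_zero r), fun a _ => rfl⟩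

/-- The change of the total that is due to the state `x + 1` of the leading neighbor `j`, in its
translate to the neighbor `k`. -/
noncomputable def change (M : ℤ → ℤ) (d v m : ℕ) (F : ℤ) (j k x r : ℕ) : ℤ :=
  M (shiftCode M d v m j k r + (F + ((x + 1 : ℕ) : ℤ) * weight v m k)) -
    M (shiftCode M d v m j k r + F) - ((x + 1 : ℕ) : ℤ) * if k = 0 then 1 else 0

/-- All codes point into the table. -/
def InRange (M : ℤ → ℤ) (d v m : ℕ) (F T : ℤ) : Prop :=
  ∀ j < v, ∀ k < v, ∀ x ≤ m, ∀ r < (m + 1) ^ j,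
    0 ≤ shiftCode M d v m j k r + (F + x * weight v m k) ∧
      shiftCode M d v m j k r + (F + x * weight v m k) < T

/-- A bound for the time of the accumulation for one translate of the leading neighbor. -/
def translateTime (d v m j : ℕ) : ℕ := v * (v * (d * 18 + 15) + 13) + 34 * (m + 1) ^ (j + 1) + 16

/-- The codes are rebuilt from `T` for each `k` over the previous ones. The frame condition excludes
only these codes and the current accumulators, which protects the blocks of earlier leading
neighbors. -/
theorem translate_spec {B d v m j k : ℕ} {F T g : ℤ} {M : ℤ → ℤ} {s : State}
    (hg : Globals d v m F T s) (h15 : s.reg 15 = g) (h17 : s.reg 17 = vecAddr d j)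
    (h18 : s.reg 18 = ((m + 1) ^ j : ℕ)) (h19 : s.reg 19 = j) (h21 : s.reg 21 = vecAddr d k)
    (h22 : s.reg 22 = -1 - k) (h23 : s.reg 23 = if k = 0 then 1 else 0)
    (hj : j < v) (hk : k < v) (hT : vecAddr d v ≤ T)
    (hB : T + ((m + 1) ^ v : ℕ) ≤ B) (hB' : v ≤ B)
    (hgT : T + ((m + 1) ^ j : ℕ) ≤ g) (hgB : g + (m * (m + 1) ^ j : ℕ) ≤ B)
    (hw : ∀ i < v, M (-1 - (i : ℤ)) = weight v m i) (hR : InRange M d v m F T)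
    (hM : ∀ a < T, s.mem a = M a) :
    Ends B translateBody s (translateTime d v m j) fun s' =>
      Same 20 s s' ∧ (s'.reg 20 = s.reg 20 - 1 ∧ s'.reg 21 = vecAddr d (k + 1) ∧
      s'.reg 22 = -1 - (k + 1 : ℕ) ∧ s'.reg 23 = 0 ∧ s'.reg 30 = g + (m * (m + 1) ^ j : ℕ)) ∧
      (∀ x < m, ∀ r < (m + 1) ^ j, s'.mem (g + (x * (m + 1) ^ j : ℕ) + r) =
        s.mem (g + (x * (m + 1) ^ j : ℕ) + r) + change M d v m F j k x r) ∧
      ∀ a, a < T ∨ (T + ((m + 1) ^ j : ℕ) ≤ a ∧ a < g) ∨ g + (m * (m + 1) ^ j : ℕ) ≤ a →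
        s'.mem a = s.mem a := by
  have hT0 : 0 ≤ T := (vecAddr_nonneg d v).trans hT
  have htime : v * (v * (d * 18 + 15) + 13) + 13 * (m + 1) ^ j + 5 +
      (m * ((m + 1) ^ j * 14 + 7) + 10) ≤ translateTime d v m j := by
    have h1 : m * 1 ≤ m * (m + 1) ^ j := Nat.mul_le_mul_left m (Nat.one_le_pow _ _ (by omega))
    have h2 : m * ((m + 1) ^ j * 14 + 7) = 14 * (m * (m + 1) ^ j) + 7 * m := by ring
    have h3 : (m + 1) ^ (j + 1) = m * (m + 1) ^ j + (m + 1) ^ j := by rw [pow_succ]; ring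
    unfold translateTime
    omega
  unfold translateBody
  refine Ends.seq_le (U := m * ((m + 1) ^ j * 14 + 7) + 10)
    (build_spec hg h17 h19 h21 hj hk hT hB hB' hw hM) ?_ htime
  rintro s₁ ⟨hf₁, hm₁, hm₁'⟩
  have g₁ := hg.of_same (hf₁.le (by norm_num))
  have f15 := (hf₁ 15 (by norm_num)).trans h15
  have f18 := (hf₁ 18 (by norm_num)).trans h18
  have f22 := (hf₁ 22 (by norm_num)).trans h22
  have f23 := (hf₁ 23 (by norm_num)).trans h23
  have kw : s₁.mem (-1 - k) = weight v m k := by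
    rw [hm₁' _ (by omega), hM _ (by omega), hw k hk]
  repeat
    first
    | refine Ends.add_seq ?_
    | refine Ends.sub_seq ?_
    | refine Ends.const_seq ?_
    | refine Ends.ite_const_seq (by decide) ?_
    | refine Ends.load_seq (by
        simp only [State.reg_setReg, State.mem_setReg, State.reg_setMem, Nat.reduceEqDiff,
          reduceIte, g₁.zero, g₁.states, g₁.values, f15, f22, kw, add_zero]; omega) ?_
    try simp only [State.reg_setReg, State.mem_setReg, State.reg_setMem, Nat.reduceEqDiff,
      reduceIte, g₁.zero, g₁.states, g₁.values, f15, f22, kw, add_zero]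
  refine Ends.seq_le (U := 4) (state_spec (B := B) (N := (m + 1) ^ j) (m := m) (T := T) (F := F)
    (M := M) (t := fun r => shiftCode M d v m j k r) (g := g) (w := weight v m k)
    (δ := if k = 0 then 1 else 0) ?_ ?_ ?_ ?_ ?_ ?_ ?_ ?_ ?_ ?_ ?_ hT0 hgT hgB ?_ ?_
    (hR j hj k hk)) ?_ (by omega)
  iterate 11
    simp only [State.reg_setReg, Nat.reduceEqDiff, reduceIte, g₁.one, g₁.zero, g₁.codes,
      g₁.values, f18, f23]
  · exact fun a ha => (hm₁' a (Or.inl ha)).trans (hM a ha)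
  · exact hm₁
  rintro s₂ ⟨hf₂, e30, hm₂, hm₂'⟩
  simp only [State.mem_setReg] at hm₂ hm₂'
  have hf₃ : Same 24 s s₂ := hf₁.trans ((show Same 24 s₁ _ by
    simp only [same_setReg, Nat.reduceLeDiff]; exact Same.refl _ _).trans (hf₂.le (by norm_num)))
  have g₂ := hg.of_same (hf₃.le (by norm_num))
  have e20 := hf₃ 20 (by norm_num)
  have e21 := (hf₃ 21 (by norm_num)).trans h21
  have e22 := (hf₃ 22 (by norm_num)).trans h22
  repeat
    first
    | refine Ends.add_seq ?_
    | refine Ends.sub_seq ?_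
    | refine Ends.const_seq ?_
    | refine Ends.ite_const_seq (by decide) ?_
    try simp only [State.reg_setReg, State.mem_setReg, State.reg_setMem, Nat.reduceEqDiff,
      reduceIte, g₂.dim, g₂.one, g₂.zero, e21, e22, add_zero]
  refine Ends.sub ?_
  simp only [State.reg_setReg, State.mem_setReg, Nat.reduceEqDiff, reduceIte, g₂.one, e20, e30,
    same_setReg, Nat.reduceLeDiff]
  refine ⟨hf₃.le (by norm_num), ⟨trivial, (vecAddr_succ d k).symm, by push_cast; ring, trivial,
    trivial⟩, fun x hx r hr => ?_, fun a ha => ?_⟩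
  · rw [hm₂ x hx r hr, hm₁' _ (by omega), change]
  · rw [hm₂' a (by omega), hm₁' a (by omega)]

/-- The sum of the changes over all translates of the leading neighbor. -/
noncomputable def totalChange (M : ℤ → ℤ) (d v m : ℕ) (F : ℤ) (j x r : ℕ) : ℤ :=
  ∑ k ∈ Finset.range v, change M d v m F j k x r

theorem lead_spec {B d v m j : ℕ} {F T g : ℤ} {M : ℤ → ℤ} {s : State}
    (hg : Globals d v m F T s) (h15 : s.reg 15 = g) (h17 : s.reg 17 = vecAddr d j)
    (h18 : s.reg 18 = ((m + 1) ^ j : ℕ)) (h19 : s.reg 19 = j)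
    (hj : j < v) (hT : vecAddr d v ≤ T)
    (hB : T + ((m + 1) ^ v : ℕ) ≤ B) (hB' : v ≤ B)
    (hgT : T + ((m + 1) ^ j : ℕ) ≤ g) (hgB : g + (m * (m + 1) ^ j : ℕ) ≤ B)
    (hw : ∀ i < v, M (-1 - (i : ℤ)) = weight v m i) (hR : InRange M d v m F T)
    (hM : ∀ a < T, s.mem a = M a)
    (hz : ∀ x < m, ∀ r < (m + 1) ^ j, s.mem (g + (x * (m + 1) ^ j : ℕ) + r) = 0) :
    Ends B leadBody s (v * (translateTime d v m j + 1) + 11) fun s' =>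
      Same 15 s s' ∧ (s'.reg 15 = g + (m * (m + 1) ^ j : ℕ) ∧ s'.reg 16 = s.reg 16 - 1 ∧
      s'.reg 17 = vecAddr d (j + 1) ∧ s'.reg 18 = ((m + 1) ^ (j + 1) : ℕ) ∧
      s'.reg 19 = (j + 1 : ℕ)) ∧
      (∀ x < m, ∀ r < (m + 1) ^ j, s'.mem (g + (x * (m + 1) ^ j : ℕ) + r) =
        totalChange M d v m F j x r) ∧
      ∀ a, a < T ∨ (T + ((m + 1) ^ j : ℕ) ≤ a ∧ a < g) ∨ g + (m * (m + 1) ^ j : ℕ) ≤ a →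
        s'.mem a = s.mem a := by
  have hv : v ≠ 0 := by omega
  unfold leadBody
  repeat
    first
    | refine Ends.add_seq ?_
    | refine Ends.sub_seq ?_
    | refine Ends.const_seq ?_
    | refine Ends.ite_const_seq (by decide) ?_
    try simp only [State.reg_setReg, State.mem_setReg, State.reg_setMem, Nat.reduceEqDiff,
      reduceIte, hg.one, hg.zero, hg.three, hg.arity, add_zero, zero_sub]
  refine Ends.seq_le (U := 6) (Ends.loop_const (I := fun k s' => Same 20 s s' ∧
    (s'.reg 20 = v - k ∧ s'.reg 21 = vecAddr d k ∧ s'.reg 22 = -1 - k ∧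
      (s'.reg 23 = if k = 0 then 1 else 0) ∧
      -- Register 30 holds the end of the block only after a first round; the conclusion uses it at
      -- `k = v ≠ 0`.
      (k ≠ 0 → s'.reg 30 = g + (m * (m + 1) ^ j : ℕ))) ∧
    (∀ x < m, ∀ r < (m + 1) ^ j, s'.mem (g + (x * (m + 1) ^ j : ℕ) + r) =
      ∑ k' ∈ Finset.range k, change M d v m F j k' x r) ∧
    ∀ a, a < T ∨ (T + ((m + 1) ^ j : ℕ) ≤ a ∧ a < g) ∨ g + (m * (m + 1) ^ j : ℕ) ≤ a →
      s'.mem a = s.mem a) (translateTime d v m j) v (fun i _ s h => h.2.1.1) ?_ ?_) ?_ (by omega)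
  · rintro k hk s' ⟨hf, ⟨g20, g21, g22, g23, -⟩, hm, hm'⟩
    refine (translate_spec (hg.of_same (hf.le (by norm_num))) ((hf 15 (by norm_num)).trans h15)
      ((hf 17 (by norm_num)).trans h17) ((hf 18 (by norm_num)).trans h18)
      ((hf 19 (by norm_num)).trans h19) g21 g22 g23 hj hk hT hB hB' hgT hgB hw hR
      fun a ha => (hm' a (Or.inl ha)).trans (hM a ha)).mono le_rfl ?_
    rintro s₁ ⟨hf₁, ⟨e20, e21, e22, e23, e30⟩, hm₁, hm₁'⟩
    refine ⟨hf.trans hf₁, ⟨by rw [e20, g20]; push_cast; ring, e21, e22, by rw [e23]; simp,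
      fun _ => e30⟩, fun x hx r hr => ?_, fun a ha => ?_⟩
    · rw [hm₁ x hx r hr, hm x hx r hr, Finset.sum_range_succ]
    · rw [hm₁' a ha, hm' a ha]
  · simp only [State.reg_setReg, State.mem_setReg, Nat.reduceEqDiff, reduceIte,
      same_setReg, Nat.reduceLeDiff]
    refine ⟨Same.refl _ _, ⟨by simp, by simp [vecAddr_zero], by simp, trivial,
      fun h => absurd rfl h⟩, fun x hx r hr => by simpa using hz x hx r hr, fun a _ => trivial⟩
  rintro s₁ ⟨hf₁, ⟨-, -, -, -, e30⟩, hm₁, hm₁'⟩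
  have g₁ := hg.of_same (hf₁.le (by norm_num))
  have e15 := (hf₁ 15 (by norm_num)).trans h15
  have e16 := hf₁ 16 (by norm_num)
  have e17 := (hf₁ 17 (by norm_num)).trans h17
  have e18 := (hf₁ 18 (by norm_num)).trans h18
  have e19 := (hf₁ 19 (by norm_num)).trans h19
  have e30 := e30 hv
  repeat
    first
    | refine Ends.add_seq ?_
    | refine Ends.sub_seq ?_
    | refine Ends.const_seq ?_
    | refine Ends.ite_const_seq (by decide) ?_
    try simp only [State.reg_setReg, State.mem_setReg, State.reg_setMem, Nat.reduceEqDiff,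
      reduceIte, g₁.dim, g₁.one, g₁.zero, e15, e16, e17, e18, e19, e30, add_zero,
      add_sub_cancel_left]
  refine Ends.sub ?_
  simp only [State.reg_setReg, State.mem_setReg, Nat.reduceEqDiff, reduceIte, g₁.one, e16, e18,
    same_setReg, Nat.reduceLeDiff]
  refine ⟨hf₁.le (by norm_num), ⟨trivial, trivial, (vecAddr_succ d j).symm, ?_, by push_cast; rfl⟩,
    hm₁, hm₁'⟩
  rw [← Nat.cast_add, pow_succ]
  congr 1
  ring

theorem zero_spec {B N : ℕ} {g : ℤ} {s : State} (h1 : s.reg 1 = 1) (h9 : s.reg 9 = 0)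
    (h16 : s.reg 16 = g) (h17 : s.reg 17 = N) (hg : 0 ≤ g) (hB : g + N ≤ B) :
    Ends B (.loop 17 zeroBody) s (N * 9 + 1) fun s' =>
      (s'.reg 0 = 1 ↔ s.reg 0 = 1 ∧ ∀ i < N, s.mem (g + i) = 0) := by
  refine (Ends.loop_const (I := fun i s' => s'.reg 1 = 1 ∧ s'.reg 9 = 0 ∧ s'.reg 17 = N - i ∧
    s'.reg 16 = g + i ∧ s'.mem = s.mem ∧
    (s'.reg 0 = 1 ↔ s.reg 0 = 1 ∧ ∀ i' < i, s.mem (g + i') = 0)) 8 N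
    (fun i _ s h => h.2.2.1) ?_ ?_).mono le_rfl fun s' h => h.2.2.2.2.2
  · rintro i hi s' ⟨g1, g9, g17, g16, hm, hi0⟩
    obtain ⟨w, k⟩ : ∃ w, s.mem (g + i) = w := ⟨_, rfl⟩
    have k' : s'.mem (g + i) = w := by rw [hm, k]
    unfold zeroBody
    repeat
      first
      | refine Ends.add_seq ?_
      | refine Ends.sub_seq ?_
      | refine Ends.const_seq ?_
      | refine Ends.ite_const_seq (by decide) ?_
      | refine Ends.load_seq (by
          simp only [State.reg_setReg, State.mem_setReg, State.reg_setMem, Nat.reduceEqDiff,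
            reduceIte, g1, g9, g16, g17, k']; omega) ?_
      try simp only [State.reg_setReg, State.mem_setReg, State.reg_setMem, Nat.reduceEqDiff,
        reduceIte, g1, g9, g16, g17, k']
    refine Ends.sub ?_
    simp only [State.reg_setReg, State.mem_setReg, Nat.reduceEqDiff, reduceIte, g1, g9, g16, g17,
      Nat.forall_lt_succ_right, k]
    refine ⟨trivial, trivial, by push_cast; ring, by push_cast; ring, hm, ?_⟩
    rw [← and_assoc, ← hi0]
    split_ifs <;> omega
  · exact ⟨h1, h9, by simp [h17], by simp [h16], rfl, by simp⟩

end RAM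

/-! ### Initialization and assembly of the main case. -/

namespace RAM

local infixr:60 " ⨟ " => Prog.seq

theorem weight_nonneg (v m l : ℕ) : 0 ≤ weight v m l := by
  simp only [weight]; positivity

theorem weight_zero (v m : ℕ) : weight v m 0 = v + 1 := by simp [weight]

theorem weight_succ (v m l : ℕ) : weight v m (l + 1) = weight v m l + m * weight v m l := by
  simp only [weight]; ring

theorem pow_le_weight (v m l : ℕ) : (((m + 1) ^ l : ℕ) : ℤ) ≤ weight v m l := by
  simp only [weight]
  push_cast
  have : (0 : ℤ) ≤ v * (m + 1) ^ l := by positivity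
  linarith

theorem addr_loop_spec {B v d : ℕ} {a : ℤ} {s : State} (h1 : s.reg 1 = 1) (h2 : s.reg 2 = d)
    (h5 : s.reg 5 = a) (h10 : s.reg 10 = v) :
    Ends B (.loop 10 (.add 5 5 2 ⨟ .sub 10 10 1)) s (v * 3 + 1) fun s' =>
      (∀ x, x ≠ 5 → x ≠ 10 → s'.reg x = s.reg x) ∧ s'.reg 5 = a + v * d ∧ s'.mem = s.mem := by
  refine (Ends.loop_const (I := fun i s' => (∀ x, x ≠ 5 → x ≠ 10 → s'.reg x = s.reg x) ∧
    s'.reg 10 = v - i ∧ s'.reg 5 = a + i * d ∧ s'.mem = s.mem) 2 v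
    (fun i _ s h => h.2.1) ?_ ?_).mono le_rfl fun s' h => ⟨h.1, h.2.2⟩
  · rintro i hi s' ⟨hf, g10, g5, hm⟩
    have g1 := (hf 1 (by norm_num) (by norm_num)).trans h1
    have g2 := (hf 2 (by norm_num) (by norm_num)).trans h2
    repeat
      first
      | refine Ends.add_seq ?_
      | refine Ends.sub_seq ?_
      | refine Ends.const_seq ?_
      | refine Ends.ite_const_seq (by decide) ?_
      try simp only [State.reg_setReg, State.mem_setReg, State.reg_setMem, Nat.reduceEqDiff,
        reduceIte, g1, g2, g5, g10]
    refine Ends.sub ?_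
    simp only [State.reg_setReg, State.mem_setReg, Nat.reduceEqDiff, reduceIte, g1, g2, g5, g10]
    refine ⟨fun x h5 h10 => by rw [if_neg h10, if_neg h5, hf x h5 h10], by push_cast; ring,
      by push_cast; ring, hm⟩
  · exact ⟨fun _ _ _ => rfl, by simp [h10], by simp [h5], rfl⟩

theorem mul_loop_spec {B m : ℕ} {a b : ℤ} {s : State} (h1 : s.reg 1 = 1) (h11 : s.reg 11 = a)
    (h13 : s.reg 13 = b) (h14 : s.reg 14 = m) :
    Ends B (.loop 14 (.add 11 11 13 ⨟ .sub 14 14 1)) s (m * 3 + 1) fun s' =>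
      (∀ x, x ≠ 11 → x ≠ 14 → s'.reg x = s.reg x) ∧ s'.reg 11 = a + m * b ∧ s'.mem = s.mem := by
  refine (Ends.loop_const (I := fun i s' => (∀ x, x ≠ 11 → x ≠ 14 → s'.reg x = s.reg x) ∧
    s'.reg 14 = m - i ∧ s'.reg 11 = a + i * b ∧ s'.mem = s.mem) 2 m
    (fun i _ s h => h.2.1) ?_ ?_).mono le_rfl fun s' h => ⟨h.1, h.2.2⟩
  · rintro i hi s' ⟨hf, g14, g11, hm⟩
    have g1 := (hf 1 (by norm_num) (by norm_num)).trans h1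
    have g13 := (hf 13 (by norm_num) (by norm_num)).trans h13
    repeat
      first
      | refine Ends.add_seq ?_
      | refine Ends.sub_seq ?_
      | refine Ends.const_seq ?_
      | refine Ends.ite_const_seq (by decide) ?_
      try simp only [State.reg_setReg, State.mem_setReg, State.reg_setMem, Nat.reduceEqDiff,
        reduceIte, g1, g11, g13, g14]
    refine Ends.sub ?_
    simp only [State.reg_setReg, State.mem_setReg, Nat.reduceEqDiff, reduceIte, g1, g11, g13, g14]
    refine ⟨fun x h5 h10 => by rw [if_neg h10, if_neg h5, hf x h5 h10], by push_cast; ring,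
      by push_cast; ring, hm⟩
  · exact ⟨fun _ _ _ => rfl, by simp [h14], by simp [h11], rfl⟩

/-- The memory after the weights have been stored. -/
def withWeights (M : ℤ → ℤ) (v m n : ℕ) (a : ℤ) : ℤ :=
  if -(n : ℤ) ≤ a ∧ a < 0 then weight v m (-1 - a).toNat else M a

theorem withWeights_neg {M : ℤ → ℤ} {v m n i : ℕ} (hi : i < n) :
    withWeights M v m n (-1 - i) = weight v m i := by
  rw [withWeights, if_pos (by omega)]
  congr 1
  omega

theorem withWeights_of_nonneg {M : ℤ → ℤ} {v m n : ℕ} {a : ℤ} (ha : 0 ≤ a) :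
    withWeights M v m n a = M a := by
  rw [withWeights, if_neg (by omega)]

theorem weight_spec {B v m : ℕ} {s : State} (h1 : s.reg 1 = 1) (h4 : s.reg 4 = m)
    (h9 : s.reg 9 = 0) (h10 : s.reg 10 = v) (h11 : s.reg 11 = v + 1) (h12 : s.reg 12 = -1)
    (hB : v ≤ B) :
    Ends B (.loop 10 weightBody) s (v * (m * 3 + 7) + 1) fun s' =>
      Same 10 s s' ∧ s'.reg 11 = weight v m v ∧ ∀ a, s'.mem a = withWeights s.mem v m v a := by
  refine (Ends.loop_const (I := fun i s' => Same 10 s s' ∧ (s'.reg 10 = v - i ∧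
    s'.reg 12 = -1 - i) ∧ s'.reg 11 = weight v m i ∧
    ∀ a, s'.mem a = withWeights s.mem v m i a) (m * 3 + 6) v
    (fun i _ s h => h.2.1.1) ?_ ?_).mono le_rfl fun s' h => ⟨h.1, h.2.2⟩
  · rintro i hi s' ⟨hf, ⟨g10, g12⟩, g11, hm⟩
    have g1 := (hf 1 (by norm_num)).trans h1
    have g4 := (hf 4 (by norm_num)).trans h4
    have g9 := (hf 9 (by norm_num)).trans h9
    unfold weightBody
    repeat
      first
      | refine Ends.add_seq ?_
      | refine Ends.sub_seq ?_
      | refine Ends.const_seq ?_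
      | refine Ends.ite_const_seq (by decide) ?_
      | refine Ends.store_seq (by
          simp only [State.reg_setReg, State.mem_setReg, State.reg_setMem, Nat.reduceEqDiff,
            reduceIte, g1, g4, g9, g10, g11, g12, add_zero]; omega) ?_
      try simp only [State.reg_setReg, State.mem_setReg, State.reg_setMem, Nat.reduceEqDiff,
        reduceIte, g1, g4, g9, g10, g11, g12, add_zero]
    refine Ends.seq_le (U := 1) (mul_loop_spec (m := m) (a := weight v m i) (b := weight v m i)
      ?_ ?_ ?_ ?_) ?_ (by omega)
    iterate 4
      simp only [State.reg_setReg, State.reg_setMem, Nat.reduceEqDiff, reduceIte, g1, g11]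
    rintro s₁ ⟨hf₁, e11, hm₁⟩
    have e1 := hf₁ 1 (by norm_num) (by norm_num)
    have e10 := hf₁ 10 (by norm_num) (by norm_num)
    have e12 := hf₁ 12 (by norm_num) (by norm_num)
    simp only [State.reg_setReg, State.reg_setMem, Nat.reduceEqDiff, reduceIte, g1, g10]
      at e1 e10 e12
    refine Ends.sub ?_
    simp only [State.reg_setReg, State.mem_setReg, Nat.reduceEqDiff, reduceIte, e1, e10, e11, e12,
      same_setReg, Nat.reduceLeDiff, hm₁, State.mem_setMem]
    refine ⟨fun x hx => ?_, ⟨by push_cast; ring, by push_cast; ring⟩, (weight_succ v m i).symm,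
      fun a => ?_⟩
    · rw [hf₁ x (by omega) (by omega), ← hf x hx]
      simp only [State.reg_setReg, State.reg_setMem]
      rw [if_neg (by omega), if_neg (by omega), if_neg (by omega)]
    · rw [hm]
      by_cases ha : a = -1 - i
      · rw [if_pos ha, ha, withWeights_neg (Nat.lt_succ_self i)]
      · rw [if_neg ha]
        exact if_congr (by omega) rfl rfl
  · exact ⟨Same.refl _ _, by simp [*], by rw [h11, weight_zero],
      fun a => by rw [withWeights, if_neg (by omega)]⟩

/-- What the program tests. -/
def Passes (M : ℤ → ℤ) (d v m : ℕ) (F : ℤ) : Prop :=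
  ¬ 0 < M F ∧ ∀ j < v, ∀ x < m, ∀ r < (m + 1) ^ j, totalChange M d v m F j x r = 0

/-- Every positive number below `q ^ v` is an `x`-th successor block of a power. -/
theorem exists_block {m v i : ℕ} (hm : 0 < m) (hi : 0 < i) (hv : i < (m + 1) ^ v) :
    ∃ j < v, ∃ x < m, ∃ r < (m + 1) ^ j, i = (m + 1) ^ j + x * (m + 1) ^ j + r := by
  have hq : 1 < m + 1 := by omega
  set j := Nat.log (m + 1) i with hj
  have hP : 0 < (m + 1) ^ j := by positivity
  have h1 : (m + 1) ^ j ≤ i := Nat.pow_log_le_self _ hi.ne'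
  have h2 : i < (m + 1) ^ j * (m + 1) := Nat.lt_pow_succ_log_self hq i
  have h3 : i / (m + 1) ^ j < m + 1 := Nat.div_lt_of_lt_mul h2
  have h4 : 0 < i / (m + 1) ^ j := Nat.div_pos h1 hP
  refine ⟨j, Nat.log_lt_of_lt_pow hi.ne' hv, i / (m + 1) ^ j - 1, by omega, i % (m + 1) ^ j,
    Nat.mod_lt _ hP, ?_⟩
  conv_lhs => rw [← Nat.div_add_mod' i ((m + 1) ^ j)]
  obtain ⟨y, hy⟩ := Nat.exists_eq_succ_of_ne_zero h4.ne'
  rw [hy, Nat.succ_sub_one, Nat.succ_mul]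
  ring

/-- The accumulator of the row `(x + 1) * (m + 1) ^ j + r` lies at that distance from `T + weight v
m v`, so the blocks of successive `j` are adjacent. The codes fit into the gap in front, since `(m +
1) ^ v ≤ weight v m v`. -/
theorem leads_spec {B d v m : ℕ} {F T : ℤ} {M : ℤ → ℤ} {s : State}
    (hg : Globals d v m F T s) (h15 : s.reg 15 = T + weight v m v + 1) (h16 : s.reg 16 = v)
    (h17 : s.reg 17 = 3) (h18 : s.reg 18 = 1) (h19 : s.reg 19 = 0)
    (hT : vecAddr d v ≤ T) (hB : T + weight v m v + ((m + 1) ^ v : ℕ) ≤ B) (hB' : v ≤ B)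
    (hw : ∀ i < v, M (-1 - (i : ℤ)) = weight v m i) (hR : InRange M d v m F T)
    (hM : ∀ a < T, s.mem a = M a) (hz : ∀ a, T ≤ a → s.mem a = 0) :
    Ends B (.loop 16 leadBody) s
      (∑ j ∈ Finset.range v, (v * (translateTime d v m j + 1) + 12) + 1) fun s' =>
      Same 15 s s' ∧ s'.reg 15 = T + weight v m v + ((m + 1) ^ v : ℕ) ∧
      s'.mem (T + weight v m v) = 0 ∧
      ∀ j < v, ∀ x < m, ∀ r < (m + 1) ^ j,
        s'.mem (T + weight v m v + ((m + 1) ^ j : ℕ) + (x * (m + 1) ^ j : ℕ) + r) =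
          totalChange M d v m F j x r := by
  have hD := pow_le_weight v m v
  set D := weight v m v with hDdef
  have hsucc : ∀ j, (m + 1) ^ (j + 1) = (m + 1) ^ j + m * (m + 1) ^ j := fun j => by
    rw [pow_succ]; ring
  have hmono : ∀ {i j : ℕ}, i ≤ j → (m + 1) ^ i ≤ (m + 1) ^ j := fun h =>
    Nat.pow_le_pow_right (Nat.succ_pos _) h
  have hblock : ∀ {x j : ℕ}, x < m → x * (m + 1) ^ j + (m + 1) ^ j ≤ m * (m + 1) ^ j :=
    fun {x j} hx => by rw [← Nat.succ_mul]; exact Nat.mul_le_mul_right _ hx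
  refine (Ends.loop (I := fun j s' => Same 15 s s' ∧ (s'.reg 15 = T + D + ((m + 1) ^ j : ℕ) ∧
    s'.reg 16 = v - j ∧ s'.reg 17 = vecAddr d j ∧ s'.reg 18 = ((m + 1) ^ j : ℕ) ∧
    s'.reg 19 = j) ∧ (∀ a < T, s'.mem a = M a) ∧ s'.mem (T + D) = 0 ∧
    (∀ j' < j, ∀ x < m, ∀ r < (m + 1) ^ j',
        s'.mem (T + D + ((m + 1) ^ j' : ℕ) + (x * (m + 1) ^ j' : ℕ) + r) =
          totalChange M d v m F j' x r) ∧
    ∀ a, T + D + ((m + 1) ^ j : ℕ) ≤ a → s'.mem a = 0)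
    (fun j => v * (translateTime d v m j + 1) + 11) v
    (fun i _ s h => h.2.1.2.1) ?_ ?_).mono le_rfl fun s' h =>
      ⟨h.1, h.2.1.1, h.2.2.2.1, h.2.2.2.2.1⟩
  · rintro j hj s' ⟨hf, ⟨g15, g16, g17, g18, g19⟩, hlow, h0, hm, hm'⟩
    have b1 := hmono hj.le
    have b2 := hmono (Nat.succ_le_of_lt hj)
    have b3 := hsucc j
    simp only [Nat.succ_eq_add_one] at b2
    have b4 : 0 < (m + 1) ^ j := by positivity
    refine (lead_spec (hg.of_same (hf.le (by norm_num))) g15 g17 g18 g19 hj hT (by omega) hB'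
      (by omega) (by omega) hw hR hlow fun x hx r hr => hm' _ (by omega)).mono le_rfl ?_
    rintro s₁ ⟨hf₁, ⟨e15, e16, e17, e18, e19⟩, hm₁, hm₁'⟩
    refine ⟨hf.trans hf₁, ⟨by rw [e15, b3]; push_cast; ring, by rw [e16, g16]; push_cast; ring,
      e17, e18, e19⟩, fun a ha => (hm₁' a (Or.inl ha)).trans (hlow a ha), ?_,
      fun j' hj' x hx r hr => ?_, fun a ha => ?_⟩
    · rw [hm₁' _ (by omega), h0]
    · rcases Nat.lt_succ_iff_lt_or_eq.1 hj' with h | rfl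
      · have b5 := hmono (Nat.succ_le_of_lt h)
        have b6 := hsucc j'
        have b7 := hblock (j := j') hx
        simp only [Nat.succ_eq_add_one] at b5
        rw [hm₁' _ (by omega), hm j' h x hx r hr]
      · exact hm₁ x hx r hr
    · rw [hm₁' a (by omega), hm' a (by omega)]
  · refine ⟨Same.refl _ _, ⟨by simp [h15], by simp [h16], by rw [h17, vecAddr_zero], by simp [h18],
      by simp [h19]⟩, hM, hz _ (by omega), fun j hj => absurd hj (Nat.not_lt_zero j),
      fun a ha => hz a (by omega)⟩

/-- A bound for the time of the program on automata with at least two states. -/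
def mainTime (d v m : ℕ) : ℕ :=
  v * 3 + v * (m * 3 + 7) + ∑ j ∈ Finset.range v, (v * (translateTime d v m j + 1) + 12) +
    (m + 1) ^ v * 9 + 40

theorem mainCase_spec {B d v m : ℕ} {s : State} (hm : 0 < m) (hv : 0 < v)
    (h0 : s.reg 0 = 1) (h1 : s.reg 1 = 1) (h2 : s.reg 2 = d) (h3 : s.reg 3 = v) (h4 : s.reg 4 = m)
    (h8 : s.reg 8 = 3) (h9 : s.reg 9 = 0)
    (hB : vecAddr d v + 2 * weight v m v + ((m + 1) ^ v : ℕ) ≤ B)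
    (hR : InRange (withWeights s.mem v m v) d v m (vecAddr d v + v) (vecAddr d v + weight v m v))
    (hz : ∀ a, vecAddr d v + weight v m v ≤ a → s.mem a = 0) :
    Ends B mainCase s (mainTime d v m) fun s' =>
      (s'.reg 0 = 1 ↔ Passes (withWeights s.mem v m v) d v m (vecAddr d v + v)) := by
  have hA := vecAddr_nonneg d v
  have hD := pow_le_weight v m v
  have hDv : (v : ℤ) + 1 ≤ weight v m v := by
    simp only [weight]
    exact le_mul_of_one_le_right (by positivity) (one_le_pow₀ (by linarith [Int.natCast_nonneg m]))
  have hAv : (3 : ℤ) + v * d = vecAddr d v := rfl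
  unfold mainCase
  repeat
    first
    | refine Ends.add_seq ?_
    | refine Ends.sub_seq ?_
    | refine Ends.const_seq ?_
    | refine Ends.ite_const_seq (by decide) ?_
    try simp only [State.reg_setReg, State.mem_setReg, State.reg_setMem, Nat.reduceEqDiff,
      reduceIte, h1, h2, h3, h4, h8, h9, add_zero]
  refine Ends.seq_le (U := mainTime d v m - v * 3 - 3) (addr_loop_spec (v := v) (d := d) (a := 3)
    ?_ ?_ ?_ ?_) ?_ (by unfold mainTime; omega)
  iterate 4
    simp only [State.reg_setReg, Nat.reduceEqDiff, reduceIte, h1, h2]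
  rintro s₁ ⟨hf₁, e5, hm₁⟩
  rw [hAv] at e5
  simp only [State.mem_setReg] at hm₁
  have f0 := hf₁ 0 (by norm_num) (by norm_num)
  have f1 := hf₁ 1 (by norm_num) (by norm_num)
  have f2 := hf₁ 2 (by norm_num) (by norm_num)
  have f3 := hf₁ 3 (by norm_num) (by norm_num)
  have f4 := hf₁ 4 (by norm_num) (by norm_num)
  have f8 := hf₁ 8 (by norm_num) (by norm_num)
  have f9 := hf₁ 9 (by norm_num) (by norm_num)
  simp only [State.reg_setReg, Nat.reduceEqDiff, reduceIte, h0, h1, h2, h3, h4, h8, h9]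
    at f0 f1 f2 f3 f4 f8 f9
  -- The remaining time is split into a rest and the number of the next unit-cost instructions.
  obtain ⟨W, hW⟩ : ∃ W, mainTime d v m - v * 3 - 3 = W + 4 :=
    ⟨mainTime d v m - v * 3 - 7, by unfold mainTime; omega⟩
  rw [hW]
  repeat
    first
    | refine Ends.add_seq ?_
    | refine Ends.sub_seq ?_
    | refine Ends.const_seq ?_
    | refine Ends.ite_const_seq (by decide) ?_
    try simp only [State.reg_setReg, State.mem_setReg, State.reg_setMem, Nat.reduceEqDiff,
      reduceIte, f0, f1, f2, f3, f4, f8, f9, e5, add_zero, zero_sub]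
  refine Ends.seq_le (U := W - v * (m * 3 + 7) - 1) (weight_spec (v := v) (m := m)
    ?_ ?_ ?_ ?_ ?_ ?_ (by omega)) ?_ (by unfold mainTime at hW; omega)
  iterate 6
    simp only [State.reg_setReg, Nat.reduceEqDiff, reduceIte, f1, f4, f9]
  rintro s₂ ⟨hf₂, e11, hm₂⟩
  simp only [State.mem_setReg, hm₁] at hm₂
  have k0 := hf₂ 0 (by norm_num)
  have k1 := hf₂ 1 (by norm_num)
  have k2 := hf₂ 2 (by norm_num)
  have k3 := hf₂ 3 (by norm_num)
  have k4 := hf₂ 4 (by norm_num)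
  have k5 := hf₂ 5 (by norm_num)
  have k6 := hf₂ 6 (by norm_num)
  have k8 := hf₂ 8 (by norm_num)
  have k9 := hf₂ 9 (by norm_num)
  simp only [State.reg_setReg, Nat.reduceEqDiff, reduceIte, f0, f1, f2, f3, f4, f8, f9, e5]
    at k0 k1 k2 k3 k4 k5 k6 k8 k9
  obtain ⟨W', hW'⟩ : ∃ W', W - v * (m * 3 + 7) - 1 = W' + 10 :=
    ⟨W - v * (m * 3 + 7) - 11, by unfold mainTime at hW; omega⟩
  rw [hW']
  have kF : s₂.mem (vecAddr d v + v) = withWeights s.mem v m v (vecAddr d v + v) := hm₂ _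
  repeat
    first
    | refine Ends.add_seq ?_
    | refine Ends.sub_seq ?_
    | refine Ends.const_seq ?_
    | refine Ends.ite_const_seq (by decide) ?_
    | refine Ends.load_seq (by
        simp only [State.reg_setReg, State.mem_setReg, State.reg_setMem, Nat.reduceEqDiff,
          reduceIte, k0, k1, k2, k3, k4, k5, k6, k8, k9, e11, kF, add_zero]; omega) ?_
    try simp only [State.reg_setReg, State.mem_setReg, State.reg_setMem, Nat.reduceEqDiff,
      reduceIte, k0, k1, k2, k3, k4, k5, k6, k8, k9, e11, kF, add_zero]
  refine Ends.seq_le (U := (m + 1) ^ v * 9 + 3) (leads_spec (B := B) (d := d) (v := v) (m := m)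
    (F := vecAddr d v + v) (T := vecAddr d v + weight v m v) (M := withWeights s.mem v m v)
    ⟨?_, ?_, ?_, ?_, ?_, ?_, ?_, ?_⟩ ?_ ?_ ?_ ?_ ?_ (by omega) (by omega) (by omega)
    (fun i hi => withWeights_neg hi) hR (fun a _ => hm₂ a) fun a ha => ?_) ?_
    (by unfold mainTime at hW; omega)
  iterate 13
    simp only [State.reg_setReg, Nat.reduceEqDiff, reduceIte, k1, k2, k3, k4, k6, k8, k9]
  · rw [State.mem_setReg, State.mem_setReg, State.mem_setReg, State.mem_setReg]
    simp only [State.mem_setReg]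
    rw [hm₂, withWeights_of_nonneg (by omega), hz a ha]
  rintro s₃ ⟨hf₃, e15, hc, hm₃⟩
  have l0 := hf₃ 0 (by norm_num)
  have l1 := hf₃ 1 (by norm_num)
  have l7 := hf₃ 7 (by norm_num)
  have l9 := hf₃ 9 (by norm_num)
  have l11 := hf₃ 11 (by norm_num)
  simp only [State.reg_setReg, Nat.reduceEqDiff, reduceIte, k0, k1, k9, e11]
    at l0 l1 l7 l9 l11
  repeat
    first
    | refine Ends.add_seq ?_
    | refine Ends.sub_seq ?_
    | refine Ends.const_seq ?_
    | refine Ends.ite_const_seq (by decide) ?_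
    try simp only [State.reg_setReg, State.mem_setReg, State.reg_setMem, Nat.reduceEqDiff,
      reduceIte, l1, l7, l9, l11, e15, add_sub_cancel_left]
  refine (zero_spec (N := (m + 1) ^ v) (g := vecAddr d v + weight v m v + weight v m v)
    ?_ ?_ ?_ ?_ (by omega) (by omega)).mono (by omega) ?_
  iterate 4
    simp only [State.reg_setReg, Nat.reduceEqDiff, reduceIte, l1, l9]
  rintro s₄ h₄
  rw [h₄]
  simp only [State.reg_setReg, State.mem_setReg, Nat.reduceEqDiff, reduceIte, l0]
  refine and_congr ?_ ⟨fun h j hj x hx r hr => ?_, fun h i hi => ?_⟩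
  · split_ifs with hp <;> simp [hp]
  · rw [← hm₃ j hj x hx r hr, add_assoc, add_assoc]
    have := h ((m + 1) ^ j + (x * (m + 1) ^ j + r)) ?_
    · push_cast at this ⊢
      exact this
    · have b1 : (x + 1) * (m + 1) ^ j ≤ m * (m + 1) ^ j := Nat.mul_le_mul_right _ hx
      have b2 : (m + 1) ^ (j + 1) ≤ (m + 1) ^ v := Nat.pow_le_pow_right (Nat.succ_pos _) hj
      have b3 : (m + 1) ^ (j + 1) = (m + 1) ^ j + m * (m + 1) ^ j := by rw [pow_succ]; ring
      rw [Nat.succ_mul] at b1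
      omega
  · rcases Nat.eq_zero_or_pos i with rfl | hpos
    -- The cell of row 0 is never written, so the final scan finds it zero; every other cell belongs
    -- to exactly one kind of block found by `exists_block`.
    · rw [Nat.cast_zero, add_zero, hc]
    · obtain ⟨j, hj, x, hx, r, hr, rfl⟩ := exists_block hm hpos hi
      have := hm₃ j hj x hx r hr
      rw [h j hj x hx r hr] at this
      push_cast at this ⊢
      rw [← this]
      congr 1
      ring

end RAM

/-! ### The input in memory and the meaning of the computed codes. -/

theorem List.getD_flatten_of_length_eq {α : Type*} {c : ℕ} (x : α) {L : List (List α)}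
    (h : ∀ l ∈ L, l.length = c) {i e : ℕ} (he : e < c) :
    L.flatten.getD (i * c + e) x = (L.getD i []).getD e x := by
  induction L generalizing i with
  | nil => simp
  | cons l L ih =>
    have hl : l.length = c := h l (by simp)
    rw [List.flatten_cons]
    cases i with
    | zero => rw [List.getD_append _ _ _ _ (by omega)]; simp
    | succ i =>
      rw [List.getD_append_right _ _ _ _ (by rw [hl, Nat.succ_mul]; omega), List.getD_cons_succ,
        ← ih (fun l hl => h l (by simp [hl]))]
      congr 1
      rw [hl, Nat.succ_mul]
      omega

theorem List.length_flatten_of_length_eq {α : Type*} {c : ℕ} {L : List (List α)}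
    (h : ∀ l ∈ L, l.length = c) : L.flatten.length = L.length * c := by
  rw [List.length_flatten, List.map_congr_left h]
  simp

namespace CellularAutomaton

open RAM

variable {d : ℕ} (A : CellularAutomaton d)

theorem length_tableRow (p : Fin A.arity → Fin (A.maxState + 1)) :
    (A.tableRow p).length = A.arity + 1 := by
  simp [tableRow]

theorem tableSize_eq : A.tableSize = (A.arity + 1) * (A.maxState + 1) ^ A.arity := by
  rw [tableSize, table, List.length_flatten_of_length_eq (c := A.arity + 1), List.length_ofFn,
    mul_comm]
  intro l hl
  obtain ⟨r, rfl⟩ := (List.mem_ofFn' _ _).1 hl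
  exact A.length_tableRow _

theorem table_getD {r : ℕ} (hr : r < (A.maxState + 1) ^ A.arity) :
    A.table.getD (r * (A.arity + 1) + A.arity) 0 = ((A.rule (A.digits r) : ℕ) : ℤ) := by
  rw [table, List.getD_flatten_of_length_eq _ _ (Nat.lt_succ_self _)]
  · have h1 : (List.ofFn fun r : Fin ((A.maxState + 1) ^ A.arity) =>
        A.tableRow (finFunctionFinEquiv.symm r)).getD r [] = A.tableRow (A.digits r) := by
      rw [List.getD_eq_getElem _ _ (by simpa using hr), List.getElem_ofFn]
      rfl
    rw [h1, tableRow, List.getD_append_right _ _ _ _ (by simp)]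
    simp
  · intro l hl
    obtain ⟨r, rfl⟩ := (List.mem_ofFn' _ _).1 hl
    exact A.length_tableRow _

/-- The memory cells that describe the automaton. -/
def memory (A : CellularAutomaton d) : ℤ → ℤ := (initial A.encode).mem

theorem memory_natCast (n : ℕ) : A.memory n = A.encode.getD n 0 := by
  simp [memory, initial]

/-- The list of all coordinates of the neighbors. -/
def coordinates (A : CellularAutomaton d) : List ℤ :=
  (List.ofFn fun k => List.ofFn (A.neighbor k)).flatten

theorem length_coordinates : A.coordinates.length = A.arity * d := by
  rw [coordinates, List.length_flatten_of_length_eq (c := d), List.length_ofFn]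
  intro l hl
  obtain ⟨r, rfl⟩ := (List.mem_ofFn' _ _).1 hl
  simp

theorem encode_eq : A.encode =
    (d : ℤ) :: (A.arity : ℤ) :: (A.maxState : ℤ) :: (A.coordinates ++ A.table) := by
  simp [encode, coordinates]

theorem memory_zero : A.memory 0 = d := by
  have := A.memory_natCast 0
  rw [encode_eq] at this
  simpa using this

theorem memory_one : A.memory 1 = A.arity := by
  have := A.memory_natCast 1
  rw [encode_eq] at this
  simpa using this

theorem memory_two : A.memory 2 = A.maxState := by
  have := A.memory_natCast 2
  rw [encode_eq] at this
  simpa using this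

theorem memory_neighbor (i : Fin A.arity) (e : Fin d) :
    A.memory (vecAddr d i + (e : ℕ)) = A.neighbor i e := by
  have h1 : vecAddr d i + (e : ℕ) = ((i * d + e + 3 : ℕ) : ℤ) := by
    simp only [vecAddr]; push_cast; ring
  have hlt : (i : ℕ) * d + e < A.arity * d := by
    have := Nat.mul_le_mul_right d (Nat.succ_le_of_lt i.2)
    rw [Nat.succ_mul] at this
    omega
  rw [h1, memory_natCast, encode_eq, List.getD_cons_succ, List.getD_cons_succ,
    List.getD_cons_succ, List.getD_append _ _ _ _ (by rwa [length_coordinates]), coordinates,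
    List.getD_flatten_of_length_eq _ _ e.2]
  · rw [List.getD_eq_getElem (l := List.ofFn _) (n := i) _ (by simp), List.getElem_ofFn,
      List.getD_eq_getElem _ _ (by simp), List.getElem_ofFn]
  · intro l hl
    obtain ⟨r, rfl⟩ := (List.mem_ofFn' _ _).1 hl
    simp

theorem memory_rule {r : ℕ} (hr : r < (A.maxState + 1) ^ A.arity) :
    A.memory (vecAddr d A.arity + A.arity + (A.arity + 1) * r) =
      ((A.rule (A.digits r) : ℕ) : ℤ) := by
  have h1 : vecAddr d A.arity + A.arity + (A.arity + 1) * r =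
      ((A.coordinates.length + (r * (A.arity + 1) + A.arity) + 3 : ℕ) : ℤ) := by
    rw [length_coordinates]
    simp only [vecAddr]; push_cast; ring
  rw [h1, memory_natCast, encode_eq, List.getD_cons_succ, List.getD_cons_succ,
    List.getD_cons_succ, List.getD_append_right _ _ _ _ (by omega), Nat.add_sub_cancel_left,
    table_getD A hr]

/-- The input ends here, so the accumulators start at 0 without being cleared. -/
theorem memory_of_le {a : ℤ} (ha : vecAddr d A.arity + weight A.arity A.maxState A.arity ≤ a) :
    A.memory a = 0 := by
  have h0 := vecAddr_nonneg d A.arity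
  have h1 := weight_nonneg A.arity A.maxState A.arity
  lift a to ℕ using (by omega)
  rw [memory_natCast, List.getD_eq_default]
  have h2 : A.table.length = (A.arity + 1) * (A.maxState + 1) ^ A.arity := A.tableSize_eq
  rw [encode_eq, List.length_cons, List.length_cons, List.length_cons, List.length_append,
    length_coordinates, h2]
  simp only [vecAddr, weight] at ha
  zify
  linarith

variable {A}

theorem spread_eq_sum (p : Fin A.arity → Fin (A.maxState + 1)) (y : Fin d → ℤ) :
    (A.spread p y : ℕ) = ∑ l, if A.neighbor l = y then (p l : ℕ) else 0 := by
  classical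
  by_cases h : ∃ k, A.neighbor k = y
  · obtain ⟨k, rfl⟩ := h
    simp [spread_neighbor, A.neighbor.injective.eq_iff]
  · push Not at h
    simp [spread_of_notMem p h, h]

variable {M : ℤ → ℤ}

theorem balanced_iff (hM : ∀ a, 0 ≤ a → M a = A.memory a) (i l k j : Fin A.arity) :
    Balanced M d (vecAddr d i) (vecAddr d l) (vecAddr d k) (vecAddr d j) ↔
      A.neighbor l = A.neighbor j - A.neighbor k + A.neighbor i := by
  have h : ∀ (i : Fin A.arity) (e : Fin d), M (vecAddr d i + (e : ℕ)) = A.neighbor i e :=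
    fun i e => (hM _ (by have := vecAddr_nonneg d i; omega)).trans (A.memory_neighbor i e)
  constructor
  · intro hb
    funext e
    have := hb e e.2
    simp only [offset, h] at this
    simp only [Pi.add_apply, Pi.sub_apply]
    linarith
  · intro hx e he
    have := congrFun hx ⟨e, he⟩
    simp only [Pi.add_apply, Pi.sub_apply] at this
    simp only [offset]
    have h' : ∀ i : Fin A.arity, M (vecAddr d i + (e : ℕ)) = A.neighbor i ⟨e, he⟩ :=
      fun i => h i ⟨e, he⟩
    rw [h', h', h', h', this]
    ring

/-- For `l = j` the equation `x_i = x_l + x_k - x_j` has the unique solution `i = k`. So the leading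
digit enters the code with the weight of `k` and needs no search. -/
theorem shiftWeight_self (hM : ∀ a, 0 ≤ a → M a = A.memory a) (j k : Fin A.arity) :
    shiftWeight M d A.arity A.maxState j k j A.arity = weight A.arity A.maxState k := by
  classical
  rw [shiftWeight, Finset.sum_range, Finset.sum_eq_single_of_mem k (Finset.mem_univ k)]
  · rw [if_pos ((balanced_iff hM _ _ _ _).2 (by simp))]
  · intro i _ hik
    refine if_neg fun hb => hik (A.neighbor.injective ?_)
    have := (balanced_iff hM _ _ _ _).1 hb
    rw [sub_add_eq_add_sub, eq_sub_iff_add_eq] at this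
    exact (add_left_cancel this).symm

/-- Exchanging the sums over `l` and `i` collects, for each position `i` of the shifted window, the
digit of the neighbor seen there, or 0 if there is none. The factor is the length of a row. Only
nonnegative cells must agree with the input, as negative ones hold weights. -/
theorem shiftCode_eq (hM : ∀ a, 0 ≤ a → M a = A.memory a) (j k : Fin A.arity) (r : ℕ) :
    shiftCode M d A.arity A.maxState j k r =
      (A.arity + 1) * ((finFunctionFinEquiv (A.shifted j k (A.digits r)) : ℕ) : ℤ) := by
  classical
  rw [finFunctionFinEquiv_apply, shiftCode, Finset.sum_range]
  simp only [shiftWeight, Finset.sum_range, balanced_iff hM, shifted, spread_eq_sum, Finset.mul_sum,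
    Nat.cast_sum, Nat.cast_mul, Finset.sum_mul]
  rw [Finset.sum_comm]
  refine Finset.sum_congr rfl fun i _ => Finset.sum_congr rfl fun l _ => ?_
  split_ifs
  · simp only [digits, weight]
    push_cast
    ring
  · simp

theorem digits_finFunctionFinEquiv (p : Fin A.arity → Fin (A.maxState + 1)) :
    A.digits (finFunctionFinEquiv p) = p := by
  conv_rhs => rw [← finFunctionFinEquiv.symm_apply_apply p]
  rfl

theorem memory_shiftCode (hM : ∀ a, 0 ≤ a → M a = A.memory a) (j k : Fin A.arity) (r : ℕ) :
    M (shiftCode M d A.arity A.maxState j k r + (vecAddr d A.arity + A.arity)) =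
      ((A.rule (A.shifted j k (A.digits r)) : ℕ) : ℤ) := by
  have h := vecAddr_nonneg d A.arity
  rw [shiftCode_eq hM, add_comm, hM _ (by positivity), memory_rule A (Fin.is_lt _),
    digits_finFunctionFinEquiv]

theorem shiftCode_add_weight (hM : ∀ a, 0 ≤ a → M a = A.memory a) (j k : Fin A.arity) {x r : ℕ}
    (hx : x ≤ A.maxState) (hr : r < (A.maxState + 1) ^ (j : ℕ)) (F : ℤ) :
    shiftCode M d A.arity A.maxState j k r + (F + x * weight A.arity A.maxState k) =
      shiftCode M d A.arity A.maxState j k (x * (A.maxState + 1) ^ (j : ℕ) + r) + F := by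
  rw [shiftCode_add hx hr j.2, shiftWeight_self hM]
  ring

/-- With the leading digit included, the code is still the offset of an actual row, so the address
stays inside the table. -/
theorem inRange_memory (hM : ∀ a, 0 ≤ a → M a = A.memory a) :
    InRange M d A.arity A.maxState (vecAddr d A.arity + A.arity)
      (vecAddr d A.arity + weight A.arity A.maxState A.arity) := by
  intro j hj k hk x hx r hr
  have h := vecAddr_nonneg d A.arity
  have := shiftCode_add_weight hM ⟨j, hj⟩ ⟨k, hk⟩ hx hr (vecAddr d A.arity + A.arity)
  simp only at this
  rw [this]
  have h2 := shiftCode_eq hM ⟨j, hj⟩ ⟨k, hk⟩ (x * (A.maxState + 1) ^ j + r)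
  simp only at h2
  rw [h2]
  set i := finFunctionFinEquiv
    (A.shifted ⟨j, hj⟩ ⟨k, hk⟩ (A.digits (x * (A.maxState + 1) ^ j + r)))
  have hi : ((i : ℕ) : ℤ) + 1 ≤ (A.maxState + 1) ^ A.arity := by exact_mod_cast i.2
  have h3 := mul_le_mul_of_nonneg_left hi (by positivity : (0 : ℤ) ≤ A.arity + 1)
  constructor
  · positivity
  · simp only [weight]
    linarith

theorem change_eq (hM : ∀ a, 0 ≤ a → M a = A.memory a) (j k : Fin A.arity) {x r : ℕ}
    (hx : x < A.maxState) (hr : r < (A.maxState + 1) ^ (j : ℕ)) :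
    change M d A.arity A.maxState (vecAddr d A.arity + A.arity) j k x r =
      ((A.rule (A.shifted j k (A.digits ((x + 1) * (A.maxState + 1) ^ (j : ℕ) + r))) : ℕ) : ℤ) -
        ((A.rule (A.shifted j k (A.digits r)) : ℕ) : ℤ) -
          if (k : ℕ) = 0 then ((x + 1 : ℕ) : ℤ) else 0 := by
  rw [change, shiftCode_add_weight hM j k hx hr, memory_shiftCode hM, memory_shiftCode hM]
  split_ifs <;> simp

/-- The tests are the row equations for `k₀ = 0`, with `x + 1` as the nonzero leading state `a`. -/
theorem passes_iff (hA : 0 < A.arity) (hM : ∀ a, 0 ≤ a → M a = A.memory a) :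
    Passes M d A.arity A.maxState (vecAddr d A.arity + A.arity) ↔ A.FiniteNumberConserving := by
  rw [finiteNumberConserving_iff_forall_row ⟨0, hA⟩, Passes]
  refine and_congr ?_ ?_
  · have h := vecAddr_nonneg d A.arity
    have := A.memory_rule (r := 0) (by positivity)
    rw [Nat.cast_zero, mul_zero, add_zero, digits_zero] at this
    rw [hM _ (by positivity), this, Fin.ext_iff]
    simp
  · constructor
    · intro h j a ha r hr
      have ha' : (a : ℕ) ≠ 0 := fun hh => ha (Fin.ext hh)
      obtain ⟨x, hx⟩ := Nat.exists_eq_succ_of_ne_zero ha'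
      have hxm : x < A.maxState := by have := a.2; omega
      have := h j j.2 x hxm r hr
      rw [totalChange, Finset.sum_range] at this
      simp only [change_eq hM j _ hxm hr] at this
      simpa only [hx, Fin.ext_iff] using this
    · intro h j hj x hx r hr
      have := h ⟨j, hj⟩ ⟨x + 1, by omega⟩ (fun hh => by simp [Fin.ext_iff] at hh) r hr
      rw [totalChange, Finset.sum_range]
      have hc := fun k => change_eq hM ⟨j, hj⟩ k hx hr
      simp only at hc
      simp only [hc]
      simpa only [Fin.ext_iff] using this

theorem finiteNumberConserving_of_maxState_eq_zero (h : A.maxState = 0) :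
    A.FiniteNumberConserving := by
  have hc : ∀ (c : A.Config) (i : Fin d → ℤ), c i = 0 := fun c i => by
    have := (c i).2
    exact Fin.ext (by simp only [Fin.val_zero]; omega)
  intro c _
  simp [hc]

end CellularAutomaton

/-! ### Running time and correctness of the whole program. -/

namespace RAM

/-- Absorbs the search over quadruples of neighbors. The quotient of `v ^ 4` by `2 ^ v` is largest
at `v = 6`, where it is 20.25. -/
theorem pow_four_le (v : ℕ) : v ^ 4 ≤ 21 * 2 ^ v := by
  rcases Nat.lt_or_ge v 6 with h | h
  · interval_cases v <;> norm_num
  · induction v, h using Nat.le_induction with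
    | base => norm_num
    | succ n hn ih =>
      -- This holds from `n = 6` on, but not yet for `n = 5`.
      have h1 : (n + 1) ^ 4 ≤ 2 * n ^ 4 := by
        obtain ⟨e, rfl⟩ := Nat.exists_eq_add_of_le hn
        ring_nf
        nlinarith [Nat.zero_le e, Nat.zero_le (e ^ 2), Nat.zero_le (e ^ 3), Nat.zero_le (e ^ 4)]
      rw [pow_succ 2]
      omega

theorem sum_translateTime_le {d v m : ℕ} (hm : 0 < m) (hv : 0 < v) :
    ∑ j ∈ Finset.range v, (v * (translateTime d v m j + 1) + 12) ≤
      (21 * (d * 18 + 57) + 68) * ((v + 1) * (m + 1) ^ v) := by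
  have h1 : ∑ j ∈ Finset.range v, (v * (translateTime d v m j + 1) + 12) =
      v * (v * (v * (v * (d * 18 + 15) + 13) + 17) + 12) +
        34 * v * ∑ j ∈ Finset.range v, (m + 1) ^ (j + 1) := by
    simp only [translateTime, Finset.sum_add_distrib, Finset.mul_sum, mul_add, Finset.sum_const,
      Finset.card_range, smul_eq_mul]
    have : ∀ x, v * (34 * (m + 1) ^ (x + 1)) = 34 * v * (m + 1) ^ (x + 1) := fun x => by ring
    simp only [this]
    ring
  have h2 : ∑ j ∈ Finset.range v, (m + 1) ^ (j + 1) ≤ 2 * (m + 1) ^ v := by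
    rw [← sum_mul_pow_le m v]
    have : ∑ j ∈ Finset.range v, (m + 1) ^ (j + 1) ≤
        ∑ j ∈ Finset.range v, 2 * (m * (m + 1) ^ j) := by
      refine Finset.sum_le_sum fun j _ => ?_
      rw [pow_succ, mul_comm, ← mul_assoc]
      exact Nat.mul_le_mul_right _ (by omega)
    rw [← Finset.mul_sum] at this
    omega
  have h3 : v * (v * (v * (v * (d * 18 + 15) + 13) + 17) + 12) ≤ v ^ 4 * (d * 18 + 57) := by
    have e1 : v ^ 1 ≤ v ^ 4 := Nat.pow_le_pow_right hv (by norm_num)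
    have e2 : v ^ 2 ≤ v ^ 4 := Nat.pow_le_pow_right hv (by norm_num)
    have e3 : v ^ 3 ≤ v ^ 4 := Nat.pow_le_pow_right hv (by norm_num)
    have e : v * (v * (v * (v * (d * 18 + 15) + 13) + 17) + 12) =
      v ^ 4 * (d * 18 + 15) + 13 * v ^ 3 + 17 * v ^ 2 + 12 * v ^ 1 := by ring
    have e' : v ^ 4 * (d * 18 + 57) = v ^ 4 * (d * 18 + 15) + 42 * v ^ 4 := by ring
    rw [e, e']
    omega
  -- Here at least two states are needed; with one state the table has only `v + 1` entries.
  have h4 : v ^ 4 ≤ 21 * (m + 1) ^ v :=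
    (pow_four_le v).trans (Nat.mul_le_mul_left _ (Nat.pow_le_pow_left (by omega) v))
  rw [h1]
  set Q := (m + 1) ^ v
  calc _ ≤ 21 * Q * (d * 18 + 57) + 34 * v * (2 * Q) :=
        Nat.add_le_add (h3.trans (Nat.mul_le_mul_right _ h4)) (Nat.mul_le_mul_left _ h2)
    _ ≤ 21 * Q * (d * 18 + 57) + 34 * v * (2 * Q) + (21 * (d * 18 + 57) * (v * Q) + 68 * Q) :=
        Nat.le_add_right _ _
    _ = _ := by ring

theorem mainTime_le {d v m : ℕ} (hm : 0 < m) (hv : 0 < v) :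
    mainTime d v m + 10 ≤ (21 * (d * 18 + 57) + 200) * ((v + 1) * (m + 1) ^ v) := by
  have h1 := sum_translateTime_le (d := d) hm hv
  have h2 : m + 1 ≤ (m + 1) ^ v := Nat.le_self_pow hv.ne' _
  have h3 : v * m ≤ v * (m + 1) ^ v := Nat.mul_le_mul_left v (by omega)
  have h4 : v * 1 ≤ v * (m + 1) ^ v := Nat.mul_le_mul_left v (by omega)
  have h5 : v * (m * 3 + 7) = 3 * (v * m) + 7 * v := by ring
  have h6 : (v + 1) * (m + 1) ^ v = v * (m + 1) ^ v + (m + 1) ^ v := by ring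
  rw [add_mul] at h1 ⊢
  unfold mainTime
  omega

theorem decider_spec {d : ℕ} (A : CellularAutomaton d) (hA : 0 < A.arity) {B : ℕ}
    (hB : vecAddr d A.arity + 2 * weight A.arity A.maxState A.arity +
      ((A.maxState + 1) ^ A.arity : ℕ) ≤ B) :
    Ends B decider (initial A.encode) ((21 * (d * 18 + 57) + 200) * A.tableSize) fun s' =>
      (s'.reg 0 = 1 ↔ A.FiniteNumberConserving) := by
  have h0 : ∀ x, (initial A.encode).reg x = 0 := fun _ => rfl
  have hm : (initial A.encode).mem = A.memory := rfl
  have k0 := A.memory_zero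
  have k1 := A.memory_one
  have k2 := A.memory_two
  have hD := weight_nonneg A.arity A.maxState A.arity
  have hB3 : (3 : ℤ) ≤ B := by
    have : (3 : ℤ) ≤ vecAddr d A.arity := by 
      simp only [vecAddr]
      have : (0 : ℤ) ≤ (A.arity : ℤ) * d := by positivity
      linarith
    omega
  have hsize : 1 ≤ A.tableSize := by
    rw [A.tableSize_eq]; exact Nat.mul_pos (Nat.succ_pos _) (by positivity)
  obtain ⟨W, hW⟩ : ∃ W, (21 * (d * 18 + 57) + 200) * A.tableSize = W + 10 := by
    have := Nat.mul_le_mul_left (21 * (d * 18 + 57) + 200) hsize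
    exact ⟨(21 * (d * 18 + 57) + 200) * A.tableSize - 10, by omega⟩
  rw [hW]
  unfold decider
  repeat
    first
    | refine Ends.add_seq ?_
    | refine Ends.sub_seq ?_
    | refine Ends.const_seq ?_
    | refine Ends.ite_const_seq (by decide) ?_
    | refine Ends.load_seq (by
        simp only [State.reg_setReg, State.mem_setReg, State.reg_setMem, Nat.reduceEqDiff,
          reduceIte, h0, hm, k0, k1, k2]; omega) ?_
    try simp only [State.reg_setReg, State.mem_setReg, State.reg_setMem, Nat.reduceEqDiff,
      reduceIte, h0, hm, k0, k1, k2]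
  refine (Ends.ite (T := W + 2) (fun hx => ?_) fun hx => ?_)
  · simp only [State.reg_setReg, Nat.reduceEqDiff, reduceIte] at hx
    have hM : ∀ a, 0 ≤ a →
        withWeights A.memory A.arity A.maxState A.arity a = A.memory a := fun a ha =>
      withWeights_of_nonneg ha
    refine (mainCase_spec (d := d) (v := A.arity) (m := A.maxState) (by exact_mod_cast hx) hA ?_ ?_
      ?_ ?_ ?_ ?_ ?_ hB ?_ ?_).mono ?_ fun s' h => ?_
    iterate 7
      simp only [State.reg_setReg, Nat.reduceEqDiff, reduceIte, h0]
    · exact CellularAutomaton.inRange_memory hM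
    · exact fun a ha => A.memory_of_le ha
    · have := mainTime_le (d := d) (v := A.arity) (m := A.maxState) (by exact_mod_cast hx) hA
      rw [← A.tableSize_eq] at this
      omega
    · exact h.trans (CellularAutomaton.passes_iff hA hM)
  · simp only [State.reg_setReg, Nat.reduceEqDiff, reduceIte] at hx
    -- With a single state everything is conserved, and the answer 1 already stands in register 0.
    refine (Ends.const ?_).mono (by omega) fun _ h => h
    simp only [State.reg_setReg, Nat.reduceEqDiff, reduceIte, true_iff]
    exact CellularAutomaton.finiteNumberConserving_of_maxState_eq_zero (by omega)

end RAM

/-! ### The two time bounds and the three notions of conservation. -/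

theorem mainTheorem2 :
    ∃ P : RAM.Prog, ∀ d : ℕ, ∃ C : ℕ, ∀ A : CellularAutomaton d, 0 < A.arity →
      ∃ (s : RAM.State) (t u : ℕ),
        RAM.Exec RAM.constantAccess P (RAM.initial A.encode) s t ∧
        t ≤ C * A.tableSize ∧
        RAM.Exec RAM.logarithmicAccess P (RAM.initial A.encode) s u ∧
        u ≤ C * (A.tableSize * Nat.log 2 A.tableSize) ∧
        (s.reg 0 = 1 ↔ A.FiniteNumberConserving) ∧
        (s.reg 0 = 1 ↔ A.PeriodicNumberConserving) ∧
        (d = 1 → (s.reg 0 = 1 ↔ A.WindowNumberConserving)) := by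
  -- The second factor bounds the number of steps per table entry; `d + 9` is the price of a
  -- logarithmic access in units of `Nat.log 2 A.tableSize`.
  refine ⟨RAM.decider, fun d => ⟨(d + 9) * (21 * (d * 18 + 57) + 200), fun A hA => ?_⟩⟩
  set C := 21 * (d * 18 + 57) + 200
  have hsize := A.tableSize_eq
  set v := A.arity with hv
  set Q := (A.maxState + 1) ^ v with hQ
  have hQpos : 0 < Q := by positivity
  have hexp : A.tableSize = v * Q + Q := by rw [hsize]; ring
  have hvQ : v ≤ v * Q := Nat.le_mul_of_pos_right v hQpos
  have hs2 : 2 ≤ A.tableSize := by omega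
  have hlog : 1 ≤ Nat.log 2 A.tableSize := Nat.le_log_of_pow_le (by norm_num) hs2
  obtain ⟨s, hs, hruns⟩ := RAM.decider_spec A hA (B := (d + 6) * A.tableSize) (by
    have h1 : v * d ≤ d * A.tableSize := by
      rw [mul_comm]; exact Nat.mul_le_mul_left d (by omega)
    have h2 : RAM.weight v A.maxState v = A.tableSize := by
      rw [hsize, RAM.weight]; push_cast; rfl
    rw [← hv, ← hQ, h2]
    simp only [RAM.vecAddr]
    have h3 : 3 + v * d + 2 * A.tableSize + Q ≤ (d + 6) * A.tableSize := by
      rw [add_mul]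
      omega
    exact_mod_cast h3)
  obtain ⟨t, ht, het⟩ := hruns RAM.constantAccess 1 le_rfl fun _ _ => le_rfl
  -- The same run, with the same final state, is charged with the cost of the largest address for
  -- every step.
  obtain ⟨u, hu, heu⟩ := hruns RAM.logarithmicAccess (Nat.size ((d + 6) * A.tableSize) + 1)
    (by omega) fun a ha => Nat.succ_le_succ (Nat.size_le_size ha)
  have hK : Nat.size ((d + 6) * A.tableSize) + 1 ≤ (d + 9) * Nat.log 2 A.tableSize := by
    -- Since `d + 6 < 2 ^ (d + 6)`, the address bound adds at most `d + 6` digits; the additive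
    -- constant is then absorbed by `1 ≤ Nat.log 2 A.tableSize`.
    have h1 : Nat.size ((d + 6) * A.tableSize) ≤ d + 6 + (Nat.log 2 A.tableSize + 1) := by
      rw [Nat.size_le, pow_add]
      exact Nat.mul_lt_mul'' Nat.lt_two_pow_self (Nat.lt_pow_succ_log_self (by norm_num) _)
    have h2 : (d + 8) * 1 ≤ (d + 8) * Nat.log 2 A.tableSize := Nat.mul_le_mul_left _ hlog
    have h3 : (d + 9) * Nat.log 2 A.tableSize =
      (d + 8) * Nat.log 2 A.tableSize + Nat.log 2 A.tableSize := by ring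
    omega
  refine ⟨s, t, u, het, ?_, heu, ?_, hs, ?_, ?_⟩
  · refine ht.trans ?_
    rw [one_mul, mul_assoc]
    exact Nat.le_mul_of_pos_left _ (by omega)
  · refine hu.trans ((Nat.mul_le_mul_right _ hK).trans_eq ?_)
    ring
  · exact hs.trans ⟨CellularAutomaton.periodic_of_finite,
      CellularAutomaton.finite_of_periodic hA⟩
  · rintro rfl
    exact hs.trans ⟨CellularAutomaton.window_of_finite, CellularAutomaton.finite_of_window⟩
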